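/- Let $d\ge 1$ be an integer, let $\alpha\ge 1$ be real, put $\mathbb R^d_+=(0,\infty)^d$ and $|n|=n_1+\dots+n_d$ for $n\in\mathbb N_0^d$; multi-index powers are products over the coordinates, with $0^0=1$. Let $\mathcal S(\mathbb R^d_+)$ be the space of all $f\in C^\infty(\mathbb R^d_+)$ (complex valued) such that every derivative $D^pf$, $p\in\mathbb N_0^d$, extends to a continuous function on $[0,\infty)^d$ and $\sup_{x\in\mathbb R^d_+}x^k|D^pf(x)|<\infty$ for all $k,p\in\mathbb N_0^d$. For $A>0$ let $G^{\alpha,A}_{\alpha,A}(\mathbb R^d_+)$ be the space of all $f\in\mathcal S(\mathbb R^d_+)$ with $$\sup_{p,k\in\mathbb N_0^d}\frac{\|t^{(p+k)/2}D^pf(t)\|_{L^2(\mathbb R^d_+)}}{A^{|p+k|}\,k^{(\alpha/2)k}\,p^{(\alpha/2)p}}<\infty ,$$ topologized by the seminorms $$\sigma_{A,j}(f)=\sup_{p,k\in\mathbb N_0^d}\frac{\|t^{(p+k)/2}D^pf(t)\|_{L^2(\mathbb R^d_+)}}{A^{|p+k|}k^{(\alpha/2)k}p^{(\alpha/2)p}}+\sup_{|p|\le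 j,\,|k|\le j}\ \sup_{t\in\mathbb R^d_+}|t^kD^pf(t)|,\qquad j\in\mathbb N_0,$$ and let $G^\alpha_\alpha(\mathbb R^d_+)=\varinjlim_{A\to\infty}G^{\alpha,A}_{\alpha,A}(\mathbb R^d_+)$ be the locally convex inductive limit (the union with the finest locally convex topology making all inclusions continuous). For $a>1$ let $s^{\alpha,a}$ be the Banach space of all complex sequences $(u_n)_{n\in\mathbb N_0^d}$ with norm $\sup_n|u_n|\,a^{|n|^{1/\alpha}}<\infty$, and let $s^\alpha=\varinjlim_{a\to1^+}s^{\alpha,a}$ be the locally convex inductive limit. For $n\in\mathbb N_0^d$ let $\mathcal L_n(t)=\prod_{l=1}^dL_{n_l}(t_l)e^{-t_l/2}$, $t\in\mathbb R^d_+$, where $L_m(t)=\frac{e^t}{m!}\frac{d^m}{dt^m}(e^{-t}t^m)$, and put $\langle f,\mathcal L_n\rangle=\int_{\mathbb R^d_+}f(t)\mathcal L_n(t)\,dt$. A $(DFN)$-space is a nuclear $(DFS)$-space, i.e. a nuclear locally convex space that is the locally convex inductive limit of an injective sequence of Banach spaces with compact linking maps; an $(FN)$-space is a nuclear Fréchet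 space. **Theorem.** 1. For every $f\in G^\alpha_\alpha(\mathbb R^d_+)$ and every $n\in\mathbb N_0^d$ the function $f\mathcal L_n$ is integrable on $\mathbb R^d_+$, and the mapping $\iota(f)=(\langle f,\mathcal L_n\rangle)_{n\in\mathbb N_0^d}$ is a topological isomorphism (a linear homeomorphism) from $G^\alpha_\alpha(\mathbb R^d_+)$ onto $s^\alpha$. 2. $G^\alpha_\alpha(\mathbb R^d_+)$ is a $(DFN)$-space, and its strong dual is an $(FN)$-space. 3. Every $\mathcal L_n$ belongs to $G^\alpha_\alpha(\mathbb R^d_+)$, and for each $f\in G^\alpha_\alpha(\mathbb R^d_+)$ the family $(\langle f,\mathcal L_n\rangle\mathcal L_n)_{n\in\mathbb N_0^d}$ is (unconditionally) summable to $f$ in $G^\alpha_\alpha(\mathbb R^d_+)$. -/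

import Mathlib

open MeasureTheory Topology Filter Set
open scoped ENNReal NNReal ContDiff

namespace LaguerreExpansion

/-! ### Locally convex spaces: inductive limits, nuclear spaces, (DFN)- and (FN)-spaces -/

/-- The locally convex inductive limit topology on `E` defined by linear maps `j i : X i → E`:
the finest locally convex vector space topology on `E` for which all `j i` are continuous.
(In Mathlib's order on topologies, finer means smaller.) -/
@[reducible] def lcIndTopology {ι : Type*} {E : Type*} [AddCommGroup E] [Module ℂ E]
    {X : ι → Type*} [∀ i, AddCommGroup (X i)] [∀ i, Module ℂ (X i)]
    [∀ i, TopologicalSpace (X i)] (j : ∀ i, X i →ₗ[ℂ] E) : TopologicalSpace E :=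
  sInf {t : TopologicalSpace E |
    @IsTopologicalAddGroup E t _ ∧ @ContinuousSMul ℂ E _ _ t ∧
    @LocallyConvexSpace ℝ E _ _ _ _ t ∧ ∀ i, @Continuous (X i) E _ t (j i)}

/-- A continuous linear map between normed spaces is nuclear if it has a representation
`T x = ∑ f_m(x) y_m` with `∑ ‖f_m‖ ‖y_m‖ < ∞`. -/
def IsNuclearMap {X Y : Type*} [NormedAddCommGroup X] [NormedSpace ℂ X]
    [NormedAddCommGroup Y] [NormedSpace ℂ Y] (T : X →L[ℂ] Y) : Prop :=
  ∃ (f : ℕ → StrongDual ℂ X) (y : ℕ → Y),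
    Summable (fun m => ‖f m‖ * ‖y m‖) ∧ ∀ x, HasSum (fun m => f m x • y m) (T x)

/-- The space `E` regarded as a seminormed space with the seminorm `p`. -/
def SeminormedBy {E : Type*} [AddCommGroup E] [Module ℂ E] (_p : Seminorm ℂ E) : Type _ := E

instance {E : Type*} [AddCommGroup E] [Module ℂ E] (p : Seminorm ℂ E) :
    SeminormedAddCommGroup (SeminormedBy p) :=
  p.toAddGroupSeminorm.toSeminormedAddCommGroup

instance {E : Type*} [AddCommGroup E] [Module ℂ E] (p : Seminorm ℂ E) :
    Module ℂ (SeminormedBy p) :=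
  inferInstanceAs (Module ℂ E)

instance {E : Type*} [AddCommGroup E] [Module ℂ E] (p : Seminorm ℂ E) :
    NormedSpace ℂ (SeminormedBy p) where
  norm_smul_le c x := (map_smul_eq_mul p c x).le

/-- The local Banach space of the seminorm `p`: the (Hausdorff) completion of `E` for `p`, that is,
the completion of the normed space `E / ker p`. -/
abbrev LocalBanach {E : Type*} [AddCommGroup E] [Module ℂ E] (p : Seminorm ℂ E) : Type _ :=
  UniformSpace.Completion (SeminormedBy p)

/-- The canonical map between local Banach spaces for `p ≤ q`: the continuous extension of the
identity of `E`. -/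
noncomputable def localMap {E : Type*} [AddCommGroup E] [Module ℂ E] {p q : Seminorm ℂ E}
    (h : p ≤ q) : LocalBanach q →L[ℂ] LocalBanach p :=
  ContinuousLinearMap.completion
    (LinearMap.mkContinuous
      ({ toFun := fun x => x, map_add' := fun _ _ => rfl, map_smul' := fun _ _ => rfl } :
        SeminormedBy q →ₗ[ℂ] SeminormedBy p) 1
      (fun x => by rw [one_mul]; exact h x))

/-- Nuclear spaces: Hausdorff locally convex spaces such that for every continuous seminorm `p`
there is a continuous seminorm `q ≥ p` for which the canonical map of the local Banach space of
`q` into that of `p` is nuclear. -/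
structure IsNuclearSpace (E : Type*) [AddCommGroup E] [Module ℂ E] [TopologicalSpace E] :
    Prop where
  topologicalAddGroup : IsTopologicalAddGroup E
  continuousSMul : ContinuousSMul ℂ E
  locallyConvex : LocallyConvexSpace ℝ E
  t2 : T2Space E
  nuclear : ∀ p : Seminorm ℂ E, Continuous p →
    ∃ q : Seminorm ℂ E, Continuous q ∧ ∃ h : p ≤ q, IsNuclearMap (localMap h)

/-- Fréchet spaces: locally convex, metrizable and complete. -/
structure IsFrechetSpace (E : Type*) [AddCommGroup E] [Module ℂ E] [TopologicalSpace E] :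
    Prop where
  topologicalAddGroup : IsTopologicalAddGroup E
  continuousSMul : ContinuousSMul ℂ E
  locallyConvex : LocallyConvexSpace ℝ E
  metrizable : TopologicalSpace.MetrizableSpace E
  complete : @CompleteSpace E (IsTopologicalAddGroup.rightUniformSpace E)

/-- (DFS)-spaces: locally convex inductive limits of an injective sequence of Banach spaces with
compact linking maps. -/
def IsDFS (E : Type) [AddCommGroup E] [Module ℂ E] [t : TopologicalSpace E] : Prop :=
  ∃ (X : ℕ → Type) (_ : ∀ m, NormedAddCommGroup (X m)) (_ : ∀ m, NormedSpace ℂ (X m))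
    (_ : ∀ m, CompleteSpace (X m)) (u : ∀ m, X m →L[ℂ] X (m + 1)) (j : ∀ m, X m →ₗ[ℂ] E),
    (∀ m, IsCompactOperator (u m)) ∧
    (∀ m, Function.Injective (j m)) ∧
    (∀ m x, j (m + 1) (u m x) = j m x) ∧
    (∀ y : E, ∃ m x, j m x = y) ∧
    t = lcIndTopology j

/-- (DFN)-spaces: nuclear (DFS)-spaces. -/
def IsDFN (E : Type) [AddCommGroup E] [Module ℂ E] [TopologicalSpace E] : Prop :=
  IsNuclearSpace E ∧ IsDFS E

/-- (FN)-spaces: nuclear Fréchet spaces. -/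
def IsFN (E : Type) [AddCommGroup E] [Module ℂ E] [TopologicalSpace E] : Prop :=
  IsNuclearSpace E ∧ IsFrechetSpace E

/-- A finite `ℝ≥0∞`-valued functional with the properties of a seminorm, as a seminorm. -/
noncomputable def seminormOfENNReal {E : Type*} [AddCommGroup E] [Module ℂ E] (N : E → ℝ≥0∞)
    (hfin : ∀ x, N x < ⊤) (hadd : ∀ x y, N (x + y) ≤ N x + N y)
    (hsmul : ∀ (c : ℂ) x, N (c • x) ≤ ‖c‖ₑ * N x) : Seminorm ℂ E :=
  Seminorm.ofSMulLE (fun x => (N x).toReal)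
    (by
      have h := hsmul 0 0
      simp only [smul_zero, enorm_zero, zero_mul, nonpos_iff_eq_zero] at h
      simp [h])
    (fun x y => by
      rw [← ENNReal.toReal_add (hfin x).ne (hfin y).ne]
      exact ENNReal.toReal_mono (ENNReal.add_ne_top.2 ⟨(hfin x).ne, (hfin y).ne⟩) (hadd x y))
    (fun c x => by
      have h := ENNReal.toReal_mono (ENNReal.mul_ne_top enorm_ne_top (hfin x).ne) (hsmul c x)
      simpa [ENNReal.toReal_mul] using h)

/-! ### The sequence spaces -/

/-- The weighted supremum norm `sup_n |u_n| a^{|n|^{1/α}}`, with values in `[0, ∞]`. -/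
noncomputable def seqNorm (d : ℕ) (α a : ℝ) (u : (Fin d → ℕ) → ℂ) : ℝ≥0∞ :=
  ⨆ n : Fin d → ℕ, ‖u n‖ₑ * ENNReal.ofReal (a ^ (((∑ i, n i : ℕ) : ℝ) ^ (1 / α)))

theorem seqNorm_add (d : ℕ) (α a : ℝ) (u v : (Fin d → ℕ) → ℂ) :
    seqNorm d α a (u + v) ≤ seqNorm d α a u + seqNorm d α a v := by
  refine iSup_le fun n => ?_
  calc ‖(u + v) n‖ₑ * ENNReal.ofReal (a ^ (((∑ i, n i : ℕ) : ℝ) ^ (1 / α)))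
      ≤ (‖u n‖ₑ + ‖v n‖ₑ) * ENNReal.ofReal (a ^ (((∑ i, n i : ℕ) : ℝ) ^ (1 / α))) := by
        gcongr
        exact enorm_add_le _ _
    _ ≤ _ := by
        rw [add_mul]
        exact add_le_add
          (le_iSup (fun n : Fin d → ℕ =>
            ‖u n‖ₑ * ENNReal.ofReal (a ^ (((∑ i, n i : ℕ) : ℝ) ^ (1 / α)))) n)
          (le_iSup (fun n : Fin d → ℕ =>
            ‖v n‖ₑ * ENNReal.ofReal (a ^ (((∑ i, n i : ℕ) : ℝ) ^ (1 / α)))) n)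

theorem seqNorm_smul (d : ℕ) (α a : ℝ) (c : ℂ) (u : (Fin d → ℕ) → ℂ) :
    seqNorm d α a (c • u) ≤ ‖c‖ₑ * seqNorm d α a u := by
  refine iSup_le fun n => ?_
  rw [Pi.smul_apply, smul_eq_mul, enorm_mul, mul_assoc]
  gcongr
  exact le_iSup (fun n : Fin d → ℕ =>
    ‖u n‖ₑ * ENNReal.ofReal (a ^ (((∑ i, n i : ℕ) : ℝ) ^ (1 / α)))) n

theorem seqNorm_zero (d : ℕ) (α a : ℝ) : seqNorm d α a 0 = 0 := by
  simp [seqNorm]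

theorem seqNorm_mono (d : ℕ) (α : ℝ) {a b : ℝ} (ha : 0 ≤ a) (hab : a ≤ b)
    (u : (Fin d → ℕ) → ℂ) : seqNorm d α a u ≤ seqNorm d α b u := by
  unfold seqNorm
  gcongr

/-- The sequences with finite weighted norm. -/
def seqStepSubmodule (d : ℕ) (α a : ℝ) : Submodule ℂ ((Fin d → ℕ) → ℂ) where
  carrier := {u | seqNorm d α a u < ⊤}
  zero_mem' := by simp [seqNorm_zero]
  add_mem' hu hv := (seqNorm_add d α a _ _).trans_lt (ENNReal.add_lt_top.2 ⟨hu, hv⟩)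
  smul_mem' c u hu := (seqNorm_smul d α a c u).trans_lt (ENNReal.mul_lt_top enorm_lt_top hu)

/-- The Banach space `s^{α,a}`, `a > 1`. -/
def SeqStep (d : ℕ) (α : ℝ) (a : Ioi (1 : ℝ)) : Type := seqStepSubmodule d α a

noncomputable instance (d : ℕ) (α : ℝ) (a : Ioi (1 : ℝ)) : AddCommGroup (SeqStep d α a) :=
  inferInstanceAs (AddCommGroup (seqStepSubmodule d α a))

noncomputable instance (d : ℕ) (α : ℝ) (a : Ioi (1 : ℝ)) : Module ℂ (SeqStep d α a) :=
  inferInstanceAs (Module ℂ (seqStepSubmodule d α a))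

/-- The norm of `s^{α,a}`. -/
noncomputable def seqStepNorm (d : ℕ) (α : ℝ) (a : Ioi (1 : ℝ)) : Seminorm ℂ (SeqStep d α a) :=
  seminormOfENNReal (fun u => seqNorm d α a u.1) (fun u => u.2)
    (fun u v => seqNorm_add d α a u.1 v.1) (fun c u => seqNorm_smul d α a c u.1)

/-- The topology of `s^{α,a}` is the one given by its norm. -/
noncomputable instance (d : ℕ) (α : ℝ) (a : Ioi (1 : ℝ)) : TopologicalSpace (SeqStep d α a) :=
  (SeminormFamily.moduleFilterBasis (fun _ : Unit => seqStepNorm d α a)).topology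

/-- The union of the spaces `s^{α,a}`, `a > 1`. -/
def seqSubmodule (d : ℕ) (α : ℝ) : Submodule ℂ ((Fin d → ℕ) → ℂ) where
  carrier := {u | ∃ a : ℝ, 1 < a ∧ u ∈ seqStepSubmodule d α a}
  zero_mem' := ⟨2, one_lt_two, zero_mem _⟩
  add_mem' := by
    rintro u v ⟨a, ha, hu⟩ ⟨b, hb, hv⟩
    have h0 : 0 ≤ min a b := (zero_lt_one.trans (lt_min ha hb)).le
    exact ⟨min a b, lt_min ha hb, add_mem
      ((seqNorm_mono d α h0 (min_le_left _ _) _).trans_lt hu)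
      ((seqNorm_mono d α h0 (min_le_right _ _) _).trans_lt hv)⟩
  smul_mem' := by
    rintro c u ⟨a, ha, hu⟩
    exact ⟨a, ha, Submodule.smul_mem _ c hu⟩

/-- The space `s^α`. -/
def SeqSpace (d : ℕ) (α : ℝ) : Type := seqSubmodule d α

noncomputable instance (d : ℕ) (α : ℝ) : AddCommGroup (SeqSpace d α) :=
  inferInstanceAs (AddCommGroup (seqSubmodule d α))

noncomputable instance (d : ℕ) (α : ℝ) : Module ℂ (SeqSpace d α) :=
  inferInstanceAs (Module ℂ (seqSubmodule d α))

/-- The inclusion of `s^{α,a}` into `s^α`. -/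
def seqIncl (d : ℕ) (α : ℝ) (a : Ioi (1 : ℝ)) : SeqStep d α a →ₗ[ℂ] SeqSpace d α :=
  Submodule.inclusion (p := seqStepSubmodule d α a) (p' := seqSubmodule d α)
    (fun _ hu => ⟨a, a.2, hu⟩)

/-- `s^α` carries the inductive limit topology of the spaces `s^{α,a}`, `a → 1+`. -/
noncomputable instance (d : ℕ) (α : ℝ) : TopologicalSpace (SeqSpace d α) :=
  lcIndTopology (seqIncl d α)

/-! ### The function spaces -/

/-- `ℝ^d_+ = (0, ∞)^d`. -/
def orthant (d : ℕ) : Set (Fin d → ℝ) := {x | ∀ i, 0 < x i}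

/-- `[0, ∞)^d`, the closure of `ℝ^d_+`. -/
def closedOrthant (d : ℕ) : Set (Fin d → ℝ) := {x | ∀ i, 0 ≤ x i}

theorem isOpen_orthant (d : ℕ) : IsOpen (orthant d) := by
  simp only [orthant, ofPred_forall]
  exact isOpen_iInter_of_finite fun i => isOpen_lt continuous_const (continuous_apply i)

/-- The partial derivative `∂/∂t_i`. -/
noncomputable def partialDeriv {d : ℕ} (i : Fin d) (f : (Fin d → ℝ) → ℂ) : (Fin d → ℝ) → ℂ :=
  fun x => lineDeriv ℝ f x (Pi.single i 1)

/-- The iterated partial derivative `D^p` (for smooth functions the order is irrelevant). -/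
noncomputable def multiDeriv {d : ℕ} (p : Fin d → ℕ) (f : (Fin d → ℝ) → ℂ) :
    (Fin d → ℝ) → ℂ :=
  (List.finRange d).foldr (fun i g => (partialDeriv i)^[p i] g) f

section derivatives

variable {d : ℕ} {f g : (Fin d → ℝ) → ℂ}

theorem partialDeriv_contDiffOn (i : Fin d) (hf : ContDiffOn ℝ ∞ f (orthant d)) :
    ContDiffOn ℝ ∞ (partialDeriv i f) (orthant d) := by
  have h : ContDiffOn ℝ ∞ (fun x => fderiv ℝ f x (Pi.single i 1)) (orthant d) :=
    (hf.fderiv_of_isOpen (isOpen_orthant d) (by simp)).clm_apply contDiffOn_const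
  refine h.congr fun x hx => ?_
  have hd : DifferentiableAt ℝ f x :=
    (hf.contDiffAt ((isOpen_orthant d).mem_nhds hx)).differentiableAt (by simp)
  exact hd.lineDeriv_eq_fderiv

theorem partialDeriv_congr (i : Fin d) (h : EqOn f g (orthant d)) :
    EqOn (partialDeriv i f) (partialDeriv i g) (orthant d) := fun _ hx =>
  (h.eventuallyEq_of_mem ((isOpen_orthant d).mem_nhds hx)).lineDeriv_eq

theorem partialDeriv_add (i : Fin d) (hf : ContDiffOn ℝ ∞ f (orthant d))
    (hg : ContDiffOn ℝ ∞ g (orthant d)) :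
    EqOn (partialDeriv i (f + g)) (partialDeriv i f + partialDeriv i g) (orthant d) := by
  intro x hx
  have hfd : DifferentiableAt ℝ f x :=
    (hf.contDiffAt ((isOpen_orthant d).mem_nhds hx)).differentiableAt (by simp)
  have hgd : DifferentiableAt ℝ g x :=
    (hg.contDiffAt ((isOpen_orthant d).mem_nhds hx)).differentiableAt (by simp)
  simp [partialDeriv, (hfd.add hgd).lineDeriv_eq_fderiv, hfd.lineDeriv_eq_fderiv,
    hgd.lineDeriv_eq_fderiv, fderiv_add hfd hgd]

theorem partialDeriv_smul (i : Fin d) (c : ℂ) :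
    partialDeriv i (c • f) = c • partialDeriv i f := by
  funext x
  simp only [partialDeriv, lineDeriv, Pi.smul_apply]
  exact deriv_fun_const_smul_field c _

theorem iterate_contDiffOn (i : Fin d) (m : ℕ) (hf : ContDiffOn ℝ ∞ f (orthant d)) :
    ContDiffOn ℝ ∞ ((partialDeriv i)^[m] f) (orthant d) := by
  induction m with
  | zero => exact hf
  | succ m ih =>
    rw [Function.iterate_succ_apply']
    exact partialDeriv_contDiffOn i ih

theorem iterate_congr (i : Fin d) (m : ℕ) (h : EqOn f g (orthant d)) :
    EqOn ((partialDeriv i)^[m] f) ((partialDeriv i)^[m] g) (orthant d) := by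
  induction m with
  | zero => exact h
  | succ m ih =>
    rw [Function.iterate_succ_apply', Function.iterate_succ_apply']
    exact partialDeriv_congr i ih

theorem iterate_add (i : Fin d) (m : ℕ) (hf : ContDiffOn ℝ ∞ f (orthant d))
    (hg : ContDiffOn ℝ ∞ g (orthant d)) :
    EqOn ((partialDeriv i)^[m] (f + g)) ((partialDeriv i)^[m] f + (partialDeriv i)^[m] g)
      (orthant d) := by
  induction m with
  | zero => exact fun _ _ => rfl
  | succ m ih =>
    simp only [Function.iterate_succ_apply']
    exact (partialDeriv_congr i ih).trans
      (partialDeriv_add i (iterate_contDiffOn i m hf) (iterate_contDiffOn i m hg))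

theorem iterate_smul (i : Fin d) (m : ℕ) (c : ℂ) :
    (partialDeriv i)^[m] (c • f) = c • (partialDeriv i)^[m] f := by
  induction m with
  | zero => rfl
  | succ m ih => simp only [Function.iterate_succ_apply', ih, partialDeriv_smul]

theorem multiDeriv_contDiffOn (p : Fin d → ℕ) (hf : ContDiffOn ℝ ∞ f (orthant d)) :
    ContDiffOn ℝ ∞ (multiDeriv p f) (orthant d) := by
  unfold multiDeriv
  induction List.finRange d with
  | nil => exact hf
  | cons i l ih => exact iterate_contDiffOn i (p i) ih

theorem multiDeriv_add (p : Fin d → ℕ) (hf : ContDiffOn ℝ ∞ f (orthant d))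
    (hg : ContDiffOn ℝ ∞ g (orthant d)) :
    EqOn (multiDeriv p (f + g)) (multiDeriv p f + multiDeriv p g) (orthant d) := by
  have key : ∀ l : List (Fin d), ∀ h : (Fin d → ℝ) → ℂ, ContDiffOn ℝ ∞ h (orthant d) →
      ContDiffOn ℝ ∞ (l.foldr (fun i g => (partialDeriv i)^[p i] g) h) (orthant d) := by
    intro l h hh
    induction l with
    | nil => exact hh
    | cons i l ih => exact iterate_contDiffOn i (p i) ih
  unfold multiDeriv
  induction List.finRange d with
  | nil => exact fun _ _ => rfl
  | cons i l ih =>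
    exact (iterate_congr i (p i) ih).trans (iterate_add i (p i) (key l f hf) (key l g hg))

theorem multiDeriv_smul (p : Fin d → ℕ) (c : ℂ) :
    multiDeriv p (c • f) = c • multiDeriv p f := by
  unfold multiDeriv
  induction List.finRange d with
  | nil => rfl
  | cons i l ih => simp only [List.foldr_cons, ih, iterate_smul]

theorem multiDeriv_zero (p : Fin d → ℕ) : multiDeriv p (0 : (Fin d → ℝ) → ℂ) = 0 := by
  have h := multiDeriv_smul (f := (0 : (Fin d → ℝ) → ℂ)) p 0
  rwa [zero_smul, zero_smul] at h

end derivatives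

/-- `sup_{x ∈ ℝ^d_+} |x^k D^p f(x)|`, with values in `[0, ∞]`. -/
noncomputable def supNorm {d : ℕ} (p k : Fin d → ℕ) (f : (Fin d → ℝ) → ℂ) : ℝ≥0∞ :=
  ⨆ x ∈ orthant d, ‖(∏ i, x i ^ k i) • multiDeriv p f x‖ₑ

/-- `‖t^{(p+k)/2} D^p f(t)‖_{L²(ℝ^d_+)}`, with values in `[0, ∞]`. -/
noncomputable def l2Norm {d : ℕ} (p k : Fin d → ℕ) (f : (Fin d → ℝ) → ℂ) : ℝ≥0∞ :=
  eLpNorm (fun t => (∏ i, t i ^ (((p i + k i : ℕ) : ℝ) / 2)) • multiDeriv p f t) 2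
    (volume.restrict (orthant d))

/-- `sup_{p,k} ‖t^{(p+k)/2} D^p f(t)‖_{L²(ℝ^d_+)} / (A^{|p+k|} k^{(α/2)k} p^{(β/2)p})`, with values
in `[0, ∞]`; here `0^0 = 1`. -/
noncomputable def gsNorm {d : ℕ} (α β A : ℝ) (f : (Fin d → ℝ) → ℂ) : ℝ≥0∞ :=
  ⨆ (p : Fin d → ℕ) (k : Fin d → ℕ), l2Norm p k f /
    ENNReal.ofReal (A ^ (∑ i, (p i + k i)) * (∏ i, (k i : ℝ) ^ (α / 2 * k i)) *
      ∏ i, (p i : ℝ) ^ (β / 2 * p i))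

/-- `sup_{|p| ≤ j, |k| ≤ j} sup_{t ∈ ℝ^d_+} |t^k D^p f(t)|`, with values in `[0, ∞]`. -/
noncomputable def supNormUpTo {d : ℕ} (j : ℕ) (f : (Fin d → ℝ) → ℂ) : ℝ≥0∞ :=
  ⨆ (p : Fin d → ℕ) (k : Fin d → ℕ) (_ : ∑ i, p i ≤ j) (_ : ∑ i, k i ≤ j), supNorm p k f

section norms

variable {d : ℕ} {f g : (Fin d → ℝ) → ℂ}

theorem supNorm_add (p k : Fin d → ℕ) (hf : ContDiffOn ℝ ∞ f (orthant d))
    (hg : ContDiffOn ℝ ∞ g (orthant d)) :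
    supNorm p k (f + g) ≤ supNorm p k f + supNorm p k g := by
  refine iSup₂_le fun x hx => ?_
  rw [multiDeriv_add p hf hg hx, Pi.add_apply, smul_add]
  exact (enorm_add_le _ _).trans (add_le_add
    (le_iSup₂ (f := fun x (_ : x ∈ orthant d) => ‖(∏ i, x i ^ k i) • multiDeriv p f x‖ₑ) x hx)
    (le_iSup₂ (f := fun x (_ : x ∈ orthant d) => ‖(∏ i, x i ^ k i) • multiDeriv p g x‖ₑ) x hx))

theorem supNorm_smul (p k : Fin d → ℕ) (c : ℂ) :
    supNorm p k (c • f) ≤ ‖c‖ₑ * supNorm p k f := by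
  refine iSup₂_le fun x hx => ?_
  rw [multiDeriv_smul, Pi.smul_apply, smul_comm, enorm_smul]
  gcongr
  exact le_iSup₂ (f := fun x (_ : x ∈ orthant d) => ‖(∏ i, x i ^ k i) • multiDeriv p f x‖ₑ) x hx

theorem l2Norm_add (p k : Fin d → ℕ) (hf : ContDiffOn ℝ ∞ f (orthant d))
    (hg : ContDiffOn ℝ ∞ g (orthant d)) :
    l2Norm p k (f + g) ≤ l2Norm p k f + l2Norm p k g := by
  have hU : MeasurableSet (orthant d) := (isOpen_orthant d).measurableSet
  have hm : ∀ h : (Fin d → ℝ) → ℂ, ContDiffOn ℝ ∞ h (orthant d) → AEStronglyMeasurable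
      (fun t => (∏ i, t i ^ (((p i + k i : ℕ) : ℝ) / 2)) • multiDeriv p h t)
      (volume.restrict (orthant d)) := by
    intro h hh
    refine AEStronglyMeasurable.smul (f := fun t : Fin d → ℝ =>
      ∏ i, t i ^ (((p i + k i : ℕ) : ℝ) / 2)) (Measurable.aestronglyMeasurable (by fun_prop)) ?_
    exact (multiDeriv_contDiffOn p hh).continuousOn.aestronglyMeasurable hU
  unfold l2Norm
  refine le_trans (le_of_eq ?_) (eLpNorm_add_le (hm f hf) (hm g hg) (by norm_num))
  refine eLpNorm_congr_ae ((ae_restrict_iff' hU).2 (.of_forall fun x hx => ?_))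
  simp only [Pi.add_apply, multiDeriv_add p hf hg hx, smul_add]

theorem l2Norm_smul (p k : Fin d → ℕ) (c : ℂ) :
    l2Norm p k (c • f) ≤ ‖c‖ₑ * l2Norm p k f := by
  unfold l2Norm
  rw [← eLpNorm_const_smul]
  refine le_of_eq (congrArg (fun F => eLpNorm F 2 (volume.restrict (orthant d))) ?_)
  funext x
  simp only [multiDeriv_smul, Pi.smul_apply]
  rw [smul_comm]

theorem gsNorm_add (α β A : ℝ) (hf : ContDiffOn ℝ ∞ f (orthant d))
    (hg : ContDiffOn ℝ ∞ g (orthant d)) :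
    gsNorm α β A (f + g) ≤ gsNorm α β A f + gsNorm α β A g := by
  refine iSup₂_le fun p k => ?_
  refine (ENNReal.div_le_div_right (l2Norm_add p k hf hg) _).trans ?_
  rw [ENNReal.add_div]
  unfold gsNorm
  exact add_le_add (le_iSup₂_of_le p k le_rfl) (le_iSup₂_of_le p k le_rfl)

theorem gsNorm_smul (α β A : ℝ) (c : ℂ) :
    gsNorm α β A (c • f) ≤ ‖c‖ₑ * gsNorm α β A f := by
  refine iSup₂_le fun p k => ?_
  refine (ENNReal.div_le_div_right (l2Norm_smul p k c) _).trans ?_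
  rw [mul_div_assoc]
  unfold gsNorm
  gcongr
  exact le_iSup₂_of_le p k le_rfl

theorem gsNorm_anti (α β : ℝ) {A B : ℝ} (hA : 0 < A) (hAB : A ≤ B) (f : (Fin d → ℝ) → ℂ) :
    gsNorm α β B f ≤ gsNorm α β A f := by
  unfold gsNorm
  refine iSup₂_mono fun p k => ENNReal.div_le_div_left (ENNReal.ofReal_le_ofReal ?_) _
  have h1 : 0 ≤ ∏ i, (k i : ℝ) ^ (α / 2 * k i) := Finset.prod_nonneg fun i _ => by positivity
  have h2 : 0 ≤ ∏ i, (p i : ℝ) ^ (β / 2 * p i) := Finset.prod_nonneg fun i _ => by positivity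
  gcongr

theorem supNormUpTo_add (j : ℕ) (hf : ContDiffOn ℝ ∞ f (orthant d))
    (hg : ContDiffOn ℝ ∞ g (orthant d)) :
    supNormUpTo j (f + g) ≤ supNormUpTo j f + supNormUpTo j g := by
  refine iSup₂_le fun p k => iSup₂_le fun hp hk => (supNorm_add p k hf hg).trans ?_
  unfold supNormUpTo
  exact add_le_add (le_iSup₂_of_le p k (le_iSup₂_of_le hp hk le_rfl))
    (le_iSup₂_of_le p k (le_iSup₂_of_le hp hk le_rfl))

theorem supNormUpTo_smul (j : ℕ) (c : ℂ) :
    supNormUpTo j (c • f) ≤ ‖c‖ₑ * supNormUpTo j f := by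
  refine iSup₂_le fun p k => iSup₂_le fun hp hk => (supNorm_smul p k c).trans ?_
  unfold supNormUpTo
  gcongr
  exact le_iSup₂_of_le p k (le_iSup₂_of_le hp hk le_rfl)

theorem supNorm_zero (p k : Fin d → ℕ) : supNorm p k (0 : (Fin d → ℝ) → ℂ) = 0 := by
  simp [supNorm, multiDeriv_zero]

theorem gsNorm_zero (α β A : ℝ) : gsNorm α β A (0 : (Fin d → ℝ) → ℂ) = 0 := by
  have h := gsNorm_smul (f := (0 : (Fin d → ℝ) → ℂ)) α β A 0
  simpa using h

theorem supNormUpTo_lt_top (j : ℕ) (h : ∀ p k, supNorm p k f < ⊤) : supNormUpTo j f < ⊤ := by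
  have hbd : ∀ p : Fin d → ℕ, ∑ i, p i ≤ j → p ∈ Set.Iic (fun _ : Fin d => j) := fun p hp i =>
    (Finset.single_le_sum (f := p) (fun _ _ => Nat.zero_le _) (Finset.mem_univ i)).trans hp
  have hle : supNormUpTo j f ≤ ∑ p ∈ Finset.Iic (fun _ : Fin d => j),
      ∑ k ∈ Finset.Iic (fun _ : Fin d => j), supNorm p k f := by
    refine iSup₂_le fun p k => iSup₂_le fun hp hk => ?_
    refine (Finset.single_le_sum (f := fun k => supNorm p k f) (fun _ _ => zero_le)
      (Finset.mem_Iic.2 (hbd k hk))).trans ?_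
    exact Finset.single_le_sum (f := fun p => ∑ k ∈ Finset.Iic (fun _ : Fin d => j),
      supNorm p k f) (fun _ _ => zero_le) (Finset.mem_Iic.2 (hbd p hp))
  exact hle.trans_lt (ENNReal.sum_lt_top.2 fun p _ => ENNReal.sum_lt_top.2 fun k _ => h p k)

end norms

/-- The space `S(ℝ^d_+)`. A function on `ℝ^d_+` is represented by its extension by zero to `ℝ^d`
(only the values on `ℝ^d_+` matter). -/
def schwartzOrthant (d : ℕ) : Submodule ℂ ((Fin d → ℝ) → ℂ) where
  carrier := {f | (∀ x, x ∉ orthant d → f x = 0) ∧ ContDiffOn ℝ ∞ f (orthant d) ∧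
    (∀ p : Fin d → ℕ, ∃ g : (Fin d → ℝ) → ℂ, ContinuousOn g (closedOrthant d) ∧
      EqOn g (multiDeriv p f) (orthant d)) ∧
    ∀ p k : Fin d → ℕ, supNorm p k f < ⊤}
  zero_mem' := ⟨fun _ _ => rfl, contDiffOn_const,
    fun p => ⟨0, continuousOn_const, by rw [multiDeriv_zero]; exact fun _ _ => rfl⟩,
    fun p k => by rw [supNorm_zero]; exact ENNReal.zero_lt_top⟩
  add_mem' := by
    rintro f g ⟨hf0, hf1, hf2, hf3⟩ ⟨hg0, hg1, hg2, hg3⟩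
    refine ⟨fun x hx => by simp [hf0 x hx, hg0 x hx], hf1.add hg1, fun p => ?_, fun p k =>
      (supNorm_add p k hf1 hg1).trans_lt (ENNReal.add_lt_top.2 ⟨hf3 p k, hg3 p k⟩)⟩
    obtain ⟨F, hF, hF'⟩ := hf2 p
    obtain ⟨G, hG, hG'⟩ := hg2 p
    refine ⟨F + G, hF.add hG, fun x hx => ?_⟩
    rw [multiDeriv_add p hf1 hg1 hx, Pi.add_apply, Pi.add_apply, hF' hx, hG' hx]
  smul_mem' := by
    rintro c f ⟨hf0, hf1, hf2, hf3⟩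
    refine ⟨fun x hx => by simp [hf0 x hx], hf1.const_smul c, fun p => ?_, fun p k =>
      (supNorm_smul p k c).trans_lt (ENNReal.mul_lt_top enorm_lt_top (hf3 p k))⟩
    obtain ⟨F, hF, hF'⟩ := hf2 p
    refine ⟨c • F, hF.const_smul c, fun x hx => ?_⟩
    rw [multiDeriv_smul, Pi.smul_apply, Pi.smul_apply, hF' hx]

/-- The functions `f ∈ S(ℝ^d_+)` with `gsNorm α β A f < ∞`. -/
def gsStepSubmodule (d : ℕ) (α β A : ℝ) : Submodule ℂ ((Fin d → ℝ) → ℂ) where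
  carrier := {f | f ∈ schwartzOrthant d ∧ gsNorm α β A f < ⊤}
  zero_mem' := ⟨zero_mem _, by rw [gsNorm_zero]; exact ENNReal.zero_lt_top⟩
  add_mem' hf hg := ⟨add_mem hf.1 hg.1, (gsNorm_add α β A hf.1.2.1 hg.1.2.1).trans_lt
    (ENNReal.add_lt_top.2 ⟨hf.2, hg.2⟩)⟩
  smul_mem' c _ hf := ⟨Submodule.smul_mem _ c hf.1, (gsNorm_smul α β A c).trans_lt
    (ENNReal.mul_lt_top enorm_lt_top hf.2)⟩

/-- The Fréchet space `G^{β,A}_{α,A}(ℝ^d_+)`, `A > 0`. -/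
def GSStep (d : ℕ) (α β : ℝ) (A : Ioi (0 : ℝ)) : Type := gsStepSubmodule d α β A

noncomputable instance (d : ℕ) (α β : ℝ) (A : Ioi (0 : ℝ)) : AddCommGroup (GSStep d α β A) :=
  inferInstanceAs (AddCommGroup (gsStepSubmodule d α β A))

noncomputable instance (d : ℕ) (α β : ℝ) (A : Ioi (0 : ℝ)) : Module ℂ (GSStep d α β A) :=
  inferInstanceAs (Module ℂ (gsStepSubmodule d α β A))

theorem GSStep.contDiffOn {d : ℕ} {α β : ℝ} {A : Ioi (0 : ℝ)} (f : GSStep d α β A) :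
    ContDiffOn ℝ ∞ f.1 (orthant d) := (show f.1 ∈ schwartzOrthant d from f.2.1).2.1

theorem GSStep.supNormUpTo_lt_top {d : ℕ} {α β : ℝ} {A : Ioi (0 : ℝ)} (f : GSStep d α β A)
    (j : ℕ) : supNormUpTo j f.1 < ⊤ :=
  LaguerreExpansion.supNormUpTo_lt_top j (show f.1 ∈ schwartzOrthant d from f.2.1).2.2.2

theorem GSStep.gsNorm_lt_top {d : ℕ} {α β : ℝ} {A : Ioi (0 : ℝ)} (f : GSStep d α β A) :
    gsNorm α β A f.1 < ⊤ := f.2.2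

/-- The seminorms `σ_{A,j}` of `G^{β,A}_{α,A}(ℝ^d_+)`. -/
noncomputable def gsSeminorm (d : ℕ) (α β : ℝ) (A : Ioi (0 : ℝ)) (j : ℕ) :
    Seminorm ℂ (GSStep d α β A) :=
  seminormOfENNReal (fun f : GSStep d α β A => gsNorm α β A f.1) GSStep.gsNorm_lt_top
      (fun f g => gsNorm_add α β A f.contDiffOn g.contDiffOn)
      (fun c f => gsNorm_smul (f := f.1) α β A c) +
    seminormOfENNReal (fun f : GSStep d α β A => supNormUpTo j f.1)
      (fun f => f.supNormUpTo_lt_top j)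
      (fun f g => supNormUpTo_add j f.contDiffOn g.contDiffOn)
      (fun c f => supNormUpTo_smul (f := f.1) j c)

/-- The topology of `G^{β,A}_{α,A}(ℝ^d_+)` is the one given by the seminorms `σ_{A,j}`. -/
noncomputable instance (d : ℕ) (α β : ℝ) (A : Ioi (0 : ℝ)) : TopologicalSpace (GSStep d α β A) :=
  (SeminormFamily.moduleFilterBasis (fun j : ℕ => gsSeminorm d α β A j)).topology

/-- The union of the spaces `G^{β,A}_{α,A}(ℝ^d_+)`, `A > 0`. -/
def gsSubmodule (d : ℕ) (α β : ℝ) : Submodule ℂ ((Fin d → ℝ) → ℂ) where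
  carrier := {f | ∃ A : ℝ, 0 < A ∧ f ∈ gsStepSubmodule d α β A}
  zero_mem' := ⟨1, one_pos, zero_mem _⟩
  add_mem' := by
    rintro f g ⟨A, hA, hf⟩ ⟨B, hB, hg⟩
    exact ⟨max A B, lt_max_of_lt_left hA, add_mem
      ⟨hf.1, (gsNorm_anti α β hA (le_max_left _ _) f).trans_lt hf.2⟩
      ⟨hg.1, (gsNorm_anti α β hB (le_max_right _ _) g).trans_lt hg.2⟩⟩
  smul_mem' := by
    rintro c f ⟨A, hA, hf⟩
    exact ⟨A, hA, Submodule.smul_mem _ c hf⟩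

/-- The space `G^β_α(ℝ^d_+)`. -/
def GSSpace (d : ℕ) (α β : ℝ) : Type := gsSubmodule d α β

noncomputable instance (d : ℕ) (α β : ℝ) : AddCommGroup (GSSpace d α β) :=
  inferInstanceAs (AddCommGroup (gsSubmodule d α β))

noncomputable instance (d : ℕ) (α β : ℝ) : Module ℂ (GSSpace d α β) :=
  inferInstanceAs (Module ℂ (gsSubmodule d α β))

/-- The inclusion of `G^{β,A}_{α,A}(ℝ^d_+)` into `G^β_α(ℝ^d_+)`. -/
def gsIncl (d : ℕ) (α β : ℝ) (A : Ioi (0 : ℝ)) : GSStep d α β A →ₗ[ℂ] GSSpace d α β :=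
  Submodule.inclusion (p := gsStepSubmodule d α β A) (p' := gsSubmodule d α β)
    (fun _ hf => ⟨A, A.2, hf⟩)

/-- `G^β_α(ℝ^d_+)` carries the inductive limit topology of the spaces `G^{β,A}_{α,A}(ℝ^d_+)`,
`A → ∞`. -/
noncomputable instance (d : ℕ) (α β : ℝ) : TopologicalSpace (GSSpace d α β) :=
  lcIndTopology (gsIncl d α β)

/-! ### Laguerre functions and coefficients -/

/-- The Laguerre polynomial `L_m(t) = (e^t / m!) (d^m/dt^m) (e^{-t} t^m)`. -/
noncomputable def laguerrePoly (m : ℕ) (t : ℝ) : ℝ :=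
  Real.exp t / (m.factorial : ℝ) * iteratedDeriv m (fun s => Real.exp (-s) * s ^ m) t

/-- The `d`-dimensional Laguerre function `∏_l L_{n_l}(t_l) e^{-t_l/2}` on `ℝ^d_+` (extended by
zero, as all functions on `ℝ^d_+`). -/
noncomputable def laguerreFun {d : ℕ} (n : Fin d → ℕ) : (Fin d → ℝ) → ℂ :=
  (orthant d).indicator fun t => ((∏ l, laguerrePoly (n l) (t l) * Real.exp (-(t l) / 2) : ℝ) : ℂ)

/-- The Laguerre coefficient `⟨f, 𝓛_n⟩ = ∫_{ℝ^d_+} f(t) 𝓛_n(t) dt`. -/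
noncomputable def laguerreCoeff {d : ℕ} (f : (Fin d → ℝ) → ℂ) (n : Fin d → ℕ) : ℂ :=
  ∫ t in orthant d, f t * laguerreFun n t

end LaguerreExpansion

/-! The theorem reduces to two estimates for the coefficient map. After that, the sequence space is
analysed directly and its properties are carried back along the isomorphism.

Decay of coefficients. Put `lag j m` = L_m^{(j)}. The ladder d/dt (t^{j+1} e^{-t} L_m^{(j+1)}) =
(m+1) t^j e^{-t} L_{m+1}^{(j)} allows p integrations by parts in a single coordinate x_i. Up to
sign, ⟨f, 𝓛_n⟩ becomes (n_i-p)!/n_i! times the integral of (∂_i + 1/2)^p f against x_i^p e^{-x_i/2}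
L_{n_i-p}^{(p)}(x_i) and the unchanged Laguerre functions of the other coordinates. Splitting x_i^p
evenly, Cauchy–Schwarz meets exactly the norms that define the space, and gives |⟨f, 𝓛_n⟩| ≤ σ B^p
p^{αp/2} √((n_i-p)!/n_i!) with B = 3A/2. Taking n_i maximal and p of order n_i^{1/α} yields
stretched exponential decay (`enorm_laguerreCoeff_le`, `exists_rpow_decay`).

Convergence of series. For every k, the p-th derivative of e^{-t/2} L_n is a combination of the
functions e^{-t/2} L_m^{(p+k)}, m ≤ n, with coefficients of ℓ¹ norm at most 2^k. These functions are
orthogonal for t^{p+k}, the square of the weight in the norms, so the weighted L² norms are at most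
2^k (n+p+k)^{(p+k)/2}. Part of the decay of u_n absorbs this growth, since (s+N)^{N/2} q^{s^{1/α}} ≤
C^N N^{αN/2}; the rest makes the series summable (`exists_gsNorm_laguerreSeries_le`). Weighted sup
norms of derivatives of 𝓛_n grow only polynomially in n, so the series may be differentiated
termwise.

The two maps are mutually inverse. Orthonormality gives one composition. The other needs
completeness: if all coefficients of f vanish, then so do all moments of f e^{-|x|/2}, hence its
Fourier transform, hence f. Each map sends a step of one scale continuously into one step of the
other, so both are continuous for the inductive limits.

The sequence space. A continuous seminorm p is dominated by Σ w_n |u_n| with w_n = p(e_n), and w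
grows more slowly than every a^{|n|^{1/α}}, a > 1. Such weights may be multiplied by (|n|+1)^{2d},
whose inverse is summable: this is nuclearity. The ratios (b/a)^{|n|^{1/α}}, b < a, tend to zero, so
the linking maps are compact. Bounded sets lie in one step, so the strong topology of the dual is
given by the countably many norms sup_n |φ(e_n)| a_m^{-|n|^{1/α}}. Completeness and nuclearity of
the dual follow by the same coordinate arguments. -/

namespace LaguerreExpansion

/-! ### Generalized Laguerre polynomials -/

section LaguerrePolynomials

open Polynomial

/-- The generalized Laguerre polynomial `L_m^{(j)}`. -/
noncomputable def lag (j m : ℕ) : ℝ[X] :=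
  ∑ i ∈ Finset.range (m + 1),
    monomial i ((-1) ^ i * ((m + j).choose (j + i) : ℝ) / (i.factorial : ℝ))

theorem lag_coeff (j m i : ℕ) :
    (lag j m).coeff i = (-1) ^ i * ((m + j).choose (j + i) : ℝ) / (i.factorial : ℝ) := by
  simp only [lag, finsetSum_coeff, coeff_monomial, Finset.sum_ite_eq', Finset.mem_range]
  split_ifs with h
  · rfl
  · rw [Nat.choose_eq_zero_of_lt (by omega)]
    simp

theorem lag_zero_right (j : ℕ) : lag j 0 = 1 := by
  ext i
  rw [lag_coeff, coeff_one]
  rcases i with _ | i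
  · simp
  · rw [Nat.choose_eq_zero_of_lt (by omega)]
    simp

/-- Pascal's rule, coefficient by coefficient. -/
theorem lag_contiguous (j m : ℕ) : lag j (m + 1) = lag (j + 1) (m + 1) - lag (j + 1) m := by
  ext i
  simp only [coeff_sub, lag_coeff]
  rw [show m + 1 + (j + 1) = (m + j + 1) + 1 by ring, show j + 1 + i = (j + i) + 1 by ring,
    Nat.choose_succ_succ, show m + 1 + j = m + j + 1 by ring, show m + (j + 1) = m + j + 1 by ring]
  push_cast
  ring

theorem lag_derivative_zero (j : ℕ) : derivative (lag j 0) = 0 := by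
  simp [lag_zero_right]

theorem lag_derivative_succ (j m : ℕ) : derivative (lag j (m + 1)) = -lag (j + 1) m := by
  ext i
  simp only [coeff_neg, coeff_derivative, lag_coeff]
  rw [show m + 1 + j = m + (j + 1) by ring, show j + (i + 1) = j + 1 + i by ring,
    Nat.factorial_succ]
  have : (i.factorial : ℝ) ≠ 0 := by positivity
  have : (i : ℝ) + 1 ≠ 0 := by positivity
  push_cast
  field_simp
  ring

/-- A pair of binomial identities on the coefficients. Multiplication by t lowers the upper index,
which drives the sup bounds with powers of t and the three-term recurrence. -/
theorem X_mul_lag (j m : ℕ) :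
    X * lag (j + 1) m = C ((m : ℝ) + j + 1) * lag j m - C ((m : ℝ) + 1) * lag j (m + 1) := by
  ext i
  rcases i with _ | i
  · simp only [mul_coeff_zero, coeff_X_zero, coeff_sub, lag_coeff, zero_mul, coeff_C_zero]
    have h := Nat.add_one_mul_choose_eq (m + j) m
    have h1 : (m + j).choose m = (m + j).choose j := Nat.choose_symm_add
    have h2 : (m + j + 1).choose (m + 1) = (m + 1 + j).choose j := by
      rw [show m + j + 1 = m + 1 + j by ring]; exact Nat.choose_symm_add
    simp only [h1, h2] at h
    have h' : ((m : ℝ) + j + 1) * ((m + j).choose j) = ((m + 1 + j).choose j) * (m + 1) := by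
      exact_mod_cast h
    simp only [add_zero, pow_zero, Nat.factorial_zero]
    push_cast
    linarith
  · simp only [coeff_X_mul, coeff_sub, coeff_C_mul, lag_coeff]
    have key : ((m : ℝ) + j + 1) * ((m + j).choose (j + 1 + i)) =
        ((m : ℝ) - i) * ((m + j + 1).choose (j + 1 + i)) := by
      by_cases hi : i ≤ m
      · have h := Nat.choose_mul_succ_eq (m + j) (j + 1 + i)
        have e : m + j + 1 - (j + 1 + i) = m - i := by omega
        rw [e] at h
        have h' : (((m + j).choose (j + 1 + i) * (m + j + 1) : ℕ) : ℝ) =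
          (((m + j + 1).choose (j + 1 + i) * (m - i) : ℕ) : ℝ) := by exact_mod_cast h
        push_cast [Nat.cast_sub hi] at h'
        linarith
      · rw [Nat.choose_eq_zero_of_lt (by omega), Nat.choose_eq_zero_of_lt (by omega)]
        simp
    rw [show m + (j + 1) = m + j + 1 by ring, show m + 1 + j = m + j + 1 by ring,
      show j + (i + 1) = j + 1 + i by ring, Nat.factorial_succ]
    have : (i.factorial : ℝ) ≠ 0 := by positivity
    have : (i : ℝ) + 1 ≠ 0 := by positivity
    push_cast
    field_simp
    rw [pow_succ]
    linear_combination (-1) ^ i * key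

/-- The ladder d/dt (t^{j+1} e^{-t} L_m^{(j+1)}) = (m+1) t^j e^{-t} L_{m+1}^{(j)} with t^j e^{-t}
divided out. All integrations by parts rest on it. -/
theorem lag_rodrigues_step (j m : ℕ) :
    C ((j : ℝ) + 1) * lag (j + 1) m + X * derivative (lag (j + 1) m) - X * lag (j + 1) m =
      C ((m : ℝ) + 1) * lag j (m + 1) := by
  rcases m with _ | m
  · rw [lag_derivative_zero, X_mul_lag, lag_zero_right, lag_zero_right]
    simp
  · rw [lag_derivative_succ, mul_neg, X_mul_lag (j + 1) m, X_mul_lag j (m + 1), lag_contiguous j m]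
    simp only [map_add, Nat.cast_add, Nat.cast_one]
    ring

/-- Needed for completeness: it makes the span of the Laguerre functions stable under multiplication
by coordinates. At m = 0 the truncated `m - 1` is harmless because its coefficient vanishes. -/
theorem lag_three_term (m : ℕ) :
    X * lag 0 m = C (2 * (m : ℝ) + 1) * lag 0 m - C ((m : ℝ) + 1) * lag 0 (m + 1) -
      C (m : ℝ) * lag 0 (m - 1) := by
  rcases m with _ | m
  · have h := X_mul_lag 0 0
    simpa [lag_zero_right] using h
  · have h1 := X_mul_lag 0 m
    have h2 := X_mul_lag 0 (m + 1)
    have h3 := lag_contiguous 0 m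
    rw [h3, mul_sub, h2, h1, ← h3]
    simp only [map_add, map_mul, map_one, map_zero, map_ofNat, Nat.cast_add, Nat.cast_one, Nat.cast_zero,
      Nat.add_sub_cancel]
    ring

theorem lag_ode (m : ℕ) :
    X * derivative (derivative (lag 0 m)) + (1 - X) * derivative (lag 0 m) + C (m : ℝ) * lag 0 m
      = 0 := by
  rcases m with _ | m
  · simp [lag_zero_right]
  · have h := lag_rodrigues_step 0 m
    rw [lag_derivative_succ]
    simp only [derivative_neg, Nat.cast_add, Nat.cast_one, Nat.cast_zero, zero_add, map_one,
      one_mul] at h ⊢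
    rw [← h]
    ring

end LaguerrePolynomials

/-! ### Laguerre functions of one variable -/

/-- The function `e^{-t/2} L_m^{(j)}(t)`. -/
noncomputable def lagFun (j m : ℕ) (t : ℝ) : ℝ := Real.exp (-t / 2) * (lag j m).eval t

theorem lagFun_contiguous (j m : ℕ) (t : ℝ) :
    lagFun j (m + 1) t = lagFun (j + 1) (m + 1) t - lagFun (j + 1) m t := by
  simp only [lagFun, lag_contiguous j m, Polynomial.eval_sub]
  ring

theorem lagFun_zero_right (j : ℕ) (t : ℝ) : lagFun j 0 t = Real.exp (-t / 2) := by
  simp [lagFun, lag_zero_right]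

theorem mul_lagFun (j m : ℕ) (t : ℝ) :
    t * lagFun (j + 1) m t = ((m : ℝ) + j + 1) * lagFun j m t - ((m : ℝ) + 1) * lagFun j (m + 1) t := by
  have h := congrArg (Polynomial.eval t) (X_mul_lag j m)
  simp only [Polynomial.eval_mul, Polynomial.eval_X, Polynomial.eval_sub, Polynomial.eval_C] at h
  simp only [lagFun]
  linear_combination Real.exp (-t / 2) * h

theorem lagFun_three_term (m : ℕ) (t : ℝ) :
    t * lagFun 0 m t = (2 * (m : ℝ) + 1) * lagFun 0 m t - ((m : ℝ) + 1) * lagFun 0 (m + 1) t -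
      (m : ℝ) * lagFun 0 (m - 1) t := by
  have h := congrArg (Polynomial.eval t) (lag_three_term m)
  simp only [Polynomial.eval_mul, Polynomial.eval_X, Polynomial.eval_sub, Polynomial.eval_C] at h
  simp only [lagFun]
  linear_combination Real.exp (-t / 2) * h

theorem hasDerivAt_exp_neg_half (t : ℝ) :
    HasDerivAt (fun t : ℝ => Real.exp (-t / 2)) (-(1 / 2) * Real.exp (-t / 2)) t := by
  have h : HasDerivAt (fun t : ℝ => -t / 2) (-1 / 2) t := ((hasDerivAt_id t).neg).div_const 2
  convert h.exp using 1
  ring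

theorem hasDerivAt_lagFun_zero (j : ℕ) (t : ℝ) :
    HasDerivAt (lagFun j 0) (-(1 / 2) * lagFun (j + 1) 0 t) t := by
  have : lagFun j 0 = fun t => Real.exp (-t / 2) := funext (lagFun_zero_right j)
  rw [this, lagFun_zero_right]
  exact hasDerivAt_exp_neg_half t

theorem hasDerivAt_lagFun (j m : ℕ) (t : ℝ) :
    HasDerivAt (lagFun j m)
      (-(1 / 2) * lagFun j m t + Real.exp (-t / 2) * (Polynomial.derivative (lag j m)).eval t) t := by
  have h := (hasDerivAt_exp_neg_half t).mul ((lag j m).hasDerivAt t)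
  refine h.congr_deriv ?_
  simp only [lagFun]; ring

theorem hasDerivAt_lagFun_succ (j m : ℕ) (t : ℝ) :
    HasDerivAt (lagFun j (m + 1)) (-(1 / 2) * lagFun j (m + 1) t - lagFun (j + 1) m t) t := by
  refine (hasDerivAt_lagFun j (m + 1) t).congr_deriv ?_
  rw [lag_derivative_succ]
  simp only [lagFun, Polynomial.eval_neg]
  ring

theorem hasDerivAt_rodrigues_step (j m : ℕ) (t : ℝ) :
    HasDerivAt (fun t => t ^ (j + 1) * Real.exp (-t) * (lag (j + 1) m).eval t)
      (((m : ℝ) + 1) * (t ^ j * Real.exp (-t) * (lag j (m + 1)).eval t)) t := by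
  have h1 : HasDerivAt (fun t : ℝ => Real.exp (-t)) (-Real.exp (-t)) t := by
    convert (hasDerivAt_neg t).exp using 1; ring
  have h2 := ((hasDerivAt_pow (j + 1) t).mul h1).mul ((lag (j + 1) m).hasDerivAt t)
  have h := congrArg (Polynomial.eval t) (lag_rodrigues_step j m)
  simp only [Polynomial.eval_mul, Polynomial.eval_X, Polynomial.eval_sub, Polynomial.eval_C,
    Polynomial.eval_add] at h
  refine h2.congr_deriv ?_
  rw [Nat.add_sub_cancel, Pi.mul_apply]
  push_cast
  linear_combination (t ^ j * Real.exp (-t)) * h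

/-- `t^j e^{-t/2} · e^{-t/2} L_m^{(j)}(t)` differentiates down the ladder. -/
theorem hasDerivAt_weight_lagFun (j m : ℕ) (t : ℝ) :
    HasDerivAt (fun t => t ^ (j + 1) * lagFun (j + 1) m t)
      (((m : ℝ) + 1) * (t ^ j * lagFun j (m + 1) t) + (1 / 2) * (t ^ (j + 1) * lagFun (j + 1) m t))
      t := by
  have h1 : HasDerivAt (fun t : ℝ => Real.exp (t / 2)) (1 / 2 * Real.exp (t / 2)) t := by
    refine ((hasDerivAt_id t).div_const 2).exp.congr_deriv ?_
    simp only [id]; ring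
  have h2 := h1.mul (hasDerivAt_rodrigues_step j m t)
  have key : ∀ s : ℝ, Real.exp (s / 2) * Real.exp (-s) = Real.exp (-s / 2) := fun s => by
    rw [← Real.exp_add]; congr 1; ring
  have e : (fun t => t ^ (j + 1) * lagFun (j + 1) m t) = (fun t => Real.exp (t / 2)) *
      (fun t => t ^ (j + 1) * Real.exp (-t) * (lag (j + 1) m).eval t) := by
    funext s
    simp only [lagFun, Pi.mul_apply, ← key]; ring
  rw [e]
  refine h2.congr_deriv ?_
  simp only [lagFun, ← key]; ring

/-- Each derivative is one rung of the ladder, with upper index m - p. At p = m it identifies the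
Rodrigues definition of the Laguerre polynomial with `lag 0 m`. -/
theorem iteratedDeriv_rodrigues (m p : ℕ) (hp : p ≤ m) :
    iteratedDeriv p (fun s : ℝ => Real.exp (-s) * s ^ m) = fun t =>
      (p.factorial : ℝ) * (t ^ (m - p) * Real.exp (-t) * (lag (m - p) p).eval t) := by
  induction p with
  | zero =>
    funext t
    simp [lag_zero_right, mul_comm]
  | succ p ih =>
    rw [iteratedDeriv_succ, ih (by omega)]
    funext t
    obtain ⟨j, hj⟩ : ∃ j, m - p = j + 1 := ⟨m - p - 1, by omega⟩
    rw [hj, show m - (p + 1) = j by omega]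
    rw [((hasDerivAt_rodrigues_step j p t).const_mul (p.factorial : ℝ)).deriv, Nat.factorial_succ]
    push_cast; ring

theorem laguerrePoly_eq (m : ℕ) (t : ℝ) : laguerrePoly m t = (lag 0 m).eval t := by
  unfold laguerrePoly
  rw [iteratedDeriv_rodrigues m m le_rfl]
  have : (m.factorial : ℝ) ≠ 0 := by positivity
  have h : Real.exp t * Real.exp (-t) = 1 := by rw [← Real.exp_add]; simp
  simp only [Nat.sub_self, pow_zero, one_mul]
  field_simp
  linear_combination (lag 0 m).eval t * h

theorem laguerrePoly_mul_exp (m : ℕ) (t : ℝ) :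
    laguerrePoly m t * Real.exp (-t / 2) = lagFun 0 m t := by
  rw [laguerrePoly_eq, lagFun, mul_comm]

/-! ### Pointwise bounds for the Laguerre functions of one variable -/

theorem lag_eval_zero (m : ℕ) : (lag 0 m).eval 0 = 1 := by
  rw [← Polynomial.coeff_zero_eq_eval_zero, lag_coeff]
  simp

theorem lag_ode_eval (m : ℕ) (t : ℝ) :
    t * (Polynomial.derivative (Polynomial.derivative (lag 0 m))).eval t +
      (1 - t) * (Polynomial.derivative (lag 0 m)).eval t + m * (lag 0 m).eval t = 0 := by
  have h := congrArg (Polynomial.eval t) (lag_ode m)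
  simpa using h

theorem tendsto_polynomial_mul_exp_neg (P : Polynomial ℝ) :
    Tendsto (fun t => P.eval t * Real.exp (-t)) atTop (𝓝 0) := by
  simpa [Real.exp_neg, div_eq_mul_inv] using P.tendsto_div_exp_atTop

/-- The Laguerre functions are bounded by `√(m + 1)`; the proof uses a Sonin type energy. -/
theorem sq_lagFun_zero_le (m : ℕ) {t : ℝ} (ht : 0 ≤ t) : lagFun 0 m t ^ 2 ≤ m + 1 := by
  set L := lag 0 m with hL
  set L1 := Polynomial.derivative L with hL1
  set L2 := Polynomial.derivative L1 with hL2
  -- With φ = e^{-t/2} L and E = t φ'² + (m + 1/2 - t/4) φ², the function `Q s` times e^{-t} is φ² +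
  -- sE. Laguerre's equation reads (tφ')' = -(m + 1/2 - t/4) φ, so E' = -φ'² - φ²/4. Hence φ² + 2E
  -- has derivative -2(φ' - φ/2)² and φ² - 2E has derivative 2(φ' + φ/2)².
  let Q : ℝ → Polynomial ℝ := fun s => L ^ 2 + Polynomial.C s *
    (Polynomial.X * (L1 - Polynomial.C (1 / 2) * L) ^ 2 +
      (Polynomial.C ((m : ℝ) + 1 / 2) - Polynomial.C (1 / 4) * Polynomial.X) * L ^ 2)
  have hQ : ∀ s t, (Q s).eval t = L.eval t ^ 2 + s * (t * (L1.eval t - 1 / 2 * L.eval t) ^ 2 +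
      ((m : ℝ) + 1 / 2 - 1 / 4 * t) * L.eval t ^ 2) := fun s t => by simp [Q]
  have hder : ∀ s t, HasDerivAt (fun t => (Q s).eval t * Real.exp (-t))
      (Real.exp (-t) * (2 * L.eval t * L1.eval t - L.eval t ^ 2 -
        s * (L1.eval t ^ 2 - L.eval t * L1.eval t + L.eval t ^ 2 / 2))) t := by
    intro s t
    have h1 : HasDerivAt (fun t : ℝ => Real.exp (-t)) (-Real.exp (-t)) t := by
      convert (hasDerivAt_neg t).exp using 1; ring
    have d0 := L.hasDerivAt t
    have d1 := L1.hasDerivAt t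
    have d2 := ((d0.pow 2).add ((((hasDerivAt_id t).mul ((d1.sub (d0.const_mul (1 / 2))).pow 2)).add
      ((((hasDerivAt_id t).const_mul (1 / 4 : ℝ)).const_sub ((m : ℝ) + 1 / 2)).mul
        (d0.pow 2))).const_mul s)).mul h1
    have ode := lag_ode_eval m t
    rw [← hL, ← hL1, ← hL2] at ode
    simp only [hQ]
    refine d2.congr_deriv ?_
    simp only [← hL1, ← hL2, Pi.mul_apply, Pi.add_apply, Pi.pow_apply, Pi.sub_apply, id,
      Nat.cast_ofNat, Nat.add_one_sub_one, pow_one]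
    linear_combination
      (Real.exp (-t) * s * 2 * (L1.eval t - 1 / 2 * L.eval t)) * ode
  have hmono : Monotone (fun t => (Q (-2)).eval t * Real.exp (-t)) := by
    refine monotone_of_deriv_nonneg (fun t => (hder (-2) t).differentiableAt) fun t => ?_
    rw [(hder (-2) t).deriv]
    have : 2 * L.eval t * L1.eval t - L.eval t ^ 2 -
        -2 * (L1.eval t ^ 2 - L.eval t * L1.eval t + L.eval t ^ 2 / 2) = 2 * L1.eval t ^ 2 := by ring
    rw [this]
    positivity
  have hanti : Antitone (fun t => (Q 2).eval t * Real.exp (-t)) := by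
    refine antitone_of_deriv_nonpos (fun t => (hder 2 t).differentiableAt) fun t => ?_
    rw [(hder 2 t).deriv]
    have : 2 * L.eval t * L1.eval t - L.eval t ^ 2 -
        2 * (L1.eval t ^ 2 - L.eval t * L1.eval t + L.eval t ^ 2 / 2) =
        -(2 * (L1.eval t - L.eval t) ^ 2) := by ring
    rw [this, mul_neg, neg_nonpos]
    positivity
  -- φ² - 2E increases to its limit 0, hence is nonpositive, and φ² + 2E is at most its value 2m + 2
  -- at the origin. The sum of the two bounds is twice the claim.
  have h1 := hmono.ge_of_tendsto (tendsto_polynomial_mul_exp_neg (Q (-2))) t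
  have h2 := hanti ht
  simp only [hQ, neg_zero, Real.exp_zero, mul_one, zero_mul, zero_add, hL, lag_eval_zero] at h1 h2
  have h3 : lagFun 0 m t ^ 2 = (lag 0 m).eval t ^ 2 * Real.exp (-t) := by
    rw [lagFun, mul_pow, ← Real.exp_nat_mul, mul_comm]
    congr 2
    push_cast; ring
  rw [h3]
  linarith

theorem abs_lagFun_zero_le (m : ℕ) {t : ℝ} (ht : 0 ≤ t) : |lagFun 0 m t| ≤ m + 1 := by
  refine abs_le_of_sq_le_sq ((sq_lagFun_zero_le m ht).trans ?_) (by positivity)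
  have : (0 : ℝ) ≤ m := by positivity
  nlinarith

/-- The contiguous relation telescopes: upper index j + 1 is the sum over i ≤ m of upper index j.
Each raise thus costs a factor m + 1. -/
theorem abs_lagFun_le (j m : ℕ) {t : ℝ} (ht : 0 ≤ t) : |lagFun j m t| ≤ ((m : ℝ) + 1) ^ (j + 1) := by
  induction j generalizing m with
  | zero => simpa using abs_lagFun_zero_le m ht
  | succ j ih =>
    have hsum : lagFun (j + 1) m t = ∑ i ∈ Finset.range (m + 1), lagFun j i t := by
      induction m with
      | zero => simp [lagFun_zero_right]
      | succ m ihm =>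
        rw [Finset.sum_range_succ, ← ihm, lagFun_contiguous j m]; ring
    rw [hsum]
    calc |∑ i ∈ Finset.range (m + 1), lagFun j i t|
        ≤ ∑ i ∈ Finset.range (m + 1), |lagFun j i t| := Finset.abs_sum_le_sum_abs _ _
      _ ≤ ∑ _i ∈ Finset.range (m + 1), ((m : ℝ) + 1) ^ (j + 1) := by
          refine Finset.sum_le_sum fun i hi => (ih i).trans ?_
          have : (i : ℝ) ≤ m := by
            exact_mod_cast Nat.lt_succ_iff.1 (Finset.mem_range.1 hi)
          gcongr
      _ = ((m : ℝ) + 1) ^ (j + 1 + 1) := by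
          simp only [Finset.sum_const, Finset.card_range, nsmul_eq_mul]
          push_cast; ring

/-- Every factor t is spent on lowering the upper index by one through `mul_lagFun`. The two
coefficients that appear are at most half the base of the bound, so each power of t costs one
further factor; the exponent 2k leaves slack. -/
theorem abs_pow_mul_lagFun_le (j k m : ℕ) {t : ℝ} (ht : 0 ≤ t) :
    |t ^ k * lagFun (j + k) m t| ≤ (2 * ((m : ℝ) + j + k + 1)) ^ (2 * k + j + 1) := by
  induction k generalizing m with
  | zero =>
    simp only [pow_zero, one_mul, add_zero, mul_zero, zero_add, Nat.cast_zero]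
    refine (abs_lagFun_le j m ht).trans (pow_le_pow_left₀ (by positivity) ?_ _)
    have : (0 : ℝ) ≤ m := by positivity
    have : (0 : ℝ) ≤ j := by positivity
    linarith
  | succ k ih =>
    have e : t ^ (k + 1) * lagFun (j + (k + 1)) m t =
        ((m : ℝ) + (j + k) + 1) * (t ^ k * lagFun (j + k) m t) -
          ((m : ℝ) + 1) * (t ^ k * lagFun (j + k) (m + 1) t) := by
      have h := mul_lagFun (j + k) m t
      push_cast at h
      rw [pow_succ, mul_assoc, ← add_assoc, h]; ring
    rw [e]
    have hm : (0 : ℝ) ≤ m := by positivity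
    have hj : (0 : ℝ) ≤ j := by positivity
    have hk : (0 : ℝ) ≤ k := by positivity
    set B : ℝ := 2 * ((m : ℝ) + j + (k + 1 : ℕ) + 1) with hB
    push_cast at hB
    have hB1 : 1 ≤ B := by rw [hB]; linarith
    have b1 : |t ^ k * lagFun (j + k) m t| ≤ B ^ (2 * k + j + 1) :=
      (ih m).trans (pow_le_pow_left₀ (by positivity) (by rw [hB]; linarith) _)
    have b2 : |t ^ k * lagFun (j + k) (m + 1) t| ≤ B ^ (2 * k + j + 1) :=
      (ih (m + 1)).trans (pow_le_pow_left₀ (by positivity) (by rw [hB]; push_cast; linarith) _)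
    have hP : 0 ≤ B ^ (2 * k + j + 1) := by positivity
    calc _ ≤ |((m : ℝ) + (j + k) + 1) * (t ^ k * lagFun (j + k) m t)| +
          |((m : ℝ) + 1) * (t ^ k * lagFun (j + k) (m + 1) t)| := abs_sub _ _
      _ ≤ (B / 2) * B ^ (2 * k + j + 1) + (B / 2) * B ^ (2 * k + j + 1) := by
          rw [abs_mul ((m : ℝ) + (j + k) + 1), abs_mul ((m : ℝ) + 1),
            abs_of_nonneg (by positivity : (0 : ℝ) ≤ (m : ℝ) + (j + k) + 1),
            abs_of_nonneg (by positivity : (0 : ℝ) ≤ (m : ℝ) + 1)]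
          gcongr <;> rw [hB] <;> linarith
      _ = B ^ (2 * k + j + 1 + 1) := by rw [pow_succ]; ring
      _ ≤ B ^ (2 * (k + 1) + j + 1) := pow_le_pow_right₀ hB1 (by omega)

/-! ### Derivatives of Laguerre functions as combinations of Laguerre functions -/

/-- The contiguous relation is iterated k times; its two coefficients ±1 at most double the ℓ¹ norm
at each step. At n = 0 all upper indices give the same function e^{-t/2}. -/
theorem exists_combination_raise (j k n : ℕ) : ∃ c : ℕ → ℝ,
    ∑ m ∈ Finset.range (n + 1), |c m| ≤ 2 ^ k ∧
    ∀ t, lagFun j n t = ∑ m ∈ Finset.range (n + 1), c m * lagFun (j + k) m t := by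
  induction k generalizing j n with
  | zero =>
    refine ⟨fun m => if m = n then 1 else 0, ?_, fun t => ?_⟩
    · simp [apply_ite]
    · simp
  | succ k ih =>
    rcases n with _ | n
    · refine ⟨fun _ => 1, ?_, fun t => ?_⟩
      · simpa using one_le_pow₀ (M₀ := ℝ) (n := k + 1) one_le_two
      · simp [lagFun_zero_right]
    · obtain ⟨c, hc, hc'⟩ := ih (j + 1) (n + 1)
      obtain ⟨b, hb, hb'⟩ := ih (j + 1) n
      refine ⟨fun m => c m - if m ∈ Finset.range (n + 1) then b m else 0, ?_, fun t => ?_⟩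
      · calc _ ≤ ∑ m ∈ Finset.range (n + 1 + 1), (|c m| +
              abs (if m ∈ Finset.range (n + 1) then b m else 0)) :=
            Finset.sum_le_sum fun m _ => abs_sub _ _
          _ = ∑ m ∈ Finset.range (n + 1 + 1), |c m| + ∑ m ∈ Finset.range (n + 1), |b m| := by
            rw [Finset.sum_add_distrib]
            congr 1
            rw [Finset.sum_range_succ]
            simp only [Finset.mem_range, lt_irrefl, if_false, abs_zero, add_zero]
            exact Finset.sum_congr rfl fun m hm => by rw [if_pos (Finset.mem_range.1 hm)]
          _ ≤ 2 ^ k + 2 ^ k := add_le_add hc hb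
          _ = 2 ^ (k + 1) := by ring
      · rw [lagFun_contiguous, hc', hb']
        simp only [sub_mul, Finset.sum_sub_distrib, add_right_comm j 1 k, add_assoc j k 1]
        congr 1
        rw [Finset.sum_range_succ _ (n + 1)]
        simp only [Finset.mem_range, lt_irrefl, if_false, zero_mul, add_zero]
        exact Finset.sum_congr rfl fun m hm => by rw [if_pos (Finset.mem_range.1 hm)]

theorem contDiff_lagFun (j m : ℕ) : ContDiff ℝ ∞ (lagFun j m) := by
  unfold lagFun
  exact (Real.contDiff_exp.comp (contDiff_neg.div_const 2)).mul (by
    simpa using (lag j m).contDiff_aeval (𝕜 := ℝ) ∞)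

theorem deriv_lagFun_zero (j : ℕ) : deriv (lagFun j 0) = (-(1 / 2) : ℝ) • lagFun (j + 1) 0 :=
  funext fun t => by rw [(hasDerivAt_lagFun_zero j t).deriv, Pi.smul_apply, smul_eq_mul]

theorem deriv_lagFun_succ (j n : ℕ) : deriv (lagFun j (n + 1)) =
    (-(1 / 2) : ℝ) • (lagFun (j + 1) (n + 1) + lagFun (j + 1) n) := funext fun t => by
  rw [(hasDerivAt_lagFun_succ j n t).deriv, lagFun_contiguous]
  simp only [Pi.smul_apply, smul_eq_mul, Pi.add_apply]; ring

/-- A derivative raises the upper index once with coefficients -1/2, -1/2 (only one of them at n =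
0), so the ℓ¹ norm does not grow with p. -/
theorem exists_combination_iteratedDeriv (j p n : ℕ) : ∃ c : ℕ → ℝ,
    ∑ m ∈ Finset.range (n + 1), |c m| ≤ 1 ∧
    ∀ t, iteratedDeriv p (lagFun j n) t = ∑ m ∈ Finset.range (n + 1), c m * lagFun (j + p) m t := by
  induction p generalizing j n with
  | zero =>
    refine ⟨fun m => if m = n then 1 else 0, ?_, fun t => ?_⟩
    · simp [apply_ite]
    · simp
  | succ p ih =>
    rcases n with _ | n
    · obtain ⟨c, hc, hc'⟩ := ih (j + 1) 0
      refine ⟨fun m => -(1 / 2) * c m, ?_, fun t => ?_⟩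
      · simp only [abs_mul, ← Finset.mul_sum]
        norm_num at hc ⊢
        linarith
      · rw [iteratedDeriv_succ', deriv_lagFun_zero]
        rw [iteratedDeriv_const_smul_field, hc']
        simp [add_right_comm j 1 p, add_assoc j p 1, mul_assoc]
    · obtain ⟨c, hc, hc'⟩ := ih (j + 1) (n + 1)
      obtain ⟨b, hb, hb'⟩ := ih (j + 1) n
      refine ⟨fun m => -(1 / 2) * (c m + if m ∈ Finset.range (n + 1) then b m else 0), ?_,
        fun t => ?_⟩
      · calc
          _ ≤ ∑ m ∈ Finset.range (n + 1 + 1), (1 / 2) * (abs (c m) +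
              abs (if m ∈ Finset.range (n + 1) then b m else 0)) := by
            refine Finset.sum_le_sum fun m _ => ?_
            rw [abs_mul, abs_neg, abs_of_pos (by norm_num : (0 : ℝ) < 1 / 2)]
            gcongr
            exact abs_add_le _ _
          _ = (1 / 2) * (∑ m ∈ Finset.range (n + 1 + 1), |c m| +
              ∑ m ∈ Finset.range (n + 1), |b m|) := by
            rw [← Finset.mul_sum, Finset.sum_add_distrib]
            congr 2
            rw [Finset.sum_range_succ]
            simp only [Finset.mem_range, lt_irrefl, if_false, abs_zero, add_zero]
            exact Finset.sum_congr rfl fun m hm => by rw [if_pos (Finset.mem_range.1 hm)]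
          _ ≤ 1 := by linarith
      · have hs : ∀ m, ContDiffAt ℝ p (lagFun (j + 1) m) t := fun m =>
          ((contDiff_lagFun (j + 1) m).of_le (by exact_mod_cast le_top)).contDiffAt
        rw [iteratedDeriv_succ', deriv_lagFun_succ, iteratedDeriv_const_smul_field,
          iteratedDeriv_add (hs _) (hs _), hc', hb']
        simp only [mul_assoc, add_mul, mul_add, Finset.sum_add_distrib, add_right_comm j 1 p,
          add_assoc j p 1, smul_eq_mul, ← Finset.mul_sum]
        congr 2
        rw [Finset.sum_range_succ _ (n + 1)]
        simp only [Finset.mem_range, lt_irrefl, if_false, zero_mul, add_zero]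
        exact Finset.sum_congr rfl fun m hm => by rw [if_pos (Finset.mem_range.1 hm)]

/-- Differentiation reaches upper index p; the extra k raises bring it to p + k, the index for which
t^{p+k} is the orthogonality weight. Only these raises contribute to the factor 2^k. -/
theorem exists_combination_iteratedDeriv_raise (p k n : ℕ) : ∃ c : ℕ → ℝ,
    ∑ m ∈ Finset.range (n + 1), |c m| ≤ 2 ^ k ∧
    ∀ t, iteratedDeriv p (lagFun 0 n) t =
      ∑ m ∈ Finset.range (n + 1), c m * lagFun (p + k) m t := by
  obtain ⟨c, hc, hc'⟩ := exists_combination_iteratedDeriv 0 p n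
  choose b hb hb' using fun m => exists_combination_raise p k m
  let b' : ℕ → ℕ → ℝ := fun i m => if m ∈ Finset.range (i + 1) then b i m else 0
  have hsub : ∀ i ∈ Finset.range (n + 1), ∀ g : ℕ → ℝ, (∀ m, m ∉ Finset.range (i + 1) → g m = 0) →
      ∑ m ∈ Finset.range (i + 1), g m = ∑ m ∈ Finset.range (n + 1), g m := fun i hi g hg =>
    Finset.sum_subset (Finset.range_mono (by simp at hi; omega)) fun m _ hm => hg m hm
  have hbs : ∀ i ∈ Finset.range (n + 1), ∑ m ∈ Finset.range (n + 1), |b' i m| ≤ 2 ^ k := by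
    intro i hi
    rw [← hsub i hi _ (fun m hm => by simp only [b', if_neg hm, abs_zero])]
    refine le_of_eq_of_le (Finset.sum_congr rfl fun m hm => ?_) (hb i)
    simp only [b', if_pos hm]
  have hbs' : ∀ i ∈ Finset.range (n + 1), ∀ t, lagFun p i t =
      ∑ m ∈ Finset.range (n + 1), b' i m * lagFun (p + k) m t := by
    intro i hi t
    rw [← hsub i hi _ (fun m hm => by simp only [b', if_neg hm, zero_mul]), hb']
    refine Finset.sum_congr rfl fun m hm => ?_
    simp only [b', if_pos hm]
  refine ⟨fun m => ∑ i ∈ Finset.range (n + 1), c i * b' i m, ?_, fun t => ?_⟩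
  · calc _ ≤ ∑ m ∈ Finset.range (n + 1), ∑ i ∈ Finset.range (n + 1), |c i| * |b' i m| := by
          refine Finset.sum_le_sum fun m _ => (Finset.abs_sum_le_sum_abs _ _).trans_eq ?_
          simp only [abs_mul]
      _ = ∑ i ∈ Finset.range (n + 1), |c i| * ∑ m ∈ Finset.range (n + 1), |b' i m| := by
          rw [Finset.sum_comm]; simp only [Finset.mul_sum]
      _ ≤ ∑ i ∈ Finset.range (n + 1), |c i| * 2 ^ k :=
          Finset.sum_le_sum fun i hi => mul_le_mul_of_nonneg_left (hbs i hi) (abs_nonneg _)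
      _ ≤ 2 ^ k := by
          rw [← Finset.sum_mul]
          exact mul_le_of_le_one_left (by positivity) hc
  · rw [hc', zero_add]
    simp only [Finset.sum_mul, mul_assoc]
    rw [Finset.sum_comm]
    simp only [← Finset.mul_sum]
    exact Finset.sum_congr rfl fun i hi => by rw [hbs' i hi t]

theorem abs_pow_mul_iteratedDeriv_lagFun_le (p k n : ℕ) {t : ℝ} (ht : 0 ≤ t) :
    |t ^ k * iteratedDeriv p (lagFun 0 n) t| ≤
      2 ^ k * (2 * ((n : ℝ) + p + k + 1)) ^ (2 * k + p + 1) := by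
  obtain ⟨c, hc, hc'⟩ := exists_combination_iteratedDeriv_raise p k n
  rw [hc', Finset.mul_sum]
  calc _ ≤ ∑ m ∈ Finset.range (n + 1), |t ^ k * (c m * lagFun (p + k) m t)| :=
        Finset.abs_sum_le_sum_abs _ _
    _ ≤ ∑ m ∈ Finset.range (n + 1), |c m| * (2 * ((n : ℝ) + p + k + 1)) ^ (2 * k + p + 1) := by
        refine Finset.sum_le_sum fun m hm => ?_
        rw [mul_left_comm, abs_mul]
        have : (m : ℝ) ≤ n := by exact_mod_cast Nat.lt_succ_iff.1 (Finset.mem_range.1 hm)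
        refine mul_le_mul_of_nonneg_left ((abs_pow_mul_lagFun_le p k m ht).trans ?_) (abs_nonneg _)
        gcongr
    _ ≤ _ := by
        rw [← Finset.sum_mul]
        gcongr

/-! ### Integrals of Laguerre functions of one variable -/

theorem integrableOn_pow_mul_exp_neg (n : ℕ) :
    IntegrableOn (fun t : ℝ => t ^ n * Real.exp (-t)) (Ioi 0) := by
  have h := Real.GammaIntegral_convergent (s := n + 1) (by positivity)
  refine h.congr_fun (fun t _ => ?_) measurableSet_Ioi
  simp only [add_sub_cancel_right, Real.rpow_natCast]
  ring

theorem integral_pow_mul_exp_neg (n : ℕ) :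
    ∫ t in Ioi (0 : ℝ), t ^ n * Real.exp (-t) = n.factorial := by
  rw [← Real.Gamma_nat_eq_factorial, Real.Gamma_eq_integral (by positivity)]
  refine setIntegral_congr_fun measurableSet_Ioi fun t _ => ?_
  simp only [add_sub_cancel_right, Real.rpow_natCast]
  ring

theorem integrableOn_polynomial_mul_exp_neg (P : Polynomial ℝ) :
    IntegrableOn (fun t : ℝ => P.eval t * Real.exp (-t)) (Ioi 0) := by
  have h : (fun t : ℝ => P.eval t * Real.exp (-t)) = fun t =>
      ∑ i ∈ Finset.range (P.natDegree + 1), P.coeff i * (t ^ i * Real.exp (-t)) := by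
    funext t
    rw [Polynomial.eval_eq_sum_range, Finset.sum_mul]
    exact Finset.sum_congr rfl fun i _ => by ring
  rw [h]
  exact integrable_finsetSum _ fun i _ => (integrableOn_pow_mul_exp_neg i).const_mul _

theorem lagFun_mul_lagFun (i j m n : ℕ) (t : ℝ) :
    lagFun i m t * lagFun j n t = (lag i m * lag j n).eval t * Real.exp (-t) := by
  have : Real.exp (-t) = Real.exp (-t / 2) * Real.exp (-t / 2) := by
    rw [← Real.exp_add]; congr 1; ring
  simp only [lagFun, this, Polynomial.eval_mul]; ring

theorem pow_mul_lagFun_mul_lagFun (k i j m n : ℕ) (t : ℝ) :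
    t ^ k * (lagFun i m t * lagFun j n t) =
      (Polynomial.X ^ k * (lag i m * lag j n)).eval t * Real.exp (-t) := by
  rw [lagFun_mul_lagFun]
  simp only [Polynomial.eval_mul, Polynomial.eval_pow, Polynomial.eval_X]; ring

theorem integrableOn_pow_mul_lagFun_mul_lagFun (k i j m n : ℕ) :
    IntegrableOn (fun t => t ^ k * (lagFun i m t * lagFun j n t)) (Ioi 0) := by
  simp only [pow_mul_lagFun_mul_lagFun]
  exact integrableOn_polynomial_mul_exp_neg _

/-- The inner products of the Laguerre functions with weight `t^j`. -/
noncomputable def lagInner (j m n : ℕ) : ℝ := ∫ t in Ioi (0 : ℝ), t ^ j * (lagFun j m t * lagFun j n t)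

theorem lagInner_comm (j m n : ℕ) : lagInner j m n = lagInner j n m := by
  simp only [lagInner, mul_comm (lagFun j m _)]

/-- The ladder function t^{j+1} `lagFun (j + 1) m` times `lagFun j g` vanishes at 0 and at infinity,
so its derivative integrates to zero. The terms with 1/2 and -1/2 cancel. For g = n + 1 both lower
indices drop and j rises; for g = 0 there is no remainder R. -/
theorem lagInner_step (j m : ℕ) (g : ℕ) (c : ℝ) (R : ℝ → ℝ)
    (hg : ∀ t, HasDerivAt (lagFun j g) (-(1 / 2) * lagFun j g t - R t) t)
    (hR : IntegrableOn (fun t => t ^ (j + 1) * (lagFun (j + 1) m t * R t)) (Ioi 0))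
    (hc : ∫ t in Ioi (0 : ℝ), t ^ (j + 1) * (lagFun (j + 1) m t * R t) = c) :
    ((m : ℝ) + 1) * lagInner j (m + 1) g = c := by
  have hd : ∀ t ∈ Ici (0 : ℝ), HasDerivAt
      (fun t => t ^ (j + 1) * lagFun (j + 1) m t * lagFun j g t)
      (((m : ℝ) + 1) * (t ^ j * (lagFun j (m + 1) t * lagFun j g t)) -
        t ^ (j + 1) * (lagFun (j + 1) m t * R t)) t := fun t _ => by
    refine ((hasDerivAt_weight_lagFun j m t).mul (hg t)).congr_deriv ?_
    ring
  have hi1 : IntegrableOn (fun t => ((m : ℝ) + 1) * (t ^ j * (lagFun j (m + 1) t * lagFun j g t)))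
      (Ioi 0) := (integrableOn_pow_mul_lagFun_mul_lagFun j j j (m + 1) g).const_mul _
  have hlim : Tendsto (fun t => t ^ (j + 1) * lagFun (j + 1) m t * lagFun j g t) atTop (𝓝 0) := by
    simp only [mul_assoc, pow_mul_lagFun_mul_lagFun]
    exact tendsto_polynomial_mul_exp_neg _
  have h := integral_Ioi_of_hasDerivAt_of_tendsto' hd (hi1.sub hR) hlim
  rw [integral_sub hi1 hR, integral_const_mul, hc] at h
  simp only [ne_eq, Nat.add_eq_zero_iff, one_ne_zero, and_false, not_false_eq_true, zero_pow,
    zero_mul, sub_zero] at h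
  rw [lagInner]
  linarith

theorem lagInner_succ_succ (j m n : ℕ) :
    ((m : ℝ) + 1) * lagInner j (m + 1) (n + 1) = lagInner (j + 1) m n :=
  lagInner_step j m (n + 1) _ (lagFun (j + 1) n) (hasDerivAt_lagFun_succ j n)
    (integrableOn_pow_mul_lagFun_mul_lagFun _ _ _ _ _) rfl

theorem lagInner_succ_zero (j m : ℕ) : lagInner j (m + 1) 0 = 0 := by
  have h := lagInner_step j m 0 0 (fun _ => 0) (fun t => by
    refine (hasDerivAt_lagFun_zero j t).congr_deriv ?_
    simp [lagFun_zero_right]) (by simp) (by simp)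
  have : (m : ℝ) + 1 ≠ 0 := by positivity
  simpa [this] using h

theorem lagInner_self (j m : ℕ) :
    lagInner j m m = ((m + j).factorial : ℝ) / (m.factorial : ℝ) := by
  induction m generalizing j with
  | zero =>
    simp only [lagInner, lagFun_mul_lagFun, lag_zero_right]
    simp [integral_pow_mul_exp_neg]
  | succ m ih =>
    have h := lagInner_succ_succ j m m
    rw [ih (j + 1)] at h
    have h1 : (m : ℝ) + 1 ≠ 0 := by positivity
    have h2 : (m.factorial : ℝ) ≠ 0 := by positivity
    rw [show m + 1 + j = m + (j + 1) by ring, Nat.factorial_succ]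
    push_cast
    rw [eq_div_iff (by positivity)]
    field_simp at h
    linarith

theorem lagInner_of_ne (j : ℕ) {m n : ℕ} (h : m ≠ n) : lagInner j m n = 0 := by
  induction m generalizing j n with
  | zero =>
    obtain ⟨n, rfl⟩ := Nat.exists_eq_succ_of_ne_zero h.symm
    rw [lagInner_comm]
    exact lagInner_succ_zero j n
  | succ m ih =>
    rcases n with _ | n
    · exact lagInner_succ_zero j m
    · have h1 := lagInner_succ_succ j m n
      rw [ih (j + 1) (fun h' => h (by rw [h']))] at h1
      have : (m : ℝ) + 1 ≠ 0 := by positivity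
      simpa [this] using h1

theorem lagInner_zero_left (m n : ℕ) :
    ∫ t in Ioi (0 : ℝ), lagFun 0 m t * lagFun 0 n t = if m = n then 1 else 0 := by
  have h : ∫ t in Ioi (0 : ℝ), lagFun 0 m t * lagFun 0 n t = lagInner 0 m n := by simp [lagInner]
  rw [h]
  split_ifs with hmn
  · subst hmn
    rw [lagInner_self, add_zero, div_self (by positivity)]
  · exact lagInner_of_ne 0 hmn

theorem continuous_lagFun (j m : ℕ) : Continuous (lagFun j m) := (contDiff_lagFun j m).continuous

theorem rpow_half_sq {t : ℝ} (ht : 0 ≤ t) (N : ℕ) : (t ^ ((N : ℝ) / 2)) ^ 2 = t ^ N := by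
  rw [← Real.rpow_natCast, ← Real.rpow_mul ht]
  norm_num

/-- The weighted `L²` norms of the Laguerre functions. -/
theorem eLpNorm_rpow_mul_lagFun (j m : ℕ) :
    eLpNorm (fun t : ℝ => t ^ ((j : ℝ) / 2) * lagFun j m t) 2 (volume.restrict (Ioi 0)) =
      ENNReal.ofReal (√(((m + j).factorial : ℝ) / (m.factorial : ℝ))) := by
  rw [eLpNorm_eq_lintegral_rpow_enorm_toReal two_ne_zero ENNReal.ofNat_ne_top]
  have h : ∫⁻ t in Ioi (0 : ℝ), ‖t ^ ((j : ℝ) / 2) * lagFun j m t‖ₑ ^ (2 : ℝ≥0∞).toReal =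
      ENNReal.ofReal (lagInner j m m) := by
    rw [lagInner, ofReal_integral_eq_lintegral_ofReal
      (integrableOn_pow_mul_lagFun_mul_lagFun j j j m m)]
    · refine setLIntegral_congr_fun measurableSet_Ioi fun t ht => ?_
      have ht' : (0 : ℝ) ≤ t := le_of_lt ht
      simp only [ENNReal.toReal_ofNat, ENNReal.rpow_ofNat]
      rw [Real.enorm_eq_ofReal_abs, ← ENNReal.ofReal_pow (abs_nonneg _), sq_abs, mul_pow,
        rpow_half_sq ht']
      congr 1; ring
    · refine (ae_restrict_iff' measurableSet_Ioi).2 (.of_forall fun t ht => ?_)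
      have ht' : (0 : ℝ) ≤ t := le_of_lt ht
      exact mul_nonneg (pow_nonneg ht' _) (mul_self_nonneg _)
  rw [h, lagInner_self, ENNReal.toReal_ofNat, Real.sqrt_eq_rpow, ENNReal.ofReal_rpow_of_nonneg
    (by positivity) (by norm_num)]

theorem sqrt_factorial_div_le (j m n : ℕ) (h : m ≤ n) :
    √(((m + j).factorial : ℝ) / (m.factorial : ℝ)) ≤ ((n : ℝ) + j) ^ ((j : ℝ) / 2) := by
  have h1 : ((m + j).factorial : ℝ) / (m.factorial : ℝ) ≤ ((n : ℝ) + j) ^ j := by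
    rw [div_le_iff₀ (by positivity)]
    have h2 : (m + j).factorial = m.factorial * (m + 1).ascFactorial j :=
      (Nat.factorial_mul_ascFactorial m j).symm
    have h3 : (m + 1).ascFactorial j ≤ (n + j) ^ j := by
      rcases j with _ | j
      · simp
      · refine (Nat.ascFactorial_le_pow_add m (j + 1)).trans (Nat.pow_le_pow_left (by omega) _)
    rw [h2]
    push_cast
    rw [mul_comm]
    gcongr
    exact_mod_cast h3
  calc _ ≤ √(((n : ℝ) + j) ^ j) := Real.sqrt_le_sqrt h1
    _ = _ := by
      rw [Real.sqrt_eq_rpow, ← Real.rpow_natCast, ← Real.rpow_mul (by positivity)]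
      congr 1; ring

/-- Expanding in upper index p + k makes the weight match `eLpNorm_rpow_mul_lagFun`. The triangle
inequality then pays the ℓ¹ norm 2^k times the largest of the explicit norms √((m+p+k)!/m!), m ≤ n.
-/
theorem eLpNorm_rpow_mul_iteratedDeriv_lagFun_le (p k n : ℕ) :
    eLpNorm (fun t : ℝ => t ^ (((p + k : ℕ) : ℝ) / 2) * iteratedDeriv p (lagFun 0 n) t) 2
      (volume.restrict (Ioi 0)) ≤
      ENNReal.ofReal (2 ^ k * ((n : ℝ) + (p + k : ℕ)) ^ (((p + k : ℕ) : ℝ) / 2)) := by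
  obtain ⟨c, hc, hc'⟩ := exists_combination_iteratedDeriv_raise p k n
  set B : ℝ := ((n : ℝ) + (p + k : ℕ)) ^ (((p + k : ℕ) : ℝ) / 2) with hB
  have hB0 : 0 ≤ B := by positivity
  have e : (fun t : ℝ => t ^ (((p + k : ℕ) : ℝ) / 2) * iteratedDeriv p (lagFun 0 n) t) =
      ∑ m ∈ Finset.range (n + 1), fun t => c m • (t ^ (((p + k : ℕ) : ℝ) / 2) * lagFun (p + k) m t) := by
    funext t
    rw [hc', Finset.sum_apply, Finset.mul_sum]
    exact Finset.sum_congr rfl fun m _ => by rw [smul_eq_mul]; ring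
  have hmeas : ∀ m, AEStronglyMeasurable
      (fun t : ℝ => t ^ (((p + k : ℕ) : ℝ) / 2) * lagFun (p + k) m t) (volume.restrict (Ioi 0)) :=
    fun m => (Measurable.mul (by fun_prop) (continuous_lagFun _ _).measurable).aestronglyMeasurable
  rw [e]
  calc _ ≤ ∑ m ∈ Finset.range (n + 1), eLpNorm
          (fun t : ℝ => c m • (t ^ (((p + k : ℕ) : ℝ) / 2) * lagFun (p + k) m t)) 2
          (volume.restrict (Ioi 0)) :=
        eLpNorm_sum_le (fun m _ => (hmeas m).const_smul (c m)) (by norm_num)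
    _ ≤ ∑ m ∈ Finset.range (n + 1), ENNReal.ofReal (|c m| * B) := by
        refine Finset.sum_le_sum fun m hm => ?_
        have := eLpNorm_const_smul (c m)
          (fun t : ℝ => t ^ (((p + k : ℕ) : ℝ) / 2) * lagFun (p + k) m t) 2
          (volume.restrict (Ioi 0))
        refine (le_of_eq this).trans ?_
        rw [eLpNorm_rpow_mul_lagFun, Real.enorm_eq_ofReal_abs,
          ← ENNReal.ofReal_mul (abs_nonneg _)]
        refine ENNReal.ofReal_le_ofReal (mul_le_mul_of_nonneg_left ?_ (abs_nonneg _))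
        exact sqrt_factorial_div_le _ _ _ (Nat.lt_succ_iff.1 (Finset.mem_range.1 hm))
    _ ≤ _ := by
        rw [← ENNReal.ofReal_sum_of_nonneg (fun m _ => by positivity), ← Finset.sum_mul]
        exact ENNReal.ofReal_le_ofReal (mul_le_mul_of_nonneg_right hc hB0)

/-! ### Products of functions of one variable -/

theorem orthant_eq_pi (d : ℕ) : orthant d = Set.pi univ fun _ => Ioi (0 : ℝ) := by
  ext x; simp [orthant]

theorem volume_restrict_orthant (d : ℕ) : (volume : Measure (Fin d → ℝ)).restrict (orthant d) =
    Measure.pi fun _ => volume.restrict (Ioi (0 : ℝ)) := by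
  rw [orthant_eq_pi, volume_pi, Measure.restrict_pi_pi]

theorem measurableSet_orthant (d : ℕ) : MeasurableSet (orthant d) :=
  (isOpen_orthant d).measurableSet

theorem lintegral_fin_prod_eq_prod {d : ℕ} {μ : Fin d → Measure ℝ} [∀ i, SigmaFinite (μ i)]
    (f : Fin d → ℝ → ℝ≥0∞) (hf : ∀ i, Measurable (f i)) :
    ∫⁻ x : Fin d → ℝ, ∏ i, f i (x i) ∂(Measure.pi μ) = ∏ i, ∫⁻ x, f i x ∂(μ i) := by
  induction d with
  | zero => simp
  | succ n ih =>
    rw [← ((measurePreserving_piFinSuccAbove μ 0).symm).lintegral_comp_emb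
      (MeasurableEquiv.measurableEmbedding _)]
    simp_rw [MeasurableEquiv.piFinSuccAbove_symm_apply, Fin.insertNthEquiv,
      Fin.prod_univ_succ, Fin.insertNth_zero, Equiv.coe_fn_mk, Fin.cons_succ,
      Fin.zero_succAbove, cast_eq, Fin.cons_zero]
    rw [lintegral_prod_mul (hf 0).aemeasurable
      (f := f 0) (g := fun x : Fin n → ℝ => ∏ i : Fin n, f i.succ (x i))
      (Finset.measurable_prod _ fun i _ =>
        (hf i.succ).comp (measurable_pi_apply i)).aemeasurable,
      ih _ (fun i => hf i.succ)]

theorem eLpNorm_prod_orthant {d : ℕ} (f : Fin d → ℝ → ℝ) (hf : ∀ i, Measurable (f i)) :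
    eLpNorm (fun x : Fin d → ℝ => ∏ i, f i (x i)) 2 (volume.restrict (orthant d)) =
      ∏ i, eLpNorm (f i) 2 (volume.restrict (Ioi 0)) := by
  simp only [eLpNorm_eq_lintegral_rpow_enorm_toReal two_ne_zero ENNReal.ofNat_ne_top,
    volume_restrict_orthant]
  rw [ENNReal.prod_rpow_of_nonneg (by positivity), ← lintegral_fin_prod_eq_prod]
  · congr 2
    funext x
    rw [ENNReal.prod_rpow_of_nonneg (by positivity)]
    congr 1
    simp [Real.enorm_eq_ofReal_abs, Finset.abs_prod, ENNReal.ofReal_prod_of_nonneg]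
  · intro i
    exact (hf i).enorm.pow_const _

/-! ### Estimates for stretched exponentials -/

/-- `|n|^{1/α}`. -/
noncomputable def rho {d : ℕ} (α : ℝ) (n : Fin d → ℕ) : ℝ := ((∑ i, n i : ℕ) : ℝ) ^ (1 / α)

theorem rho_nonneg {d : ℕ} (α : ℝ) (n : Fin d → ℕ) : 0 ≤ rho α n := by
  unfold rho; positivity

/-- The inequality y ≤ e^y at y = cx/M, raised to the power M. For M = 0 the convention 0^0 = 1
makes both powers equal to one. -/
theorem rpow_le_mul_exp {x c M : ℝ} (hx : 0 ≤ x) (hc : 0 < c) (hM : 0 ≤ M) :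
    x ^ M ≤ (M / c) ^ M * Real.exp (c * x) := by
  rcases hM.eq_or_lt with rfl | hM
  · simpa using by positivity
  · have h1 : c * x / M ≤ Real.exp (c * x / M) := by
      have := Real.add_one_le_exp (c * x / M); linarith
    have h2 : (c * x / M) ^ M ≤ Real.exp (c * x) := by
      calc _ ≤ (Real.exp (c * x / M)) ^ M := Real.rpow_le_rpow (by positivity) h1 hM.le
        _ = Real.exp (c * x) := by rw [← Real.exp_mul]; congr 1; field_simp
    calc x ^ M = (M / c * (c * x / M)) ^ M := by congr 1; field_simp
      _ = (M / c) ^ M * (c * x / M) ^ M := Real.mul_rpow (by positivity) (by positivity)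
      _ ≤ _ := by gcongr

theorem rpow_eq_exp_neg {q : ℝ} (hq : 0 < q) (x : ℝ) : q ^ x = Real.exp (-(-Real.log q * x)) := by
  rw [Real.rpow_def_of_pos hq]; congr 1; ring

theorem rpow_mul_rpow_le {q x M : ℝ} (hq : 0 < q) (hq1 : q < 1) (hx : 0 ≤ x) (hM : 0 ≤ M) :
    x ^ M * q ^ x ≤ (M / (-Real.log q)) ^ M := by
  have hc : 0 < -Real.log q := by have := Real.log_neg hq hq1; linarith
  rw [rpow_eq_exp_neg hq, Real.exp_neg, ← div_eq_mul_inv, div_le_iff₀ (Real.exp_pos _)]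
  exact rpow_le_mul_exp hx hc hM

theorem summable_fin_prod {d : ℕ} (f : Fin d → ℕ → ℝ) (h0 : ∀ i n, 0 ≤ f i n)
    (hf : ∀ i, Summable (f i)) : Summable fun n : Fin d → ℕ => ∏ i, f i (n i) := by
  induction d with
  | zero => exact Summable.of_finite
  | succ d ih =>
    have h := (hf 0).mul_of_nonneg (ih (fun i => f i.succ) (fun i => h0 _) fun i => hf _) (h0 0)
      (fun n => Finset.prod_nonneg fun i _ => h0 _ _)
    rw [← (Fin.consEquiv fun _ => ℕ).summable_iff]
    refine h.congr fun x => ?_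
    simp [Fin.prod_univ_succ, Fin.consEquiv]

theorem summable_inv_sum_pow (d : ℕ) :
    Summable fun n : Fin d → ℕ => (((∑ i, n i : ℕ) : ℝ) + 1)⁻¹ ^ (2 * d) := by
  have h1 : Summable fun m : ℕ => (((m : ℝ) + 1)⁻¹) ^ 2 := by
    have := (summable_nat_add_iff 1).2 (Real.summable_nat_pow_inv.2 one_lt_two)
    refine this.congr fun m => ?_
    push_cast
    rw [inv_pow]
  refine Summable.of_nonneg_of_le (fun n => by positivity) (fun n => ?_)
    (summable_fin_prod (d := d) (fun _ m => (((m : ℝ) + 1)⁻¹) ^ 2) (fun _ _ => by positivity)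
      fun _ => h1)
  calc (((∑ i, n i : ℕ) : ℝ) + 1)⁻¹ ^ (2 * d)
      = ∏ _i : Fin d, ((((∑ i, n i : ℕ) : ℝ) + 1)⁻¹) ^ 2 := by
        simp [pow_mul]
    _ ≤ _ := by
        refine Finset.prod_le_prod (fun i _ => by positivity) fun i _ => ?_
        gcongr
        exact Finset.single_le_sum (f := n) (fun _ _ => Nat.zero_le _) (Finset.mem_univ i)

theorem exists_pow_mul_rpow_le {α q : ℝ} (hα : 1 ≤ α) (hq : 0 < q) (hq1 : q < 1) (R : ℕ) :
    ∃ C : ℝ, 0 ≤ C ∧ ∀ s : ℕ, ((s : ℝ) + 1) ^ R * q ^ ((s : ℝ) ^ (1 / α)) ≤ C := by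
  refine ⟨2 ^ R * ((α * R / (-Real.log q)) ^ (α * R) + 1), ?_, fun s => ?_⟩
  · have hc : 0 < -Real.log q := by have := Real.log_neg hq hq1; linarith
    positivity
  · have hα0 : 0 < α := by linarith
    have h1 := rpow_mul_rpow_le hq hq1 (x := (s : ℝ) ^ (1 / α)) (M := α * R) (by positivity)
      (by positivity)
    have h2 : ((s : ℝ) ^ (1 / α)) ^ (α * R) = (s : ℝ) ^ R := by
      rw [← Real.rpow_mul (by positivity), ← Real.rpow_natCast]
      congr 1; field_simp
    rw [h2] at h1
    have h3 : q ^ ((s : ℝ) ^ (1 / α)) ≤ 1 := Real.rpow_le_one hq.le hq1.le (by positivity)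
    have h4 : ((s : ℝ) + 1) ^ R ≤ 2 ^ R * ((s : ℝ) ^ R + 1) := by
      rcases Nat.eq_zero_or_pos s with rfl | hs
      · have : (1 : ℝ) ≤ 2 ^ R := one_le_pow₀ one_le_two
        have h0 : (0 : ℝ) ≤ (0 : ℝ) ^ R := by positivity
        simp only [Nat.cast_zero, zero_add, one_pow]
        nlinarith
      · have hs1 : (1 : ℝ) ≤ s := by exact_mod_cast hs
        calc ((s : ℝ) + 1) ^ R ≤ (2 * s) ^ R := by gcongr; linarith
          _ = 2 ^ R * (s : ℝ) ^ R := mul_pow _ _ _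
          _ ≤ _ := by gcongr; linarith
    have hqs : 0 ≤ q ^ ((s : ℝ) ^ (1 / α)) := by positivity
    calc _ ≤ 2 ^ R * ((s : ℝ) ^ R + 1) * q ^ ((s : ℝ) ^ (1 / α)) := by gcongr
      _ = 2 ^ R * ((s : ℝ) ^ R * q ^ ((s : ℝ) ^ (1 / α)) + q ^ ((s : ℝ) ^ (1 / α))) := by ring
      _ ≤ _ := by gcongr

theorem summable_pow_mul_rpow_rho {d : ℕ} {α q : ℝ} (hα : 1 ≤ α) (hq : 0 < q) (hq1 : q < 1)
    (R : ℕ) : Summable fun n : Fin d → ℕ => (((∑ i, n i : ℕ) : ℝ) + 1) ^ R * q ^ rho α n := by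
  obtain ⟨C, hC, h⟩ := exists_pow_mul_rpow_le hα hq hq1 (R + 2 * d)
  refine Summable.of_nonneg_of_le (fun n => by positivity) (fun n => ?_)
    ((summable_inv_sum_pow d).mul_left C)
  have := h (∑ i, n i)
  rw [inv_pow, ← div_eq_mul_inv, le_div_iff₀ (by positivity)]
  calc _ = (((∑ i, n i : ℕ) : ℝ) + 1) ^ (R + 2 * d) * q ^ rho α n := by rw [pow_add]; ring
    _ ≤ C := this

theorem summable_rpow_rho {d : ℕ} {α q : ℝ} (hα : 1 ≤ α) (hq : 0 < q) (hq1 : q < 1) :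
    Summable fun n : Fin d → ℕ => q ^ rho α n := by
  simpa using summable_pow_mul_rpow_rho (d := d) hα hq hq1 0

/-- This is the trade-off that produces the Gevrey factor. Up to 2^N, the power splits into s^{N/2}
and N^{N/2}. The first equals (s^{1/α})^{αN/2} and is beaten by the stretched exponential; the
second is at most N^{αN/2} because α ≥ 1. -/
theorem exists_add_rpow_mul_rpow_le {α q : ℝ} (hα : 1 ≤ α) (hq : 0 < q) (hq1 : q < 1) :
    ∃ C : ℝ, 1 ≤ C ∧ ∀ s N : ℕ, ((s : ℝ) + N) ^ ((N : ℝ) / 2) * q ^ ((s : ℝ) ^ (1 / α)) ≤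
      C ^ N * (N : ℝ) ^ (α / 2 * N) := by
  have hα0 : 0 < α := by linarith
  have hc : 0 < -Real.log q := by have := Real.log_neg hq hq1; linarith
  set D : ℝ := α / 2 / (-Real.log q) + 1 with hD
  have hD1 : 1 ≤ D := by rw [hD]; have : 0 ≤ α / 2 / (-Real.log q) := by positivity
                         linarith
  set K : ℝ := D ^ (α / 2) with hK
  have hK1 : 1 ≤ K := Real.one_le_rpow hD1 (by positivity)
  refine ⟨4 * K, by linarith, fun s N => ?_⟩
  rcases Nat.eq_zero_or_pos N with rfl | hN
  · simpa using Real.rpow_le_one hq.le hq1.le (by positivity)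
  have hN1 : (1 : ℝ) ≤ N := by exact_mod_cast hN
  have hqs : 0 ≤ q ^ ((s : ℝ) ^ (1 / α)) := by positivity
  have hqs1 : q ^ ((s : ℝ) ^ (1 / α)) ≤ 1 := Real.rpow_le_one hq.le hq1.le (by positivity)
  have hNN : (N : ℝ) ^ ((N : ℝ) / 2) ≤ (N : ℝ) ^ (α / 2 * N) :=
    Real.rpow_le_rpow_of_exponent_le hN1 (by nlinarith)
  have h1 : (s : ℝ) ^ ((N : ℝ) / 2) * q ^ ((s : ℝ) ^ (1 / α)) ≤ K ^ N * (N : ℝ) ^ (α / 2 * N) := by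
    have h := rpow_mul_rpow_le hq hq1 (x := (s : ℝ) ^ (1 / α)) (M := α / 2 * N) (by positivity)
      (by positivity)
    have h2 : ((s : ℝ) ^ (1 / α)) ^ (α / 2 * N) = (s : ℝ) ^ ((N : ℝ) / 2) := by
      rw [← Real.rpow_mul (by positivity)]
      congr 1; field_simp
    rw [h2] at h
    refine h.trans ?_
    calc (α / 2 * N / (-Real.log q)) ^ (α / 2 * N) ≤ (D * N) ^ (α / 2 * N) := by
          refine Real.rpow_le_rpow (by positivity) ?_ (by positivity)
          rw [hD, show α / 2 * N / (-Real.log q) = α / 2 / (-Real.log q) * N by ring]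
          gcongr
          linarith
      _ = K ^ N * (N : ℝ) ^ (α / 2 * N) := by
          rw [Real.mul_rpow (by positivity) (by positivity), hK, ← Real.rpow_natCast,
            ← Real.rpow_mul (by positivity)]
  have h2 : ((s : ℝ) + N) ^ ((N : ℝ) / 2) ≤
      2 ^ N * ((s : ℝ) ^ ((N : ℝ) / 2) + (N : ℝ) ^ ((N : ℝ) / 2)) := by
    have e2 : (2 : ℝ) ^ ((N : ℝ) / 2) ≤ 2 ^ N := by
      rw [← Real.rpow_natCast]
      exact Real.rpow_le_rpow_of_exponent_le one_le_two (by linarith)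
    have a1 : 0 ≤ (s : ℝ) ^ ((N : ℝ) / 2) := by positivity
    have a2 : 0 ≤ (N : ℝ) ^ ((N : ℝ) / 2) := by positivity
    rcases le_total (s : ℝ) N with hs | hs
    · calc _ ≤ (2 * (N : ℝ)) ^ ((N : ℝ) / 2) := by
            refine Real.rpow_le_rpow (by positivity) (by linarith) (by positivity)
        _ = 2 ^ ((N : ℝ) / 2) * (N : ℝ) ^ ((N : ℝ) / 2) := Real.mul_rpow (by positivity) (by positivity)
        _ ≤ _ := by gcongr; linarith
    · calc _ ≤ (2 * (s : ℝ)) ^ ((N : ℝ) / 2) := by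
            refine Real.rpow_le_rpow (by positivity) (by linarith) (by positivity)
        _ = 2 ^ ((N : ℝ) / 2) * (s : ℝ) ^ ((N : ℝ) / 2) := Real.mul_rpow (by positivity) (by positivity)
        _ ≤ _ := by gcongr; linarith
  have hKN : 1 ≤ K ^ N := one_le_pow₀ hK1
  have hPN : 0 ≤ (N : ℝ) ^ (α / 2 * N) := by positivity
  have h2N : (2 : ℝ) ≤ 2 ^ N := le_self_pow₀ one_le_two hN.ne'
  calc _ ≤ 2 ^ N * ((s : ℝ) ^ ((N : ℝ) / 2) + (N : ℝ) ^ ((N : ℝ) / 2)) *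
          q ^ ((s : ℝ) ^ (1 / α)) := by gcongr
    _ = 2 ^ N * ((s : ℝ) ^ ((N : ℝ) / 2) * q ^ ((s : ℝ) ^ (1 / α)) +
          (N : ℝ) ^ ((N : ℝ) / 2) * q ^ ((s : ℝ) ^ (1 / α))) := by ring
    _ ≤ 2 ^ N * (K ^ N * (N : ℝ) ^ (α / 2 * N) + K ^ N * (N : ℝ) ^ (α / 2 * N)) := by
        have : (N : ℝ) ^ ((N : ℝ) / 2) * q ^ ((s : ℝ) ^ (1 / α)) ≤ K ^ N * (N : ℝ) ^ (α / 2 * N) := by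
          calc _ ≤ (N : ℝ) ^ (α / 2 * N) * 1 := by gcongr
            _ ≤ _ := by nlinarith
        gcongr
    _ = 2 ^ N * 2 * K ^ N * (N : ℝ) ^ (α / 2 * N) := by ring
    _ ≤ 2 ^ N * 2 ^ N * K ^ N * (N : ℝ) ^ (α / 2 * N) := by gcongr
    _ = _ := by rw [← mul_pow, ← mul_pow]; norm_num

theorem natCast_rpow_mul_self (β : ℝ) (x : ℕ) :
    (x : ℝ) ^ (β * x) = Real.exp (β * (x * Real.log x)) := by
  rcases Nat.eq_zero_or_pos x with rfl | hx
  · simp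
  · rw [Real.rpow_def_of_pos (by exact_mod_cast hx)]; congr 1; ring

/-- `S^S ≤ r^S ∏ x_i^{x_i}` for the sum `S` of `r` natural numbers `x_i`, with exponents scaled. -/
theorem sum_rpow_le_prod {ι : Type*} [Fintype ι] [Nonempty ι] {β : ℝ} (hβ : 0 ≤ β) (x : ι → ℕ) :
    ((∑ i, x i : ℕ) : ℝ) ^ (β * (∑ i, x i : ℕ)) ≤
      ((Fintype.card ι : ℝ) ^ β) ^ (∑ i, x i) * ∏ i, (x i : ℝ) ^ (β * x i) := by
  set S := ∑ i, x i with hS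
  have hr : (0 : ℝ) < Fintype.card ι := by exact_mod_cast Fintype.card_pos
  have hw : ∑ _i : ι, (Fintype.card ι : ℝ)⁻¹ = 1 := by
    simp [hr.ne']
  -- Jensen's inequality for x log x with equal weights 1/r; after exponentiation the term S log r
  -- becomes the factor r^{βS}.
  have hJ := Real.convexOn_mul_log.map_sum_le (t := Finset.univ)
    (w := fun _ : ι => (Fintype.card ι : ℝ)⁻¹) (p := fun i => (x i : ℝ))
    (fun _ _ => by positivity) hw (fun i _ => by simp)
  simp only [smul_eq_mul, ← Finset.mul_sum] at hJ
  have hSr : ∑ i, (x i : ℝ) = (S : ℝ) := by rw [hS]; push_cast; rfl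
  rw [hSr, mul_assoc] at hJ
  have hJ' := le_of_mul_le_mul_left hJ (by positivity)
  have hlog : (S : ℝ) * Real.log S - S * Real.log (Fintype.card ι) ≤
      (S : ℝ) * Real.log ((Fintype.card ι : ℝ)⁻¹ * S) := by
    rcases Nat.eq_zero_or_pos S with h0 | h0
    · simp [h0]
    · have : (0 : ℝ) < S := by exact_mod_cast h0
      rw [Real.log_mul (by positivity) (by positivity), Real.log_inv]
      linarith
  rw [natCast_rpow_mul_self, ← Real.rpow_natCast, ← Real.rpow_mul hr.le, Real.rpow_def_of_pos hr]
  simp only [natCast_rpow_mul_self]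
  rw [← Real.exp_sum, ← Real.exp_add, ← Finset.mul_sum]
  refine Real.exp_le_exp.2 ?_
  have := hlog.trans hJ'
  nlinarith [mul_le_mul_of_nonneg_left this hβ]

/-- Since 2p ≤ m, each of the p factors of m!/(m-p)! exceeds m/2 (for m = 0 both sides are one). -/
theorem sqrt_factorial_sub_div_le {m p : ℕ} (h : 2 * p ≤ m) :
    √(((m - p).factorial : ℝ) / (m.factorial : ℝ)) ≤ (2 / (m : ℝ)) ^ ((p : ℝ) / 2) := by
  rcases Nat.eq_zero_or_pos m with rfl | hm
  · have : p = 0 := by omega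
    subst this; simp
  have hm0 : (0 : ℝ) < m := by exact_mod_cast hm
  have h1 : ((m - p).factorial : ℝ) / (m.factorial : ℝ) ≤ (2 / (m : ℝ)) ^ p := by
    have h2 : (m - p).factorial * (m - p + 1) ^ p ≤ m.factorial := by
      have := Nat.factorial_mul_pow_le_factorial (m := m - p) (n := p)
      rwa [Nat.sub_add_cancel (by omega)] at this
    have h3 : ((m - p).factorial : ℝ) * ((m : ℝ) / 2) ^ p ≤ m.factorial := by
      refine le_trans ?_ (by exact_mod_cast h2 : ((m - p).factorial : ℝ) *
        (((m - p + 1 : ℕ) : ℝ)) ^ p ≤ m.factorial)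
      gcongr
      rw [div_le_iff₀ two_pos]
      have : m ≤ (m - p + 1) * 2 := by omega
      exact_mod_cast this
    rw [div_le_iff₀ (by positivity), show (2 / (m : ℝ)) = ((m : ℝ) / 2)⁻¹ by rw [inv_div], inv_pow,
      inv_mul_eq_div, le_div_iff₀ (by positivity)]
    exact h3
  calc _ ≤ √((2 / (m : ℝ)) ^ p) := Real.sqrt_le_sqrt h1
    _ = _ := by
      rw [Real.sqrt_eq_rpow, ← Real.rpow_natCast, ← Real.rpow_mul (by positivity)]
      congr 1; ring

/-- Optimizing the bounds obtained from `p`-fold differentiation gives stretched exponential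
decay. -/
theorem exists_rpow_decay {α B : ℝ} (hα : 1 ≤ α) (hB : 0 < B) (d : ℕ) (hd : 1 ≤ d) :
    ∃ a : ℝ, 1 < a ∧ ∀ s m : ℕ, s ≤ d * m → ∀ X σ : ℝ, 0 ≤ X → 0 ≤ σ →
      (∀ p ≤ m, X ≤ σ * (B ^ p * (p : ℝ) ^ (α / 2 * p) *
        √(((m - p).factorial : ℝ) / (m.factorial : ℝ)))) →
      X * a ^ ((s : ℝ) ^ (1 / α)) ≤ 2 * σ := by
  have hα0 : 0 < α := by linarith
  have he : (1 : ℝ) < Real.exp 1 := by simp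
  -- The term 2B² makes 2B²/E ≤ 1/e for E = eC, which turns each unit of p into a factor e^{-1/2}.
  -- The summand 2 only ensures E ≥ 2, so that the chosen p satisfies 2p ≤ m.
  set C : ℝ := 2 * B ^ 2 + 2 with hC
  have hC0 : 2 ≤ C := by rw [hC]; nlinarith [sq_nonneg B]
  set E : ℝ := Real.exp 1 * C with hE
  have hE2 : 2 ≤ E := by rw [hE]; nlinarith
  have hd0 : (0 : ℝ) < d := by exact_mod_cast hd
  set κ : ℝ := 1 / 2 * (1 / (E * d)) ^ (1 / α) with hκ
  have hκ0 : 0 < κ := by positivity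
  refine ⟨Real.exp κ, Real.one_lt_exp_iff.2 hκ0, fun s m hs X σ hX hσ h => ?_⟩
  -- The near-optimal order of differentiation: p is the integer part of y, so p^α ≤ m/E and the
  -- factor of σ is at most e^{-p/2}. As s ≤ dm, the choice of κ gives κ s^{1/α} ≤ y/2 < (p+1)/2;
  -- rounding costs e^{1/2} ≤ 2.
  set y : ℝ := ((m : ℝ) / E) ^ (1 / α) with hy
  have hy0 : 0 ≤ y := by positivity
  set p := ⌊y⌋₊ with hp
  have hpy : (p : ℝ) ≤ y := Nat.floor_le hy0
  have hpy' : y < p + 1 := Nat.lt_floor_add_one y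
  have hmE : (m : ℝ) / E ≤ m / 2 := by gcongr
  have hpm : 2 * p ≤ m := by
    rcases lt_or_ge ((m : ℝ) / E) 1 with h1 | h1
    · have : y < 1 := Real.rpow_lt_one (by positivity) h1 (by positivity)
      have : p = 0 := Nat.floor_eq_zero.2 this
      omega
    · have : y ≤ (m : ℝ) / E := by
        calc y ≤ ((m : ℝ) / E) ^ (1 : ℝ) := Real.rpow_le_rpow_of_exponent_le h1 (by
              rw [div_le_iff₀ hα0]; linarith)
          _ = _ := Real.rpow_one _
      have : (2 : ℝ) * p ≤ m := by linarith
      exact_mod_cast this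
  have hpα : (p : ℝ) ^ α ≤ (m : ℝ) / E := by
    calc (p : ℝ) ^ α ≤ y ^ α := by gcongr
      _ = (m : ℝ) / E := by
        rw [hy, ← Real.rpow_mul (by positivity), one_div, inv_mul_cancel₀ hα0.ne', Real.rpow_one]
  have hmain : B ^ p * (p : ℝ) ^ (α / 2 * p) * √(((m - p).factorial : ℝ) / (m.factorial : ℝ)) ≤
      Real.exp (-(p : ℝ) / 2) := by
    rcases Nat.eq_zero_or_pos p with h0 | h0
    · simp [h0, div_self_le_one]
    have hm0 : (0 : ℝ) < m := by
      have : 0 < m := by omega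
      exact_mod_cast this
    calc _ ≤ B ^ p * (p : ℝ) ^ (α / 2 * p) * (2 / (m : ℝ)) ^ ((p : ℝ) / 2) := by
          gcongr
          exact sqrt_factorial_sub_div_le hpm
      _ = (B ^ 2 * (p : ℝ) ^ α * (2 / (m : ℝ))) ^ ((p : ℝ) / 2) := by
          rw [Real.mul_rpow (by positivity) (by positivity),
            Real.mul_rpow (by positivity) (by positivity), ← Real.rpow_mul (by positivity),
            ← Real.rpow_natCast, ← Real.rpow_natCast, ← Real.rpow_mul hB.le]
          push_cast
          congr 3
          · ring
          · ring
      _ ≤ (Real.exp (-1)) ^ ((p : ℝ) / 2) := by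
          refine Real.rpow_le_rpow (by positivity) ?_ (by positivity)
          calc _ ≤ B ^ 2 * ((m : ℝ) / E) * (2 / (m : ℝ)) := by gcongr
            _ = 2 * B ^ 2 / E := by field_simp
            _ ≤ C / E := by gcongr; rw [hC]; linarith
            _ = _ := by
              rw [hE, Real.exp_neg]; field_simp
      _ = _ := by rw [← Real.exp_mul]; congr 1; ring
  have hX1 : X ≤ σ * Real.exp (-(p : ℝ) / 2) :=
    (h p (by omega)).trans (mul_le_mul_of_nonneg_left hmain hσ)
  have hs' : (1 / (E * d)) ^ (1 / α) * (s : ℝ) ^ (1 / α) ≤ y := by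
    rw [← Real.mul_rpow (by positivity) (by positivity)]
    refine Real.rpow_le_rpow (by positivity) ?_ (by positivity)
    have : (s : ℝ) ≤ d * m := by exact_mod_cast hs
    rw [one_div, inv_mul_eq_div, div_le_div_iff₀ (by positivity) (by positivity)]
    nlinarith
  calc X * Real.exp κ ^ ((s : ℝ) ^ (1 / α))
      ≤ σ * Real.exp (-(p : ℝ) / 2) * Real.exp (((p : ℝ) + 1) / 2) := by
        rw [← Real.exp_mul]
        have : κ * (s : ℝ) ^ (1 / α) ≤ ((p : ℝ) + 1) / 2 := by
          rw [hκ, mul_assoc]; linarith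
        gcongr
    _ = σ * Real.exp (1 / 2) := by
        rw [mul_assoc, ← Real.exp_add]; congr 2; ring
    _ ≤ σ * 2 := by
        gcongr
        have h1 : Real.exp (1 / 2) ^ 2 = Real.exp 1 := by rw [← Real.exp_nat_mul]; norm_num
        have h2 := Real.exp_one_lt_d9
        nlinarith [Real.exp_pos (1 / 2)]
    _ = 2 * σ := mul_comm _ _

/-! ### Integration by parts in one coordinate of the orthant -/

theorem update_mem_orthant {d : ℕ} {x : Fin d → ℝ} (hx : x ∈ orthant d) (i : Fin d) {s : ℝ}
    (hs : 0 < s) : Function.update x i s ∈ orthant d := by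
  intro l
  by_cases h : l = i
  · subst h; simpa using hs
  · simpa [h] using hx l

/-- Fubini with the i-th variable innermost; on almost every line the fundamental theorem of
calculus leaves only the two boundary values, both zero. Continuity at 0 is asked of H itself, since
a function extended by zero may jump at the boundary of the orthant. -/
theorem integral_orthant_eq_zero_of_hasDerivAt {d : ℕ} (i : Fin d) {H H' : (Fin d → ℝ) → ℂ}
    (hint : IntegrableOn H' (orthant d))
    (hderiv : ∀ x ∈ orthant d, HasDerivAt (fun s => H (Function.update x i s)) (H' x) (x i))
    (hzero : ∀ x ∈ orthant d, H (Function.update x i 0) = 0)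
    (hcont : ∀ x ∈ orthant d, ContinuousWithinAt (fun s => H (Function.update x i s)) (Ici 0) 0)
    (hlim : ∀ x ∈ orthant d, Tendsto (fun s => H (Function.update x i s)) atTop (𝓝 0)) :
    ∫ x in orthant d, H' x = 0 := by
  obtain ⟨n, rfl⟩ : ∃ n, d = n + 1 := ⟨d - 1, by have := i.2; omega⟩
  set μ : Fin (n + 1) → Measure ℝ := fun _ => volume.restrict (Ioi (0 : ℝ)) with hμ
  have hmp := (measurePreserving_piFinSuccAbove μ i).symm
  rw [IntegrableOn, volume_restrict_orthant] at hint
  rw [volume_restrict_orthant, ← hmp.integral_comp']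
  have hint' := (hmp.integrable_comp_emb (MeasurableEquiv.measurableEmbedding _)).2 hint
  refine (integral_prod_symm _ hint').trans ?_
  have hpos : ∀ᵐ z ∂(Measure.pi fun j => μ (i.succAbove j)), z ∈ orthant n := by
    rw [hμ, ← volume_restrict_orthant]
    exact ae_restrict_mem (measurableSet_orthant n)
  refine integral_eq_zero_of_ae ?_
  filter_upwards [hpos, hint'.prod_left_ae] with z hz hzint
  have hmem : ∀ s : ℝ, 0 < s → i.insertNth s z ∈ orthant (n + 1) := by
    intro s hs l
    rcases Fin.eq_self_or_eq_succAbove i l with rfl | ⟨j, rfl⟩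
    · simpa using hs
    · simpa using hz j
  have h1 := hmem 1 one_pos
  have hupd : ∀ r s : ℝ, Function.update (i.insertNth r z : Fin (n + 1) → ℝ) i s = i.insertNth s z :=
    fun r s => Fin.update_insertNth (α := fun _ => ℝ) i r s z
  have hd : ∀ s ∈ Ioi (0 : ℝ), HasDerivAt (fun s => H (i.insertNth s z)) (H' (i.insertNth s z)) s := by
    intro s hs
    have := hderiv _ (hmem s hs)
    simpa only [hupd, Fin.insertNth_apply_same] using this
  have hc := hcont _ h1
  have hl := hlim _ h1
  have h0 := hzero _ h1
  simp only [hupd] at hc hl h0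
  have := integral_Ioi_of_hasDerivAt_of_tendsto hc hd hzint hl
  simpa [h0, hμ] using! this

/-! ### The Laguerre weights in one coordinate -/

/-- The product of `t_i^j e^{-t_i/2} L_m^{(j)}(t_i)` and Laguerre functions in the other
coordinates. -/
noncomputable def mixedLag {d : ℕ} (n : Fin d → ℕ) (i : Fin d) (j m : ℕ) (x : Fin d → ℝ) : ℝ :=
  x i ^ j * lagFun j m (x i) * ∏ l ∈ Finset.univ.erase i, lagFun 0 (n l) (x l)

theorem mixedLag_eq_prod {d : ℕ} (n : Fin d → ℕ) (i : Fin d) (j m : ℕ) (x : Fin d → ℝ) :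
    mixedLag n i j m x =
      ∏ l, (if l = i then fun t => t ^ j * lagFun j m t else lagFun 0 (n l)) (x l) := by
  rw [← Finset.mul_prod_erase _ _ (Finset.mem_univ i), mixedLag, if_pos rfl]
  congr 1
  exact Finset.prod_congr rfl fun l hl => by rw [if_neg (Finset.ne_of_mem_erase hl)]

theorem laguerreFun_eq {d : ℕ} (n : Fin d → ℕ) {x : Fin d → ℝ} (hx : x ∈ orthant d) :
    laguerreFun n x = ((∏ l, lagFun 0 (n l) (x l) : ℝ) : ℂ) := by
  simp only [laguerreFun, Set.indicator_of_mem hx, laguerrePoly_mul_exp]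

theorem laguerreFun_eq_mixedLag {d : ℕ} (n : Fin d → ℕ) (i : Fin d) {x : Fin d → ℝ}
    (hx : x ∈ orthant d) : laguerreFun n x = (mixedLag n i 0 (n i) x : ℂ) := by
  rw [laguerreFun_eq n hx, mixedLag, pow_zero, one_mul,
    ← Finset.mul_prod_erase _ _ (Finset.mem_univ i)]

theorem integrableOn_polynomial_mul_exp_neg_half (P : Polynomial ℝ) :
    IntegrableOn (fun t : ℝ => P.eval t * Real.exp (-t / 2)) (Ioi 0) := by
  have h := integrableOn_polynomial_mul_exp_neg (P.comp (Polynomial.C 2 * Polynomial.X))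
  have h2 := (integrableOn_Ioi_comp_mul_left_iff (fun t : ℝ => (P.comp
    (Polynomial.C 2 * Polynomial.X)).eval t * Real.exp (-t)) 0 (a := 1 / 2) (by norm_num)).2
    (by simpa using h)
  refine h2.congr_fun (fun t _ => ?_) measurableSet_Ioi
  simp only [Polynomial.eval_comp, Polynomial.eval_mul, Polynomial.eval_C, Polynomial.eval_X]
  congr 2 <;> ring

theorem integrableOn_pow_mul_lagFun (k j m : ℕ) :
    IntegrableOn (fun t => t ^ k * lagFun j m t) (Ioi 0) := by
  refine (integrableOn_polynomial_mul_exp_neg_half (Polynomial.X ^ k * lag j m)).congr_fun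
    (fun t _ => ?_) measurableSet_Ioi
  simp only [Polynomial.eval_mul, Polynomial.eval_pow, Polynomial.eval_X, lagFun]; ring

theorem integrableOn_lagFun (j m : ℕ) : IntegrableOn (lagFun j m) (Ioi 0) := by
  simpa using integrableOn_pow_mul_lagFun 0 j m

theorem integrableOn_mixedLag {d : ℕ} (n : Fin d → ℕ) (i : Fin d) (j m : ℕ) :
    IntegrableOn (mixedLag n i j m) (orthant d) := by
  rw [IntegrableOn, volume_restrict_orthant]
  have : mixedLag n i j m = fun x => ∏ l, (if l = i then fun t => t ^ j * lagFun j m t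
      else lagFun 0 (n l)) (x l) := funext (mixedLag_eq_prod n i j m)
  rw [this]
  refine Integrable.fintype_prod (𝕜 := ℝ) (f := fun l => if l = i then fun t => t ^ j * lagFun j m t
      else lagFun 0 (n l)) fun l => ?_
  by_cases h : l = i
  · simp only [h, if_true]
    exact integrableOn_pow_mul_lagFun j j m
  · simp only [h, if_false]
    exact integrableOn_lagFun 0 (n l)

theorem integrableOn_mul_of_bounded {d : ℕ} {F : (Fin d → ℝ) → ℂ} {g : (Fin d → ℝ) → ℝ} {K : ℝ}
    (hF : ContDiffOn ℝ ∞ F (orthant d)) (hK : ∀ x ∈ orthant d, ‖F x‖ ≤ K)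
    (hg : IntegrableOn g (orthant d)) :
    IntegrableOn (fun x => F x * (g x : ℂ)) (orthant d) := by
  refine Integrable.bdd_mul (c := K) hg.ofReal ?_ ?_
  · exact hF.continuousOn.aestronglyMeasurable (measurableSet_orthant d)
  · exact (ae_restrict_iff' (measurableSet_orthant d)).2 (.of_forall hK)

theorem hasDerivAt_update_of_contDiffOn {d : ℕ} {F : (Fin d → ℝ) → ℂ}
    (hF : ContDiffOn ℝ ∞ F (orthant d)) (i : Fin d) {x : Fin d → ℝ} (hx : x ∈ orthant d) :
    HasDerivAt (fun s => F (Function.update x i s)) (partialDeriv i F x) (x i) := by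
  have hd : DifferentiableAt ℝ F x :=
    (hF.contDiffAt ((isOpen_orthant d).mem_nhds hx)).differentiableAt (by simp)
  have h1 : HasFDerivAt F (fderiv ℝ F x) (Function.update x i (x i)) := by
    rw [Function.update_eq_self]; exact hd.hasFDerivAt
  have h2 := h1.comp_hasDerivAt (x i) (hasDerivAt_update x i (x i))
  rw [partialDeriv, hd.lineDeriv_eq_fderiv]
  exact h2

theorem prod_erase_update {d : ℕ} (n : Fin d → ℕ) (i : Fin d) (x : Fin d → ℝ) (s : ℝ) :
    ∏ l ∈ Finset.univ.erase i, lagFun 0 (n l) (Function.update x i s l) =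
      ∏ l ∈ Finset.univ.erase i, lagFun 0 (n l) (x l) :=
  Finset.prod_congr rfl fun l hl => by rw [Function.update_of_ne (Finset.ne_of_mem_erase hl)]

theorem tendsto_pow_mul_lagFun (k j m : ℕ) :
    Tendsto (fun t => t ^ k * lagFun j m t) atTop (𝓝 0) := by
  have h := (tendsto_polynomial_mul_exp_neg ((Polynomial.X ^ k * lag j m).comp
    (Polynomial.C 2 * Polynomial.X))).comp (tendsto_id.atTop_div_const (two_pos : (0 : ℝ) < 2))
  refine h.congr fun t => ?_
  simp only [Function.comp_apply, id, Polynomial.eval_comp, Polynomial.eval_mul, Polynomial.eval_C,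
    Polynomial.eval_X, Polynomial.eval_pow, lagFun]
  rw [show 2 * (t / 2) = t by ring, show -(t / 2) = -t / 2 by ring]
  ring

/-- One step of the ladder for Laguerre coefficients. -/
theorem integral_mul_mixedLag_succ {d : ℕ} {F : (Fin d → ℝ) → ℂ} (n : Fin d → ℕ) (i : Fin d)
    (j m : ℕ) {K K' : ℝ} (hF : ContDiffOn ℝ ∞ F (orthant d)) (hK : ∀ x ∈ orthant d, ‖F x‖ ≤ K)
    (hK' : ∀ x ∈ orthant d, ‖partialDeriv i F x‖ ≤ K') :
    ((m : ℂ) + 1) * ∫ x in orthant d, F x * (mixedLag n i j (m + 1) x : ℂ) =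
      -∫ x in orthant d, (partialDeriv i F + (1 / 2 : ℂ) • F) x * (mixedLag n i (j + 1) m x : ℂ) := by
  have hi1 := integrableOn_mul_of_bounded hF hK (integrableOn_mixedLag n i j (m + 1))
  have hF' : ContDiffOn ℝ ∞ (partialDeriv i F + (1 / 2 : ℂ) • F) (orthant d) :=
    (partialDeriv_contDiffOn i hF).add (hF.const_smul (1 / 2 : ℂ))
  have hK2 : ∀ x ∈ orthant d, ‖(partialDeriv i F + (1 / 2 : ℂ) • F) x‖ ≤ K' + K := fun x hx => by
    have h1 := hK x hx
    have h2 := hK' x hx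
    have h3 : ‖(1 / 2 : ℂ) • F x‖ ≤ K := by
      rw [norm_smul]; norm_num; linarith [norm_nonneg (F x)]
    exact (norm_add_le _ _).trans (add_le_add h2 h3)
  have hi2 := integrableOn_mul_of_bounded hF' hK2 (integrableOn_mixedLag n i (j + 1) m)
  have key := integral_orthant_eq_zero_of_hasDerivAt i
    (H := fun x => F x * (mixedLag n i (j + 1) m x : ℂ))
    (H' := fun x => (partialDeriv i F + (1 / 2 : ℂ) • F) x * (mixedLag n i (j + 1) m x : ℂ) +
      ((m : ℂ) + 1) * (F x * (mixedLag n i j (m + 1) x : ℂ)))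
    (hi2.add (hi1.const_mul _)) ?_ ?_ ?_ ?_
  · have h := integral_add hi2 (hi1.const_mul ((m : ℂ) + 1))
    rw [integral_const_mul] at h
    rw [h] at key
    linear_combination key
  · intro x hx
    have h1 := hasDerivAt_update_of_contDiffOn hF i hx
    have h2 : HasDerivAt (fun s => (mixedLag n i (j + 1) m (Function.update x i s) : ℂ))
        ((((m : ℝ) + 1) * mixedLag n i j (m + 1) x + 1 / 2 * mixedLag n i (j + 1) m x : ℝ) : ℂ)
        (x i) := by
      refine HasDerivAt.ofReal_comp ?_
      simp only [mixedLag, Function.update_self, prod_erase_update]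
      refine ((hasDerivAt_weight_lagFun j m (x i)).mul_const _).congr_deriv ?_
      ring
    refine (h1.mul h2).congr_deriv ?_
    simp only [Function.update_eq_self, Pi.add_apply, Pi.smul_apply, smul_eq_mul]
    push_cast
    ring
  · intro x hx
    simp [mixedLag]
  all_goals intro x hx
  all_goals
    set P : ℝ := ∏ l ∈ Finset.univ.erase i, lagFun 0 (n l) (x l) with hP
    -- One estimate serves both ends. `F` is controlled only inside the orthant, but at s = 0 the
    -- factor s^{j+1} kills the product whatever value `F` has there.
    have hbd : ∀ s ∈ Ici (0 : ℝ), ‖F (Function.update x i s) *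
        (mixedLag n i (j + 1) m (Function.update x i s) : ℂ)‖ ≤
        K * |P| * |s ^ (j + 1) * lagFun (j + 1) m s| := by
      intro s hs
      rw [norm_mul, Complex.norm_real, mixedLag, prod_erase_update, ← hP, Function.update_self,
        Real.norm_eq_abs, abs_mul]
      rcases (mem_Ici.1 hs).eq_or_lt with rfl | hs
      · simp
      · have := hK _ (update_mem_orthant hx i hs)
        calc _ ≤ K * (|s ^ (j + 1) * lagFun (j + 1) m s| * |P|) := by gcongr
          _ = _ := by ring
  · have h0 : F (Function.update x i 0) * (mixedLag n i (j + 1) m (Function.update x i 0) : ℂ) = 0 := by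
      simp [mixedLag]
    rw [ContinuousWithinAt, h0]
    have hc : Tendsto (fun s : ℝ => K * |P| * |s ^ (j + 1) * lagFun (j + 1) m s|) (𝓝[≥] 0) (𝓝 0) := by
      have : Continuous fun s : ℝ => K * |P| * |s ^ (j + 1) * lagFun (j + 1) m s| := by
        have := continuous_lagFun (j + 1) m
        fun_prop
      have h := (this.tendsto 0).mono_left (nhdsWithin_le_nhds (s := Ici 0))
      simpa using h
    exact squeeze_zero_norm' (eventually_mem_nhdsWithin.mono hbd) hc
  · have hc : Tendsto (fun s : ℝ => K * |P| * |s ^ (j + 1) * lagFun (j + 1) m s|) atTop (𝓝 0) := by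
      simpa using (tendsto_pow_mul_lagFun (j + 1) (j + 1) m).abs.const_mul (K * |P|)
    exact squeeze_zero_norm' ((eventually_ge_atTop 0).mono hbd) hc

/-! ### Decay of the Laguerre coefficients -/

/-- The operator `∂_i + 1/2`. -/
noncomputable def shiftDeriv {d : ℕ} (i : Fin d) (g : (Fin d → ℝ) → ℂ) : (Fin d → ℝ) → ℂ :=
  partialDeriv i g + (1 / 2 : ℂ) • g

/-- Smooth functions on the orthant with all pure derivatives in direction `i` bounded. -/
def IterBounded {d : ℕ} (i : Fin d) (g : (Fin d → ℝ) → ℂ) : Prop :=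
  ContDiffOn ℝ ∞ g (orthant d) ∧ ∀ j, ∃ K : ℝ, ∀ x ∈ orthant d, ‖(partialDeriv i)^[j] g x‖ ≤ K

section shift

variable {d : ℕ} {i : Fin d} {f g : (Fin d → ℝ) → ℂ}

theorem contDiffOn_smul' (c : ℂ) (hf : ContDiffOn ℝ ∞ f (orthant d)) :
    ContDiffOn ℝ ∞ (c • f) (orthant d) := hf.const_smul c

theorem shiftDeriv_contDiffOn (hf : ContDiffOn ℝ ∞ f (orthant d)) :
    ContDiffOn ℝ ∞ (shiftDeriv i f) (orthant d) :=
  (partialDeriv_contDiffOn i hf).add (hf.const_smul (1 / 2 : ℂ))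

theorem shiftDeriv_iterate_contDiffOn (p : ℕ) (hf : ContDiffOn ℝ ∞ f (orthant d)) :
    ContDiffOn ℝ ∞ ((shiftDeriv i)^[p] f) (orthant d) := by
  induction p with
  | zero => exact hf
  | succ p ih =>
    rw [Function.iterate_succ_apply']
    exact shiftDeriv_contDiffOn ih

theorem shiftDeriv_congr (h : EqOn f g (orthant d)) :
    EqOn (shiftDeriv i f) (shiftDeriv i g) (orthant d) := fun x hx => by
  simp only [shiftDeriv, Pi.add_apply, Pi.smul_apply, partialDeriv_congr i h hx, h hx]

theorem shiftDeriv_iterate_add (p : ℕ) (hf : ContDiffOn ℝ ∞ f (orthant d))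
    (hg : ContDiffOn ℝ ∞ g (orthant d)) :
    EqOn ((shiftDeriv i)^[p] (f + g)) ((shiftDeriv i)^[p] f + (shiftDeriv i)^[p] g)
      (orthant d) := by
  induction p with
  | zero => exact fun _ _ => rfl
  | succ p ih =>
    simp only [Function.iterate_succ_apply']
    refine (shiftDeriv_congr ih).trans fun x hx => ?_
    have h := partialDeriv_add i (shiftDeriv_iterate_contDiffOn (i := i) p hf)
      (shiftDeriv_iterate_contDiffOn (i := i) p hg) hx
    simp only [shiftDeriv, Pi.add_apply, Pi.smul_apply, smul_add] at h ⊢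
    rw [h]; abel

theorem shiftDeriv_iterate_smul (p : ℕ) (c : ℂ) :
    (shiftDeriv i)^[p] (c • f) = c • (shiftDeriv i)^[p] f := by
  induction p with
  | zero => rfl
  | succ p ih =>
    simp only [Function.iterate_succ_apply', ih, shiftDeriv, partialDeriv_smul, smul_add]
    rw [smul_comm]

theorem IterBounded.shiftDeriv (h : IterBounded i f) : IterBounded i (shiftDeriv i f) := by
  refine ⟨shiftDeriv_contDiffOn h.1, fun j => ?_⟩
  obtain ⟨K, hK⟩ := h.2 j
  obtain ⟨K', hK'⟩ := h.2 (j + 1)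
  refine ⟨K' + ‖(1 / 2 : ℂ)‖ * K, fun x hx => ?_⟩
  have e := iterate_add i j (partialDeriv_contDiffOn i h.1) (contDiffOn_smul' (1 / 2) h.1) hx
  rw [LaguerreExpansion.shiftDeriv, e, iterate_smul, ← Function.iterate_succ_apply]
  refine (norm_add_le _ _).trans (add_le_add (hK' x hx) ?_)
  rw [Pi.smul_apply, norm_smul]
  exact mul_le_mul_of_nonneg_left (hK x hx) (norm_nonneg _)

/-- Each integration by parts moves one `shiftDeriv` onto f, raises j by one and lowers the
polynomial index by one; the factors (m+1)⋯(m+p) accumulate to the quotient of factorials. -/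
theorem integral_mul_mixedLag_iterate (n : Fin d → ℕ) (p j m : ℕ) (h : IterBounded i f) :
    (((m + p).factorial : ℂ) / (m.factorial : ℂ)) *
      ∫ x in orthant d, f x * (mixedLag n i j (m + p) x : ℂ) =
      (-1) ^ p * ∫ x in orthant d, (LaguerreExpansion.shiftDeriv i)^[p] f x *
        (mixedLag n i (j + p) m x : ℂ) := by
  induction p generalizing j f with
  | zero =>
    have : (m.factorial : ℂ) ≠ 0 := by exact_mod_cast m.factorial_ne_zero
    simp [this]
  | succ p ih =>
    obtain ⟨K, hK⟩ := h.2 0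
    obtain ⟨K', hK'⟩ := h.2 1
    have h1 := integral_mul_mixedLag_succ n i j (m + p) h.1 hK hK'
    have h2 := ih (j + 1) h.shiftDeriv
    rw [Function.iterate_succ_apply, show j + (p + 1) = j + 1 + p by ring,
      pow_succ, mul_assoc, mul_comm (-1 : ℂ), ← mul_assoc, ← h2,
      show m + (p + 1) = m + p + 1 by ring, Nat.factorial_succ]
    simp only [LaguerreExpansion.shiftDeriv]
    push_cast at h1 ⊢
    linear_combination (((m + p).factorial : ℂ) / (m.factorial : ℂ)) * h1

/-- The `L²` norm on the orthant with weight `t_i^{e/2}`. -/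
noncomputable def weightedL2 (i : Fin d) (e : ℕ) (g : (Fin d → ℝ) → ℂ) : ℝ≥0∞ :=
  eLpNorm (fun t => (t i ^ ((e : ℝ) / 2)) • g t) 2 (volume.restrict (orthant d))

theorem aestronglyMeasurable_weight (e : ℝ) (hg : ContDiffOn ℝ ∞ g (orthant d)) :
    AEStronglyMeasurable (fun t => (t i ^ e) • g t) (volume.restrict (orthant d)) := by
  refine AEStronglyMeasurable.smul (f := fun t : Fin d → ℝ => t i ^ e)
    (Measurable.aestronglyMeasurable (by fun_prop)) ?_
  exact hg.continuousOn.aestronglyMeasurable (measurableSet_orthant d)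

theorem weightedL2_congr (e : ℕ) (h : EqOn f g (orthant d)) : weightedL2 i e f = weightedL2 i e g :=
  eLpNorm_congr_ae ((ae_restrict_iff' (measurableSet_orthant d)).2
    (.of_forall fun x hx => by simp only [h hx]))

theorem weightedL2_add_le (e : ℕ) (hf : ContDiffOn ℝ ∞ f (orthant d))
    (hg : ContDiffOn ℝ ∞ g (orthant d)) :
    weightedL2 i e (f + g) ≤ weightedL2 i e f + weightedL2 i e g := by
  unfold weightedL2
  simp only [Pi.add_apply, smul_add]
  exact eLpNorm_add_le (aestronglyMeasurable_weight _ hf) (aestronglyMeasurable_weight _ hg)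
    (by norm_num)

theorem weightedL2_smul (e : ℕ) (c : ℂ) : weightedL2 i e (c • f) = ‖c‖ₑ * weightedL2 i e f := by
  unfold weightedL2
  rw [← eLpNorm_const_smul]
  congr 1
  funext x
  simp only [Pi.smul_apply]
  rw [smul_comm]

/-- Binomial expansion of (∂ + 1/2)^p, whose coefficients sum to (3/2)^p. The induction leaves q
free because peeling one factor off the operator produces both the q-th and the (q+1)-th derivative;
the weight exponent e stays fixed. -/
theorem weightedL2_shiftDeriv_le (e : ℕ) (hf : ContDiffOn ℝ ∞ f (orthant d)) (M : ℝ≥0∞)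
    (hM : ∀ q ≤ e, weightedL2 i e ((partialDeriv i)^[q] f) ≤ M) (p q : ℕ) (hpq : p + q ≤ e) :
    weightedL2 i e ((LaguerreExpansion.shiftDeriv i)^[p] ((partialDeriv i)^[q] f)) ≤
      ENNReal.ofReal ((3 / 2) ^ p) * M := by
  induction p generalizing q with
  | zero => simpa using hM q (by omega)
  | succ p ih =>
    have hq := iterate_contDiffOn i q hf
    rw [Function.iterate_succ_apply]
    have h1 : LaguerreExpansion.shiftDeriv i ((partialDeriv i)^[q] f) =
        (partialDeriv i)^[q + 1] f + (1 / 2 : ℂ) • (partialDeriv i)^[q] f := by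
      rw [Function.iterate_succ_apply', LaguerreExpansion.shiftDeriv]
    rw [h1, weightedL2_congr e (shiftDeriv_iterate_add p (iterate_contDiffOn i (q + 1) hf)
      (contDiffOn_smul' _ hq)), shiftDeriv_iterate_smul]
    refine (weightedL2_add_le e (shiftDeriv_iterate_contDiffOn p (iterate_contDiffOn i (q + 1) hf))
      (contDiffOn_smul' _ (shiftDeriv_iterate_contDiffOn p hq))).trans ?_
    rw [weightedL2_smul]
    have e12 : ‖(1 / 2 : ℂ)‖ₑ = ENNReal.ofReal (1 / 2) := by
      rw [← ofReal_norm]; norm_num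
    calc _ ≤ ENNReal.ofReal ((3 / 2) ^ p) * M + ENNReal.ofReal (1 / 2) *
          (ENNReal.ofReal ((3 / 2) ^ p) * M) := by
          rw [e12]
          gcongr
          · exact ih (q + 1) (by omega)
          · exact ih q (by omega)
      _ = _ := by
          rw [← mul_assoc, ← add_mul, ← ENNReal.ofReal_mul (by norm_num),
            ← ENNReal.ofReal_add (by positivity) (by positivity)]
          congr 2; ring

end shift

/-! ### Reduction of the defining norms to a single coordinate. -/

theorem foldr_partialDeriv_single {d : ℕ} (i : Fin d) (q : ℕ) (f : (Fin d → ℝ) → ℂ)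
    (l : List (Fin d)) (hl : l.Nodup) :
    l.foldr (fun j g => (partialDeriv j)^[(Pi.single i q : Fin d → ℕ) j] g) f =
      if i ∈ l then (partialDeriv i)^[q] f else f := by
  induction l with
  | nil => rfl
  | cons j l ih =>
    rw [List.foldr_cons, ih hl.of_cons]
    by_cases hij : i = j
    · subst hij
      simp [(List.nodup_cons.1 hl).1]
    · simp [hij]

theorem multiDeriv_single {d : ℕ} (i : Fin d) (q : ℕ) (f : (Fin d → ℝ) → ℂ) :
    multiDeriv (Pi.single i q) f = (partialDeriv i)^[q] f := by
  rw [multiDeriv, foldr_partialDeriv_single i q f _ (List.nodup_finRange d), if_pos (by simp)]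

theorem l2Norm_single {d : ℕ} (i : Fin d) (q k : ℕ) (f : (Fin d → ℝ) → ℂ) :
    l2Norm (Pi.single i q) (Pi.single i k) f = weightedL2 i (q + k) ((partialDeriv i)^[q] f) := by
  unfold l2Norm weightedL2
  rw [multiDeriv_single]
  congr 1
  funext t
  congr 1
  rw [Finset.prod_eq_single i]
  · simp
  · intro l _ hl
    simp [Pi.single_eq_of_ne hl]
  · simp

theorem gsDenominator_pos {d : ℕ} {α A : ℝ} (hA : 0 < A) (p k : Fin d → ℕ) :
    0 < A ^ (∑ i, (p i + k i)) * (∏ i, (k i : ℝ) ^ (α / 2 * k i)) * ∏ i, (p i : ℝ) ^ (α / 2 * p i) := by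
  have h : ∀ m : ℕ, 0 < (m : ℝ) ^ (α / 2 * m) := fun m => by
    rw [natCast_rpow_mul_self]; positivity
  have h1 := Finset.prod_pos (s := Finset.univ) fun i _ => h (k i)
  have h2 := Finset.prod_pos (s := Finset.univ) fun i _ => h (p i)
  positivity

theorem l2Norm_le_gsNorm {d : ℕ} {α A : ℝ} (hA : 0 < A) (p k : Fin d → ℕ) (f : (Fin d → ℝ) → ℂ) :
    l2Norm p k f ≤ gsNorm α α A f * ENNReal.ofReal (A ^ (∑ i, (p i + k i)) *
      (∏ i, (k i : ℝ) ^ (α / 2 * k i)) * ∏ i, (p i : ℝ) ^ (α / 2 * p i)) := by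
  refine (ENNReal.div_le_iff ?_ ENNReal.ofReal_ne_top).1 ?_
  · exact (ENNReal.ofReal_pos.2 (gsDenominator_pos hA p k)).ne'
  · unfold gsNorm
    exact le_iSup₂_of_le p k le_rfl

theorem prod_single_rpow {d : ℕ} (α : ℝ) (i : Fin d) (k : ℕ) :
    ∏ l, (((Pi.single i k : Fin d → ℕ) l : ℕ) : ℝ) ^ (α / 2 * ((Pi.single i k : Fin d → ℕ) l : ℕ)) =
      (k : ℝ) ^ (α / 2 * k) := by
  rw [Finset.prod_eq_single i]
  · simp
  · intro l _ hl
    simp [Pi.single_eq_of_ne hl]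
  · simp

/-- The space controls t^{(q+k)/2} D^q, so k = e - q gives the same weight t^{e/2} for every order q
≤ e. The two Gevrey factors merge, as (e-q)^{e-q} q^q ≤ e^e. -/
theorem weightedL2_partialDeriv_le {d : ℕ} {α A : ℝ} (hα : 1 ≤ α) (hA : 0 < A) (i : Fin d)
    {q e : ℕ} (hq : q ≤ e) (f : (Fin d → ℝ) → ℂ) :
    weightedL2 i e ((partialDeriv i)^[q] f) ≤
      gsNorm α α A f * ENNReal.ofReal (A ^ e * (e : ℝ) ^ (α / 2 * e)) := by
  have h := l2Norm_le_gsNorm (α := α) hA (Pi.single i q) (Pi.single i (e - q)) f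
  rw [l2Norm_single, Nat.add_sub_cancel' hq, prod_single_rpow, prod_single_rpow,
    Finset.sum_add_distrib, Finset.sum_pi_single', Finset.sum_pi_single', if_pos (Finset.mem_univ _),
    if_pos (Finset.mem_univ _), Nat.add_sub_cancel' hq] at h
  refine h.trans (mul_le_mul_right (ENNReal.ofReal_le_ofReal ?_) _)
  rw [mul_assoc]
  refine mul_le_mul_of_nonneg_left ?_ (by positivity)
  rcases Nat.eq_zero_or_pos e with rfl | he
  · have : q = 0 := by omega
    subst this; simp
  have he0 : (0 : ℝ) < e := by exact_mod_cast he
  have hqe : (q : ℝ) ≤ e := by exact_mod_cast hq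
  calc ((e - q : ℕ) : ℝ) ^ (α / 2 * (e - q : ℕ)) * (q : ℝ) ^ (α / 2 * q)
      ≤ (e : ℝ) ^ (α / 2 * (e - q : ℕ)) * (e : ℝ) ^ (α / 2 * q) := by
        gcongr
        omega
    _ = _ := by
        rw [← Real.rpow_add he0, ← mul_add, Nat.cast_sub hq]
        congr 2; ring

theorem eLpNorm_mixedLag {d : ℕ} (n : Fin d → ℕ) (i : Fin d) (j m : ℕ) :
    eLpNorm (fun x : Fin d → ℝ => x i ^ ((j : ℝ) / 2) * lagFun j m (x i) *
      ∏ l ∈ Finset.univ.erase i, lagFun 0 (n l) (x l)) 2 (volume.restrict (orthant d)) =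
      ENNReal.ofReal (√(((m + j).factorial : ℝ) / (m.factorial : ℝ))) := by
  have e : (fun x : Fin d → ℝ => x i ^ ((j : ℝ) / 2) * lagFun j m (x i) *
      ∏ l ∈ Finset.univ.erase i, lagFun 0 (n l) (x l)) = fun x => ∏ l, (if l = i then
      fun t => t ^ ((j : ℝ) / 2) * lagFun j m t else lagFun 0 (n l)) (x l) := by
    funext x
    rw [← Finset.mul_prod_erase _ _ (Finset.mem_univ i), if_pos rfl]
    congr 1
    exact Finset.prod_congr rfl fun l hl => by rw [if_neg (Finset.ne_of_mem_erase hl)]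
  rw [e, eLpNorm_prod_orthant, Finset.prod_eq_single i]
  · simp only [if_true, eLpNorm_rpow_mul_lagFun]
  · intro l _ hl
    have h := eLpNorm_rpow_mul_lagFun 0 (n l)
    simp only [Nat.cast_zero, zero_div, Real.rpow_zero, one_mul, add_zero] at h
    simp only [hl, if_false]
    rw [show lagFun 0 (n l) = fun t => lagFun 0 (n l) t from rfl, h, div_self (by positivity)]
    simp
  · simp
  · intro l
    have := fun j m => (continuous_lagFun j m).measurable
    split_ifs
    · exact Measurable.mul (by fun_prop) (this _ _)
    · exact this _ _

/-- Cauchy–Schwarz after writing x_i^j as the square of x_i^{j/2}: one half goes to g, the other to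
the Laguerre factor, whose norm is then explicit. -/
theorem enorm_integral_mul_mixedLag_le {d : ℕ} {g : (Fin d → ℝ) → ℂ}
    (hg : ContDiffOn ℝ ∞ g (orthant d)) (n : Fin d → ℕ) (i : Fin d) (j m : ℕ) :
    ‖∫ x in orthant d, g x * (mixedLag n i j m x : ℂ)‖ₑ ≤
      ENNReal.ofReal (√(((m + j).factorial : ℝ) / (m.factorial : ℝ))) * weightedL2 i j g := by
  set w : (Fin d → ℝ) → ℝ := fun x => x i ^ ((j : ℝ) / 2) * lagFun j m (x i) *
      ∏ l ∈ Finset.univ.erase i, lagFun 0 (n l) (x l) with hw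
  have hwm : AEStronglyMeasurable w (volume.restrict (orthant d)) := by
    refine Measurable.aestronglyMeasurable (Measurable.mul (Measurable.mul (by fun_prop)
      ((continuous_lagFun j m).measurable.comp (measurable_pi_apply i))) ?_)
    exact Finset.measurable_prod _ fun l _ =>
      (continuous_lagFun 0 (n l)).measurable.comp (measurable_pi_apply l)
  have heq : ∫ x in orthant d, g x * (mixedLag n i j m x : ℂ) =
      ∫ x in orthant d, w x • ((x i ^ ((j : ℝ) / 2)) • g x) := by
    refine setIntegral_congr_fun (measurableSet_orthant d) fun x hx => ?_
    have h0 : (x i ^ ((j : ℝ) / 2)) ^ 2 = x i ^ j := rpow_half_sq (hx i).le j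
    simp only [hw, Complex.real_smul, mixedLag, ← h0]
    push_cast; ring
  rw [heq]
  calc _ ≤ ∫⁻ x in orthant d, ‖w x • ((x i ^ ((j : ℝ) / 2)) • g x)‖ₑ :=
        enorm_integral_le_lintegral_enorm _
    _ = eLpNorm (w • fun x => ((x i ^ ((j : ℝ) / 2)) • g x)) 1 (volume.restrict (orthant d)) := by
        rw [eLpNorm_one_eq_lintegral_enorm]; rfl
    _ ≤ eLpNorm w 2 (volume.restrict (orthant d)) * weightedL2 i j g :=
        eLpNorm_smul_le_mul_eLpNorm (aestronglyMeasurable_weight _ hg) hwm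
    _ = _ := by rw [hw, eLpNorm_mixedLag]

theorem schwartzOrthant_iterBounded {d : ℕ} {f : (Fin d → ℝ) → ℂ} (hf : f ∈ schwartzOrthant d)
    (i : Fin d) : IterBounded i f := by
  refine ⟨hf.2.1, fun j => ⟨(supNorm (Pi.single i j) 0 f).toReal, fun x hx => ?_⟩⟩
  have h : ‖(partialDeriv i)^[j] f x‖ₑ ≤ supNorm (Pi.single i j) 0 f := by
    unfold supNorm
    refine le_iSup₂_of_le x hx ?_
    simp [multiDeriv_single]
  rw [← toReal_enorm]
  exact ENNReal.toReal_mono (hf.2.2.2 _ _).ne h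

/-- With r = n_i!/(n_i-p)!, p integrations by parts put the factor r in front of the coefficient,
while Cauchy–Schwarz returns only √r. The gain is r^{-1/2}, at the cost (3A/2)^p p^{αp/2} of p
derivatives with weight t^{p/2}. -/
theorem enorm_laguerreCoeff_le {d : ℕ} {α A : ℝ} (hα : 1 ≤ α) (hA : 0 < A)
    {f : (Fin d → ℝ) → ℂ} (hf : f ∈ schwartzOrthant d) (n : Fin d → ℕ) (i : Fin d) {p : ℕ}
    (hp : p ≤ n i) :
    ‖laguerreCoeff f n‖ₑ ≤ gsNorm α α A f * ENNReal.ofReal ((3 / 2 * A) ^ p *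
      (p : ℝ) ^ (α / 2 * p) * √(((n i - p).factorial : ℝ) / ((n i).factorial : ℝ))) := by
  set m := n i - p with hm
  have hmp : m + p = n i := by omega
  have h1 := integral_mul_mixedLag_iterate (i := i) n p 0 m (schwartzOrthant_iterBounded hf i)
  rw [hmp, zero_add] at h1
  have h2 : laguerreCoeff f n = ∫ x in orthant d, f x * (mixedLag n i 0 (n i) x : ℂ) :=
    setIntegral_congr_fun (measurableSet_orthant d) fun x hx => by
      simp only [laguerreFun_eq_mixedLag n i hx]
  rw [← h2] at h1
  set r : ℝ := ((n i).factorial : ℝ) / (m.factorial : ℝ) with hr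
  have hr0 : 0 < r := by positivity
  have h3 : ENNReal.ofReal r * ‖laguerreCoeff f n‖ₑ ≤
      ENNReal.ofReal (√r) * (ENNReal.ofReal ((3 / 2) ^ p) *
        (gsNorm α α A f * ENNReal.ofReal (A ^ p * (p : ℝ) ^ (α / 2 * p)))) := by
    have e : ENNReal.ofReal r = ‖((n i).factorial : ℂ) / (m.factorial : ℂ)‖ₑ := by
      rw [← ofReal_norm]; simp [hr]
    rw [e, ← enorm_mul, h1, enorm_mul]
    have e1 : ‖((-1 : ℂ) ^ p)‖ₑ = 1 := by simp
    rw [e1, one_mul]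
    refine (enorm_integral_mul_mixedLag_le (shiftDeriv_iterate_contDiffOn p hf.2.1) n i p m).trans ?_
    rw [hmp]
    refine mul_le_mul_right ?_ _
    exact weightedL2_shiftDeriv_le p hf.2.1 _
      (fun q hq => weightedL2_partialDeriv_le hα hA i hq f) p 0 (by omega)
  have e4 : √(((n i - p).factorial : ℝ) / ((n i).factorial : ℝ)) = r⁻¹ * √r := by
    have h4 : (((n i - p).factorial : ℝ) / ((n i).factorial : ℝ)) = r⁻¹ := by rw [hr, inv_div]
    have h5 : √r ≠ 0 := (Real.sqrt_pos.2 hr0).ne'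
    have h6 : r = √r * √r := (Real.mul_self_sqrt hr0.le).symm
    rw [h4, Real.sqrt_inv]
    rw [inv_mul_eq_div, eq_div_iff hr0.ne']
    nth_rewrite 2 [h6]
    field_simp
  rw [e4]
  have hfin : ENNReal.ofReal r ≠ ⊤ := ENNReal.ofReal_ne_top
  have hne : ENNReal.ofReal r ≠ 0 := (ENNReal.ofReal_pos.2 hr0).ne'
  calc ‖laguerreCoeff f n‖ₑ = ENNReal.ofReal r⁻¹ * (ENNReal.ofReal r * ‖laguerreCoeff f n‖ₑ) := by
        rw [ENNReal.ofReal_inv_of_pos hr0, ← mul_assoc, ENNReal.inv_mul_cancel hne hfin, one_mul]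
    _ ≤ _ := mul_le_mul_right h3 _
    _ = _ := by
        rw [show (3 / 2 * A) ^ p * (p : ℝ) ^ (α / 2 * p) * (r⁻¹ * √r) =
          r⁻¹ * (√r * ((3 / 2) ^ p * (A ^ p * (p : ℝ) ^ (α / 2 * p)))) by rw [mul_pow]; ring,
          ENNReal.ofReal_mul (p := r⁻¹) (by positivity), ENNReal.ofReal_mul (p := √r) (by positivity),
          ENNReal.ofReal_mul (p := (3 / 2) ^ p) (by positivity)]
        ring

/-- The Laguerre coefficients of functions in `G^{α,A}_{α,A}` decay like the elements of a fixed
step `s^{α,a}`, with a norm estimate. -/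
theorem exists_seqNorm_laguerreCoeff_le {d : ℕ} (hd : 1 ≤ d) {α A : ℝ} (hα : 1 ≤ α) (hA : 0 < A) :
    ∃ a : ℝ, 1 < a ∧ ∀ f ∈ gsStepSubmodule d α α A,
      seqNorm d α a (laguerreCoeff f) ≤ 2 * gsNorm α α A f := by
  obtain ⟨a, ha, h⟩ := exists_rpow_decay hα (B := 3 / 2 * A) (by positivity) d hd
  refine ⟨a, ha, fun f hf => iSup_le fun n => ?_⟩
  have : Nonempty (Fin d) := ⟨⟨0, hd⟩⟩
  -- The largest coordinate satisfies |n| ≤ d n_i, so differentiating in that single direction is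
  -- enough.
  obtain ⟨i, -, hi⟩ := Finset.exists_max_image Finset.univ n ⟨Classical.arbitrary _, Finset.mem_univ _⟩
  have hs : ∑ l, n l ≤ d * n i := by
    calc ∑ l, n l ≤ ∑ _l : Fin d, n i := Finset.sum_le_sum fun l hl => hi l hl
      _ = d * n i := by simp
  have hσ : gsNorm α α A f ≠ ⊤ := hf.2.ne
  have key := h (∑ l, n l) (n i) hs ‖laguerreCoeff f n‖ (gsNorm α α A f).toReal (norm_nonneg _)
    ENNReal.toReal_nonneg fun p hp => by
      have h1 := ENNReal.toReal_mono (ENNReal.mul_ne_top hσ ENNReal.ofReal_ne_top)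
        (enorm_laguerreCoeff_le hα hA hf.1 n i hp)
      rwa [toReal_enorm, ENNReal.toReal_mul, ENNReal.toReal_ofReal (by positivity)] at h1
  calc _ = ENNReal.ofReal (‖laguerreCoeff f n‖ * a ^ (((∑ i, n i : ℕ) : ℝ) ^ (1 / α))) := by
        rw [ENNReal.ofReal_mul (norm_nonneg _), ofReal_norm]
    _ ≤ ENNReal.ofReal (2 * (gsNorm α α A f).toReal) := ENNReal.ofReal_le_ofReal key
    _ = _ := by rw [ENNReal.ofReal_mul two_pos.le, ENNReal.ofReal_toReal hσ]; simp

theorem integrableOn_mul_laguerreFun {d : ℕ} (hd : 1 ≤ d) {f : (Fin d → ℝ) → ℂ}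
    (hf : f ∈ schwartzOrthant d) (n : Fin d → ℕ) :
    IntegrableOn (fun t => f t * laguerreFun n t) (orthant d) := by
  let i : Fin d := ⟨0, hd⟩
  have hb := schwartzOrthant_iterBounded hf i
  obtain ⟨K, hK⟩ := hb.2 0
  refine (integrableOn_mul_of_bounded hf.2.1 hK (integrableOn_mixedLag n i 0 (n i))).congr_fun
    (fun x hx => ?_) (measurableSet_orthant d)
  simp only [laguerreFun_eq_mixedLag n i hx]

/-! ### Laguerre series -/

/-- The derivative `D^p` of the `d`-dimensional Laguerre function, on the whole space. -/
noncomputable def multiLag {d : ℕ} (p n : Fin d → ℕ) (x : Fin d → ℝ) : ℝ :=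
  ∏ l, iteratedDeriv (p l) (lagFun 0 (n l)) (x l)

section multiLag

variable {d : ℕ}

theorem hasDerivAt_iteratedDeriv_lagFun (p n : ℕ) (t : ℝ) :
    HasDerivAt (iteratedDeriv p (lagFun 0 n)) (iteratedDeriv (p + 1) (lagFun 0 n) t) t := by
  rw [iteratedDeriv_succ]
  exact (((contDiff_lagFun 0 n).of_le (m := ((p + 1 : ℕ) : WithTop ℕ∞)) (by exact_mod_cast le_top)
    ).differentiable_iteratedDeriv p (by exact_mod_cast Nat.lt_succ_self p)).differentiableAt.hasDerivAt

theorem continuous_iteratedDeriv_lagFun (p n : ℕ) : Continuous (iteratedDeriv p (lagFun 0 n)) :=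
  continuous_iff_continuousAt.2 fun t => (hasDerivAt_iteratedDeriv_lagFun p n t).continuousAt

theorem continuous_multiLag (p n : Fin d → ℕ) : Continuous (multiLag p n) :=
  continuous_finsetProd _ fun l _ =>
    (continuous_iteratedDeriv_lagFun (p l) (n l)).comp (continuous_apply l)

theorem hasFDerivAt_multiLag (p n : Fin d → ℕ) (x : Fin d → ℝ) :
    HasFDerivAt (multiLag p n) (∑ i, multiLag (p + Pi.single i 1) n x •
      (ContinuousLinearMap.proj i : (Fin d → ℝ) →L[ℝ] ℝ)) x := by
  have h := HasFDerivAt.finsetProd (u := Finset.univ)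
    (g := fun (l : Fin d) (x : Fin d → ℝ) => iteratedDeriv (p l) (lagFun 0 (n l)) (x l))
    (g' := fun l => iteratedDeriv (p l + 1) (lagFun 0 (n l)) (x l) •
      (ContinuousLinearMap.proj l : (Fin d → ℝ) →L[ℝ] ℝ)) (x := x) fun l _ => by
    have h1 : HasFDerivAt (fun x : Fin d → ℝ => x l)
      (ContinuousLinearMap.proj l : (Fin d → ℝ) →L[ℝ] ℝ) x := hasFDerivAt_apply l x
    exact (hasDerivAt_iteratedDeriv_lagFun (p l) (n l) (x l)).comp_hasFDerivAt x h1
  refine h.congr_fderiv (Finset.sum_congr rfl fun i _ => ?_)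
  rw [smul_smul, multiLag, ← Finset.prod_erase_mul _ _ (Finset.mem_univ i)]
  congr 2
  · refine Finset.prod_congr rfl fun l hl => ?_
    rw [Pi.add_apply, Pi.single_eq_of_ne (Finset.ne_of_mem_erase hl), add_zero]
  · rw [Pi.add_apply, Pi.single_eq_same]

theorem exists_abs_mul_multiLag_le (p k : Fin d → ℕ) : ∃ (K : ℝ) (R : ℕ), 0 ≤ K ∧
    ∀ n : Fin d → ℕ, ∀ x ∈ closedOrthant d,
      |(∏ i, x i ^ k i) * multiLag p n x| ≤ K * (((∑ i, n i : ℕ) : ℝ) + 1) ^ R := by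
  refine ⟨∏ l, (2 ^ k l * (2 * ((p l : ℝ) + k l + 1)) ^ (2 * k l + p l + 1)),
    ∑ l, (2 * k l + p l + 1), by positivity, fun n x hx => ?_⟩
  rw [multiLag, ← Finset.prod_mul_distrib, Finset.abs_prod, ← Finset.prod_pow_eq_pow_sum,
    ← Finset.prod_mul_distrib]
  refine Finset.prod_le_prod (fun _ _ => abs_nonneg _) fun l _ => ?_
  refine (abs_pow_mul_iteratedDeriv_lagFun_le (p l) (k l) (n l) (hx l)).trans ?_
  rw [mul_assoc, ← mul_pow]
  have h1 : (n l : ℝ) ≤ ((∑ i, n i : ℕ) : ℝ) := by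
    exact_mod_cast Finset.single_le_sum (f := n) (fun _ _ => Nat.zero_le _) (Finset.mem_univ l)
  have h2 : (0 : ℝ) ≤ n l := by positivity
  have h3 : (0 : ℝ) ≤ (p l : ℝ) + k l := by positivity
  have h4 : 2 * ((n l : ℝ) + p l + k l + 1) ≤
      2 * ((p l : ℝ) + k l + 1) * (((∑ i, n i : ℕ) : ℝ) + 1) := by nlinarith
  exact mul_le_mul_of_nonneg_left (pow_le_pow_left₀ (by positivity) h4 _) (by positivity)

theorem orthant_subset_closedOrthant : orthant d ⊆ closedOrthant d := fun _ hx i => (hx i).le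

theorem isPreconnected_orthant : IsPreconnected (orthant d) := by
  have h : Convex ℝ (orthant d) := by
    rw [orthant_eq_pi]
    exact convex_pi fun _ _ => convex_Ioi 0
  exact h.isPreconnected

theorem one_mem_orthant : (fun _ => 1 : Fin d → ℝ) ∈ orthant d := fun _ => one_pos

end multiLag

section series

variable {d : ℕ} {α a : ℝ} {u : (Fin d → ℕ) → ℂ}

theorem norm_le_of_mem_seqStep (ha : 1 < a) (hu : u ∈ seqStepSubmodule d α a) (n : Fin d → ℕ) :
    ‖u n‖ ≤ (seqNorm d α a u).toReal * a⁻¹ ^ rho α n := by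
  have ha0 : 0 < a := by linarith
  have h : ‖u n‖ₑ * ENNReal.ofReal (a ^ rho α n) ≤ seqNorm d α a u :=
    le_iSup (fun n : Fin d → ℕ => ‖u n‖ₑ * ENNReal.ofReal (a ^ rho α n)) n
  have h1 := ENNReal.toReal_mono (LT.lt.ne hu) h
  rw [ENNReal.toReal_mul, toReal_enorm, ENNReal.toReal_ofReal (by positivity)] at h1
  rw [Real.inv_rpow ha0.le, ← div_eq_mul_inv, le_div_iff₀ (by positivity)]
  exact h1

/-- The termwise derivative `∑ u_n D^p 𝓛_n` of a Laguerre series. -/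
noncomputable def seriesDeriv (u : (Fin d → ℕ) → ℂ) (p : Fin d → ℕ) (x : Fin d → ℝ) : ℂ :=
  ∑' n, u n * (multiLag p n x : ℂ)

/-- A summable majorant for weighted termwise derivatives. -/
theorem exists_majorant (hα : 1 ≤ α) (ha : 1 < a) (p k : Fin d → ℕ) :
    ∃ b : (Fin d → ℕ) → ℝ, Summable b ∧ (∀ n, 0 ≤ b n) ∧
      ∀ u ∈ seqStepSubmodule d α a, ∀ n, ∀ x ∈ closedOrthant d,
        ‖((∏ i, x i ^ k i : ℝ) : ℂ) * (u n * (multiLag p n x : ℂ))‖ ≤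
          (seqNorm d α a u).toReal * b n := by
  obtain ⟨K, R, hK, h⟩ := exists_abs_mul_multiLag_le p k
  have ha0 : 0 < a := by linarith
  have ha1 : a⁻¹ < 1 := inv_lt_one_of_one_lt₀ ha
  refine ⟨fun n => K * ((((∑ i, n i : ℕ) : ℝ) + 1) ^ R * a⁻¹ ^ rho α n),
    (summable_pow_mul_rpow_rho hα (inv_pos.2 ha0) ha1 R).mul_left K, fun n => by positivity,
    fun u hu n x hx => ?_⟩
  have h1 := norm_le_of_mem_seqStep ha hu n
  have h2 := h n x hx
  calc _ = ‖u n‖ * |(∏ i, x i ^ k i) * multiLag p n x| := by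
        rw [mul_left_comm, norm_mul, ← Complex.ofReal_mul, Complex.norm_real, Real.norm_eq_abs]
    _ ≤ ((seqNorm d α a u).toReal * a⁻¹ ^ rho α n) * (K * (((∑ i, n i : ℕ) : ℝ) + 1) ^ R) := by
        gcongr
    _ = _ := by ring

theorem exists_majorant_zero (hα : 1 ≤ α) (ha : 1 < a) (hu : u ∈ seqStepSubmodule d α a)
    (p : Fin d → ℕ) : ∃ b : (Fin d → ℕ) → ℝ, Summable b ∧ (∀ n, 0 ≤ b n) ∧
      ∀ n, ∀ x ∈ closedOrthant d, ‖u n * (multiLag p n x : ℂ)‖ ≤ b n := by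
  obtain ⟨b, hb, hb0, h⟩ := exists_majorant hα ha p (0 : Fin d → ℕ)
  refine ⟨fun n => (seqNorm d α a u).toReal * b n, hb.mul_left _,
    fun n => mul_nonneg ENNReal.toReal_nonneg (hb0 n), fun n x hx => ?_⟩
  simpa using h u hu n x hx

theorem summable_series (hα : 1 ≤ α) (ha : 1 < a) (hu : u ∈ seqStepSubmodule d α a)
    (p : Fin d → ℕ) {x : Fin d → ℝ} (hx : x ∈ closedOrthant d) :
    Summable fun n => u n * (multiLag p n x : ℂ) := by
  obtain ⟨b, hb, -, h⟩ := exists_majorant_zero hα ha hu p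
  exact Summable.of_norm_bounded hb fun n => h n x hx

theorem continuousOn_seriesDeriv (hα : 1 ≤ α) (ha : 1 < a) (hu : u ∈ seqStepSubmodule d α a)
    (p : Fin d → ℕ) : ContinuousOn (seriesDeriv u p) (closedOrthant d) := by
  obtain ⟨b, hb, -, h⟩ := exists_majorant_zero hα ha hu p
  refine continuousOn_tsum (fun n => ?_) hb h
  exact (continuous_const.mul (Complex.continuous_ofReal.comp (continuous_multiLag p n))).continuousOn

/-- Termwise differentiation on the open connected orthant: the gradients have a summable majorant
because weighted sup norms of Laguerre functions grow polynomially while u decays like a stretched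
exponential. -/
theorem hasFDerivAt_seriesDeriv (hα : 1 ≤ α) (ha : 1 < a) (hu : u ∈ seqStepSubmodule d α a)
    (p : Fin d → ℕ) {x : Fin d → ℝ} (hx : x ∈ orthant d) :
    HasFDerivAt (seriesDeriv u p) (∑ i, (ContinuousLinearMap.proj i :
      (Fin d → ℝ) →L[ℝ] ℝ).smulRight (seriesDeriv u (p + Pi.single i 1) x)) x := by
  choose b hb hb0 h using fun i : Fin d => exists_majorant_zero hα ha hu (p + Pi.single i 1)
  let f' : (Fin d → ℕ) → (Fin d → ℝ) → ((Fin d → ℝ) →L[ℝ] ℂ) := fun n x =>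
    ∑ i, (ContinuousLinearMap.proj i : (Fin d → ℝ) →L[ℝ] ℝ).smulRight
      (u n * (multiLag (p + Pi.single i 1) n x : ℂ))
  have hder : ∀ n x, x ∈ orthant d →
      HasFDerivAt (fun x => u n * (multiLag p n x : ℂ)) (f' n x) x := by
    intro n x _
    have h1 := (Complex.ofRealCLM.hasFDerivAt.comp x (hasFDerivAt_multiLag p n x)).const_mul (u n)
    refine h1.congr_fderiv ?_
    ext v
    simp [f', Finset.mul_sum, mul_comm, mul_left_comm]
  have hnorm : ∀ n x, x ∈ orthant d → ‖f' n x‖ ≤ ∑ i, ‖(ContinuousLinearMap.proj i :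
      (Fin d → ℝ) →L[ℝ] ℝ)‖ * b i n := by
    intro n x hx
    refine (norm_sum_le _ _).trans (Finset.sum_le_sum fun i _ => ?_)
    rw [ContinuousLinearMap.norm_smulRight_apply]
    exact mul_le_mul_of_nonneg_left (h i n x (orthant_subset_closedOrthant hx)) (norm_nonneg _)
  have key := hasFDerivAt_tsum_of_isPreconnected (summable_sum fun i _ => (hb i).mul_left _)
    (isOpen_orthant d) isPreconnected_orthant hder hnorm one_mem_orthant
    (summable_series hα ha hu p (orthant_subset_closedOrthant one_mem_orthant)) hx
  refine key.congr_fderiv (HasSum.tsum_eq ?_)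
  refine hasSum_sum fun i _ => ?_
  exact (summable_series hα ha hu (p + Pi.single i 1)
    (orthant_subset_closedOrthant hx)).hasSum.mapL
      (ContinuousLinearMap.smulRightL ℝ (Fin d → ℝ) ℂ (ContinuousLinearMap.proj i))

/-- The derivative is assembled from series of the same kind with p increased by a unit vector, so
induction on the order works for all p simultaneously. -/
theorem contDiffOn_seriesDeriv (hα : 1 ≤ α) (ha : 1 < a) (hu : u ∈ seqStepSubmodule d α a)
    (p : Fin d → ℕ) : ContDiffOn ℝ ∞ (seriesDeriv u p) (orthant d) := by
  rw [contDiffOn_infty]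
  intro m
  induction m generalizing p with
  | zero =>
    exact contDiffOn_zero.2 ((continuousOn_seriesDeriv hα ha hu p).mono orthant_subset_closedOrthant)
  | succ m ih =>
    refine (contDiffOn_succ_iff_fderiv_of_isOpen (isOpen_orthant d)).2 ⟨fun x hx =>
      (hasFDerivAt_seriesDeriv hα ha hu p hx).differentiableAt.differentiableWithinAt,
      fun h => absurd h (WithTop.natCast_ne_top m), ?_⟩
    have h : ContDiffOn ℝ m (fun x => ∑ i, (ContinuousLinearMap.smulRightL ℝ (Fin d → ℝ) ℂ
        (ContinuousLinearMap.proj i)) (seriesDeriv u (p + Pi.single i 1) x)) (orthant d) :=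
      ContDiffOn.sum fun i _ => (ContinuousLinearMap.contDiff _).comp_contDiffOn (ih _)
    refine h.congr fun x hx => ?_
    rw [(hasFDerivAt_seriesDeriv hα ha hu p hx).fderiv]
    rfl

theorem partialDeriv_seriesDeriv (hα : 1 ≤ α) (ha : 1 < a) (hu : u ∈ seqStepSubmodule d α a)
    (p : Fin d → ℕ) (i : Fin d) :
    EqOn (partialDeriv i (seriesDeriv u p)) (seriesDeriv u (p + Pi.single i 1)) (orthant d) := by
  intro x hx
  have h := hasFDerivAt_seriesDeriv hα ha hu p hx
  rw [partialDeriv, h.differentiableAt.lineDeriv_eq_fderiv, h.fderiv,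
    sum_apply, Finset.sum_eq_single i]
  · simp
  · intro j _ hj
    simp [Pi.single_eq_of_ne hj]
  · simp

theorem iterate_partialDeriv_seriesDeriv (hα : 1 ≤ α) (ha : 1 < a)
    (hu : u ∈ seqStepSubmodule d α a) (p : Fin d → ℕ) (i : Fin d) (m : ℕ) :
    EqOn ((partialDeriv i)^[m] (seriesDeriv u p)) (seriesDeriv u (p + Pi.single i m))
      (orthant d) := by
  induction m with
  | zero => simpa using eqOn_refl _ _
  | succ m ih =>
    rw [Function.iterate_succ_apply', Pi.single_add, ← add_assoc]
    exact (partialDeriv_congr i ih).trans (partialDeriv_seriesDeriv hα ha hu _ i)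

/-- The sum of a Laguerre series, as a function on the orthant. -/
noncomputable def laguerreSeries (u : (Fin d → ℕ) → ℂ) : (Fin d → ℝ) → ℂ :=
  (orthant d).indicator (seriesDeriv u 0)

theorem laguerreSeries_eqOn : EqOn (laguerreSeries u) (seriesDeriv u 0) (orthant d) :=
  fun _ hx => Set.indicator_of_mem hx _

theorem multiDeriv_laguerreSeries (hα : 1 ≤ α) (ha : 1 < a) (hu : u ∈ seqStepSubmodule d α a)
    (p : Fin d → ℕ) : EqOn (multiDeriv p (laguerreSeries u)) (seriesDeriv u p) (orthant d) := by
  have key : ∀ l : List (Fin d), l.Nodup →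
      EqOn (l.foldr (fun i g => (partialDeriv i)^[p i] g) (laguerreSeries u))
        (seriesDeriv u (fun j => if j ∈ l then p j else 0)) (orthant d) := by
    intro l hl
    induction l with
    | nil => simpa using! laguerreSeries_eqOn
    | cons i l ih =>
      have h1 := (iterate_congr i (p i) (ih hl.of_cons)).trans
        (iterate_partialDeriv_seriesDeriv hα ha hu _ i (p i))
      rw [List.foldr_cons]
      convert h1 using 2
      funext j
      rw [Pi.add_apply]
      by_cases hj : j = i
      · subst hj
        simp [(List.nodup_cons.1 hl).1]
      · simp [hj]
  have h := key _ (List.nodup_finRange d)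
  simpa [multiDeriv] using h

theorem exists_supNorm_laguerreSeries_le (hα : 1 ≤ α) (ha : 1 < a) (p k : Fin d → ℕ) :
    ∃ C : ℝ≥0, ∀ u ∈ seqStepSubmodule d α a,
      supNorm p k (laguerreSeries u) ≤ C * seqNorm d α a u := by
  obtain ⟨b, hb, hb0, h⟩ := exists_majorant (d := d) hα ha p k
  refine ⟨⟨∑' n, b n, tsum_nonneg hb0⟩, fun u hu => iSup₂_le fun x hx => ?_⟩
  have hx' := orthant_subset_closedOrthant hx
  rw [multiDeriv_laguerreSeries hα ha hu p hx, Complex.real_smul, seriesDeriv, ← tsum_mul_left]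
  have h1 := tsum_of_norm_bounded (hb.hasSum.mul_left (seqNorm d α a u).toReal)
    (fun n => h u hu n x hx')
  rw [← ofReal_norm]
  refine (ENNReal.ofReal_le_ofReal h1).trans ?_
  rw [ENNReal.ofReal_mul ENNReal.toReal_nonneg, ENNReal.ofReal_toReal (LT.lt.ne hu), mul_comm]
  refine mul_le_mul_left (le_of_eq ?_) _
  rw [ENNReal.ofReal_eq_coe_nnreal (tsum_nonneg hb0)]
  rfl

end series

/-! ### Weighted L² bounds for Laguerre series. -/

/-- Minkowski's inequality for the finite partial sums along an exhausting sequence, then Fatou's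
lemma. -/
theorem eLpNorm_tsum_le {ι X E : Type*} [Countable ι] [MeasurableSpace X] {μ : Measure X}
    [NormedAddCommGroup E] {f : ι → X → E} {p : ℝ≥0∞} (hp : 1 ≤ p)
    (hm : ∀ i, AEStronglyMeasurable (f i) μ) (hs : ∀ᵐ x ∂μ, Summable fun i => f i x) :
    eLpNorm (fun x => ∑' i, f i x) p μ ≤ ∑' i, eLpNorm (f i) p μ := by
  obtain ⟨v, hv⟩ := exists_seq_tendsto (atTop : Filter (Finset ι))
  have h1 : eLpNorm (fun x => ∑' i, f i x) p μ ≤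
      atTop.liminf fun n => eLpNorm (∑ i ∈ v n, f i) p μ := by
    refine Lp.eLpNorm_lim_le_liminf_eLpNorm
      (fun n => Finset.aestronglyMeasurable_sum _ fun i _ => hm i) _ ?_
    filter_upwards [hs] with x hx
    simpa [Function.comp_def] using hx.hasSum.comp hv
  refine h1.trans (liminf_le_of_frequently_le' (Frequently.of_forall fun n => ?_))
  exact (eLpNorm_sum_le (fun i _ => hm i) hp).trans (ENNReal.sum_le_tsum _)

section series

variable {d : ℕ} {α a : ℝ} {u : (Fin d → ℕ) → ℂ}

theorem eLpNorm_weighted_multiLag_le (p k n : Fin d → ℕ) :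
    eLpNorm (fun t : Fin d → ℝ => (∏ i, t i ^ (((p i + k i : ℕ) : ℝ) / 2)) * multiLag p n t) 2
      (volume.restrict (orthant d)) ≤
      ENNReal.ofReal (2 ^ (∑ i, (p i + k i)) * (((∑ i, n i : ℕ) : ℝ) +
        ((∑ i, (p i + k i) : ℕ) : ℝ)) ^ (((∑ i, (p i + k i) : ℕ) : ℝ) / 2)) := by
  simp only [multiLag, ← Finset.prod_mul_distrib]
  rw [eLpNorm_prod_orthant (fun i (t : ℝ) => t ^ (((p i + k i : ℕ) : ℝ) / 2) *
    iteratedDeriv (p i) (lagFun 0 (n i)) t) fun i => Measurable.mul (by fun_prop)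
      (continuous_iteratedDeriv_lagFun _ _).measurable]
  set S : ℝ := ((∑ i, n i : ℕ) : ℝ) + ((∑ i, (p i + k i) : ℕ) : ℝ) with hS
  have hS0 : 0 ≤ S := by positivity
  calc _ ≤ ∏ i, ENNReal.ofReal (2 ^ (p i + k i) * S ^ (((p i + k i : ℕ) : ℝ) / 2)) := by
        refine Finset.prod_le_prod' fun i _ =>
          (eLpNorm_rpow_mul_iteratedDeriv_lagFun_le (p i) (k i) (n i)).trans
            (ENNReal.ofReal_le_ofReal ?_)
        have h1 : (n i : ℝ) ≤ ((∑ i, n i : ℕ) : ℝ) := by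
          exact_mod_cast Finset.single_le_sum (f := n) (fun _ _ => Nat.zero_le _) (Finset.mem_univ i)
        have h2 : ((p i + k i : ℕ) : ℝ) ≤ ((∑ i, (p i + k i) : ℕ) : ℝ) := by
          exact_mod_cast Finset.single_le_sum (f := fun i => p i + k i) (fun _ _ => Nat.zero_le _)
            (Finset.mem_univ i)
        have h3 : (2 : ℝ) ^ k i ≤ 2 ^ (p i + k i) :=
          pow_le_pow_right₀ one_le_two (Nat.le_add_left _ _)
        have h4 : (n i : ℝ) + ((p i + k i : ℕ) : ℝ) ≤ S := add_le_add h1 h2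
        exact mul_le_mul h3 (Real.rpow_le_rpow (by positivity) h4 (by positivity)) (by positivity)
          (by positivity)
    _ = ENNReal.ofReal (∏ i, (2 ^ (p i + k i) * S ^ (((p i + k i : ℕ) : ℝ) / 2))) :=
        (ENNReal.ofReal_prod_of_nonneg fun i _ => by positivity).symm
    _ = _ := by
        rw [Finset.prod_mul_distrib, Finset.prod_pow_eq_pow_sum,
          ← Real.rpow_sum_of_nonneg hS0 (fun i _ => by positivity), ← Finset.sum_div,
          ← Nat.cast_sum]

/-- `sum_rpow_le_prod` for the 2d numbers k_i and p_i. It converts the power N^{αN/2} of the total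
order into the product over coordinates used in the norm, at the cost of a geometric factor. -/
theorem denominator_bound (hd : 1 ≤ d) (hα : 1 ≤ α) (p k : Fin d → ℕ) :
    ((∑ i, (p i + k i) : ℕ) : ℝ) ^ (α / 2 * (∑ i, (p i + k i) : ℕ)) ≤
      ((2 * d : ℝ) ^ (α / 2)) ^ (∑ i, (p i + k i)) * ((∏ i, (k i : ℝ) ^ (α / 2 * k i)) *
        ∏ i, (p i : ℝ) ^ (α / 2 * p i)) := by
  have : Nonempty (Fin d) := ⟨⟨0, hd⟩⟩
  have h := sum_rpow_le_prod (ι := Fin d ⊕ Fin d) (β := α / 2) (by linarith) (Sum.elim k p)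
  simp only [Fintype.sum_sum_type, Sum.elim_inl, Sum.elim_inr, Fintype.prod_sum_type,
    Fintype.card_sum, Fintype.card_fin] at h
  have e : ∑ i, k i + ∑ i, p i = ∑ i, (p i + k i) := by rw [Finset.sum_add_distrib, add_comm]
  rw [e] at h
  push_cast at h ⊢
  rwa [← two_mul] at h

theorem exists_gsNorm_laguerreSeries_le (hd : 1 ≤ d) (hα : 1 ≤ α) (ha : 1 < a) :
    ∃ A : ℝ, 0 < A ∧ ∃ C : ℝ≥0, ∀ u ∈ seqStepSubmodule d α a,
      gsNorm α α A (laguerreSeries u) ≤ C * seqNorm d α a u := by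
  have ha0 : 0 < a := by linarith
  have hd0 : (0 : ℝ) < d := by exact_mod_cast hd
  -- The decay of u is split in two equal factors q^{|n|^{1/α}}: one absorbs the growth of the L²
  -- norms of the n-th term, the other is left for summation over n.
  set q : ℝ := a⁻¹ ^ (1 / 2 : ℝ) with hq
  have hq0 : 0 < q := by positivity
  have hq1 : q < 1 := Real.rpow_lt_one (by positivity) (inv_lt_one_of_one_lt₀ ha) (by norm_num)
  have hqa : ∀ n : Fin d → ℕ, a⁻¹ ^ rho α n = q ^ rho α n * q ^ rho α n := fun n => by
    rw [hq, ← Real.mul_rpow (by positivity) (by positivity), ← Real.rpow_add (by positivity)]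
    norm_num
  obtain ⟨C, hC1, hC⟩ := exists_add_rpow_mul_rpow_le hα hq0 hq1
  have hsum := summable_rpow_rho (d := d) hα hq0 hq1
  set T : ℝ := ∑' n : Fin d → ℕ, q ^ rho α n with hT
  have hT0 : 0 ≤ T := tsum_nonneg fun n => by positivity
  -- The three geometric factors come from the L² bound of one term, from
  -- `exists_add_rpow_mul_rpow_le` and from `denominator_bound`.
  set A : ℝ := 2 * C * (2 * d : ℝ) ^ (α / 2) with hA
  have hA0 : 0 < A := by positivity
  refine ⟨A, hA0, ⟨T, hT0⟩, fun u hu => iSup₂_le fun p k => ?_⟩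
  set N := ∑ i, (p i + k i) with hN
  set D : ℝ := A ^ N * (∏ i, (k i : ℝ) ^ (α / 2 * k i)) * ∏ i, (p i : ℝ) ^ (α / 2 * p i) with hD
  have hD0 : 0 < D := gsDenominator_pos hA0 p k
  set M := (seqNorm d α a u).toReal with hM
  have hM0 : 0 ≤ M := ENNReal.toReal_nonneg
  rw [ENNReal.div_le_iff (ENNReal.ofReal_pos.2 hD0).ne' ENNReal.ofReal_ne_top]
  have hterm : ∀ n : Fin d → ℕ, eLpNorm (fun t : Fin d → ℝ =>
      u n * (((∏ i, t i ^ (((p i + k i : ℕ) : ℝ) / 2)) * multiLag p n t : ℝ) : ℂ)) 2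
      (volume.restrict (orthant d)) ≤ ENNReal.ofReal (M * D * q ^ rho α n) := by
    intro n
    have e : eLpNorm (fun t : Fin d → ℝ =>
      u n * (((∏ i, t i ^ (((p i + k i : ℕ) : ℝ) / 2)) * multiLag p n t : ℝ) : ℂ)) 2
      (volume.restrict (orthant d)) = ‖u n‖ₑ * eLpNorm (fun t : Fin d → ℝ =>
        (∏ i, t i ^ (((p i + k i : ℕ) : ℝ) / 2)) * multiLag p n t) 2
        (volume.restrict (orthant d)) := by
      have e0 := eLpNorm_congr_norm_ae (p := 2) (μ := volume.restrict (orthant d))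
        (f := fun t : Fin d → ℝ =>
          (((∏ i, t i ^ (((p i + k i : ℕ) : ℝ) / 2)) * multiLag p n t : ℝ) : ℂ))
        (g := fun t : Fin d → ℝ => (∏ i, t i ^ (((p i + k i : ℕ) : ℝ) / 2)) * multiLag p n t)
        (.of_forall fun t => Complex.norm_real _)
      rw [← e0, ← eLpNorm_const_smul]
      rfl
    have hn1 : ‖u n‖ₑ ≤ ENNReal.ofReal (M * (q ^ rho α n * q ^ rho α n)) := by
      rw [← ofReal_norm, ← hqa]
      exact ENNReal.ofReal_le_ofReal (norm_le_of_mem_seqStep ha hu n)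
    rw [e]
    refine (mul_le_mul' hn1 (eLpNorm_weighted_multiLag_le p k n)).trans ?_
    rw [← hN, ← ENNReal.ofReal_mul (by positivity)]
    refine ENNReal.ofReal_le_ofReal ?_
    have h1 := hC (∑ i, n i) N
    have h2 := denominator_bound hd hα p k
    rw [← hN] at h2
    calc M * (q ^ rho α n * q ^ rho α n) * (2 ^ N * (((∑ i, n i : ℕ) : ℝ) + N) ^ ((N : ℝ) / 2))
        = M * q ^ rho α n * 2 ^ N * ((((∑ i, n i : ℕ) : ℝ) + N) ^ ((N : ℝ) / 2) * q ^ rho α n) := by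
          ring
      _ ≤ M * q ^ rho α n * 2 ^ N * (C ^ N * (((2 * d : ℝ) ^ (α / 2)) ^ N *
          ((∏ i, (k i : ℝ) ^ (α / 2 * k i)) * ∏ i, (p i : ℝ) ^ (α / 2 * p i)))) := by
          refine mul_le_mul_of_nonneg_left (h1.trans ?_) (by positivity)
          exact mul_le_mul_of_nonneg_left h2 (by positivity)
      _ = M * D * q ^ rho α n := by
          rw [hD, hA, mul_pow, mul_pow]; ring
  have heq : l2Norm p k (laguerreSeries u) = eLpNorm (fun t : Fin d → ℝ => ∑' n : Fin d → ℕ,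
      u n * (((∏ i, t i ^ (((p i + k i : ℕ) : ℝ) / 2)) * multiLag p n t : ℝ) : ℂ)) 2
      (volume.restrict (orthant d)) := by
    refine eLpNorm_congr_ae ((ae_restrict_iff' (measurableSet_orthant d)).2 (.of_forall fun x hx => ?_))
    simp only [multiDeriv_laguerreSeries hα ha hu p hx, Complex.real_smul, seriesDeriv,
      ← tsum_mul_left]
    refine tsum_congr fun n => ?_
    push_cast; ring
  rw [heq]
  refine (eLpNorm_tsum_le (by norm_num) (fun n => ?_) ?_).trans ?_
  · refine Measurable.aestronglyMeasurable (measurable_const.mul (Complex.measurable_ofReal.comp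
      (Measurable.mul (by fun_prop) (continuous_multiLag p n).measurable)))
  · refine (ae_restrict_iff' (measurableSet_orthant d)).2 (.of_forall fun x hx => ?_)
    refine ((summable_series hα ha hu p (orthant_subset_closedOrthant hx)).mul_left
      ((∏ i, x i ^ (((p i + k i : ℕ) : ℝ) / 2) : ℝ) : ℂ)).congr fun n => ?_
    push_cast; ring
  · refine (ENNReal.tsum_le_tsum hterm).trans ?_
    rw [← ENNReal.ofReal_tsum_of_nonneg (fun n => by positivity) (hsum.mul_left _), tsum_mul_left,
      ← hT, mul_assoc, ENNReal.ofReal_mul hM0, hM, ENNReal.ofReal_toReal (LT.lt.ne hu), mul_comm D,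
      ENNReal.ofReal_mul hT0, ENNReal.ofReal_eq_coe_nnreal hT0, ← mul_assoc]
    exact le_of_eq (by rw [mul_comm (seqNorm d α a u)]; rfl)

theorem laguerreSeries_mem_schwartzOrthant (hα : 1 ≤ α) (ha : 1 < a)
    (hu : u ∈ seqStepSubmodule d α a) : laguerreSeries u ∈ schwartzOrthant d := by
  refine ⟨fun x hx => Set.indicator_of_notMem hx _,
    (contDiffOn_seriesDeriv hα ha hu 0).congr laguerreSeries_eqOn, fun p =>
    ⟨seriesDeriv u p, continuousOn_seriesDeriv hα ha hu p,
      (multiDeriv_laguerreSeries hα ha hu p).symm⟩, fun p k => ?_⟩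
  obtain ⟨C, hC⟩ := exists_supNorm_laguerreSeries_le (d := d) hα ha p k
  exact (hC u hu).trans_lt (ENNReal.mul_lt_top ENNReal.coe_lt_top hu)

/-! ### Coefficients of Laguerre series -/

theorem multiLag_zero (n : Fin d → ℕ) (x : Fin d → ℝ) :
    multiLag 0 n x = ∏ l, lagFun 0 (n l) (x l) := by
  simp [multiLag]

theorem integrableOn_multiLag_zero (n : Fin d → ℕ) : IntegrableOn (multiLag 0 n) (orthant d) := by
  rw [IntegrableOn, volume_restrict_orthant]
  have : multiLag 0 n = fun x => ∏ l, lagFun 0 (n l) (x l) := funext (multiLag_zero n)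
  rw [this]
  exact Integrable.fintype_prod (𝕜 := ℝ) (f := fun l => lagFun 0 (n l))
    fun l => integrableOn_lagFun 0 (n l)

theorem integral_multiLag_mul (m n : Fin d → ℕ) :
    ∫ x in orthant d, multiLag 0 m x * multiLag 0 n x = if m = n then 1 else 0 := by
  simp only [multiLag_zero, ← Finset.prod_mul_distrib]
  rw [volume_restrict_orthant]
  rw [integral_fintype_prod_eq_prod (𝕜 := ℝ) (fun l t => lagFun 0 (m l) t * lagFun 0 (n l) t)]
  simp only [lagInner_zero_left]
  rw [Finset.prod_ite_zero]
  simp [funext_iff]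

/-- Orthonormality of the Laguerre functions. Summation and integration are interchanged because the
terms are dominated by a summable sequence times the integrable function |𝓛_n|. -/
theorem laguerreCoeff_laguerreSeries (hα : 1 ≤ α) (ha : 1 < a) (hu : u ∈ seqStepSubmodule d α a) :
    laguerreCoeff (laguerreSeries u) = u := by
  funext n
  obtain ⟨b, hb, hb0, h⟩ := exists_majorant_zero hα ha hu (0 : Fin d → ℕ)
  have hW := integrableOn_multiLag_zero n
  set F : (Fin d → ℕ) → (Fin d → ℝ) → ℂ := fun m x =>
    (u m * (multiLag 0 m x : ℂ)) * (multiLag 0 n x : ℂ) with hF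
  have hbd : ∀ m, ∀ x ∈ orthant d, ‖F m x‖ ≤ b m * ‖multiLag 0 n x‖ := fun m x hx => by
    rw [hF, norm_mul, Complex.norm_real]
    exact mul_le_mul_of_nonneg_right (h m x (orthant_subset_closedOrthant hx)) (norm_nonneg _)
  have hmeas : ∀ m, AEStronglyMeasurable (F m) (volume.restrict (orthant d)) := fun m => by
    have h1 := continuous_multiLag 0 m
    have h2 := continuous_multiLag 0 n
    exact Continuous.aestronglyMeasurable (by fun_prop)
  have hae : ∀ m, ∀ᵐ x ∂(volume.restrict (orthant d)), ‖F m x‖ ≤ b m * ‖multiLag 0 n x‖ := fun m =>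
    (ae_restrict_iff' (measurableSet_orthant d)).2 (.of_forall (hbd m))
  have hint : ∀ m, Integrable (F m) (volume.restrict (orthant d)) := fun m =>
    Integrable.mono' (hW.norm.const_mul (b m)) (hmeas m) (hae m)
  have hsum : Summable fun m => ∫ x in orthant d, ‖F m x‖ := by
    refine Summable.of_nonneg_of_le (fun m => integral_nonneg fun x => norm_nonneg _) (fun m => ?_)
      (hb.mul_right (∫ x in orthant d, ‖multiLag 0 n x‖))
    rw [← integral_const_mul]
    exact integral_mono_ae (hint m).norm (hW.norm.const_mul (b m)) (hae m)
  have key := hasSum_integral_of_summable_integral_norm hint hsum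
  have hval : ∀ m, ∫ x in orthant d, F m x = if m = n then u n else 0 := by
    intro m
    have e : ∀ x, F m x = u m * ((multiLag 0 m x * multiLag 0 n x : ℝ) : ℂ) := fun x => by
      rw [hF]; push_cast; ring
    simp only [e]
    rw [integral_const_mul, integral_complex_ofReal, integral_multiLag_mul]
    split_ifs with hmn
    · subst hmn; simp
    · simp
  simp only [hval] at key
  have h2 : laguerreCoeff (laguerreSeries u) n = ∫ x in orthant d, ∑' m, F m x := by
    refine setIntegral_congr_fun (measurableSet_orthant d) fun x hx => ?_
    simp only [hF, laguerreSeries_eqOn hx, laguerreFun_eq n hx, seriesDeriv, tsum_mul_right,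
      multiLag_zero]
  rw [h2]
  exact key.unique (hasSum_ite_eq n (u n))

theorem seqNorm_single_lt_top (n : Fin d → ℕ) (c : ℂ) :
    seqNorm d α a (Pi.single n c) < ⊤ := by
  refine lt_of_le_of_lt (iSup_le fun m => ?_) (ENNReal.mul_lt_top (enorm_lt_top (x := c))
    (ENNReal.ofReal_lt_top (r := a ^ rho α n)))
  by_cases h : m = n
  · subst h; simp [rho]
  · simp [Pi.single_eq_of_ne h]

theorem laguerreSeries_single (n : Fin d → ℕ) : laguerreSeries (Pi.single n 1) = laguerreFun n := by
  funext x
  by_cases hx : x ∈ orthant d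
  · rw [laguerreSeries_eqOn hx, laguerreFun_eq n hx, seriesDeriv, tsum_eq_single n]
    · simp [multiLag_zero]
    · intro m hm
      simp [Pi.single_eq_of_ne hm]
  · rw [laguerreSeries, laguerreFun, Set.indicator_of_notMem hx, Set.indicator_of_notMem hx]

end series

/-! ### Completeness of the Laguerre functions -/

section completeness

variable {d : ℕ}

theorem integrableOn_exp_neg_sum {c : ℝ} (hc : 0 < c) :
    IntegrableOn (fun x : Fin d → ℝ => Real.exp (-c * ∑ i, x i)) (orthant d) := by
  rw [IntegrableOn, volume_restrict_orthant]
  have h : (fun x : Fin d → ℝ => Real.exp (-c * ∑ i, x i)) = fun x => ∏ i, Real.exp (-c * x i) := by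
    funext x
    rw [Finset.mul_sum, Real.exp_sum]
  rw [h]
  exact Integrable.fintype_prod (𝕜 := ℝ) (f := fun _ t => Real.exp (-c * t))
    fun _ => exp_neg_integrableOn_Ioi 0 hc

theorem coord_mul_multiLag_zero (i : Fin d) (n : Fin d → ℕ) (x : Fin d → ℝ) :
    x i * multiLag 0 n x = (2 * (n i : ℝ) + 1) * multiLag 0 n x -
      ((n i : ℝ) + 1) * multiLag 0 (Function.update n i (n i + 1)) x -
      (n i : ℝ) * multiLag 0 (Function.update n i (n i - 1)) x := by
  have hupd : ∀ m, multiLag 0 (Function.update n i m) x =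
      lagFun 0 m (x i) * ∏ l ∈ Finset.univ.erase i, lagFun 0 (n l) (x l) := by
    intro m
    rw [multiLag_zero, ← Finset.mul_prod_erase _ _ (Finset.mem_univ i), Function.update_self]
    congr 1
    exact Finset.prod_congr rfl fun l hl => by rw [Function.update_of_ne (Finset.ne_of_mem_erase hl)]
  have h0 := hupd (n i)
  rw [Function.update_eq_self] at h0
  rw [hupd, hupd, h0]
  linear_combination (∏ l ∈ Finset.univ.erase i, lagFun 0 (n l) (x l)) * lagFun_three_term (n i) (x i)

/-- The linear span of the Laguerre functions. -/
noncomputable def lagSpan (d : ℕ) : Submodule ℂ ((Fin d → ℝ) → ℂ) :=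
  Submodule.span ℂ (range fun (n : Fin d → ℕ) (x : Fin d → ℝ) => (multiLag 0 n x : ℂ))

theorem coord_mul_mem_lagSpan (i : Fin d) {φ : (Fin d → ℝ) → ℂ} (hφ : φ ∈ lagSpan d) :
    (fun x => (x i : ℂ) * φ x) ∈ lagSpan d := by
  induction hφ using Submodule.span_induction with
  | mem φ h =>
    obtain ⟨n, rfl⟩ := h
    have hm : ∀ m : Fin d → ℕ, (fun x => (multiLag 0 m x : ℂ)) ∈ lagSpan d :=
      fun m => Submodule.subset_span ⟨m, rfl⟩
    have e : (fun x : Fin d → ℝ => (x i : ℂ) * (multiLag 0 n x : ℂ)) =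
        (2 * (n i : ℂ) + 1) • (fun x => (multiLag 0 n x : ℂ)) -
        ((n i : ℂ) + 1) • (fun x => (multiLag 0 (Function.update n i (n i + 1)) x : ℂ)) -
        (n i : ℂ) • (fun x => (multiLag 0 (Function.update n i (n i - 1)) x : ℂ)) := by
      funext x
      simp only [Pi.sub_apply, Pi.smul_apply, smul_eq_mul]
      exact_mod_cast congrArg (fun r : ℝ => (r : ℂ)) (coord_mul_multiLag_zero i n x)
    simp only [e]
    exact sub_mem (sub_mem (Submodule.smul_mem _ _ (hm _)) (Submodule.smul_mem _ _ (hm _)))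
      (Submodule.smul_mem _ _ (hm _))
  | zero =>
    have : (fun x : Fin d → ℝ => (x i : ℂ) * (0 : (Fin d → ℝ) → ℂ) x) = 0 := by
      funext x; simp
    rw [this]; exact zero_mem _
  | add φ ψ _ _ h1 h2 =>
    simpa only [Pi.add_apply, mul_add] using! add_mem h1 h2
  | smul c φ _ h1 =>
    have := Submodule.smul_mem (lagSpan d) c h1
    refine (congrArg (· ∈ lagSpan d) (funext fun x => ?_)).mp this
    simp only [Pi.smul_apply, smul_eq_mul]; ring

/-- The Laguerre function with index 0 is e^{-|x|/2}, and the span is stable under multiplication by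
coordinates. Powers of linear forms are the only polynomials that the Fourier argument needs. -/
theorem linear_pow_mem_lagSpan (ξ : Fin d → ℝ) (N : ℕ) :
    (fun x : Fin d → ℝ => ((Real.exp (-(1 / 2) * ∑ i, x i) * (∑ i, ξ i * x i) ^ N : ℝ) : ℂ)) ∈
      lagSpan d := by
  induction N with
  | zero =>
    refine Submodule.subset_span ⟨0, funext fun x => ?_⟩
    simp only [multiLag_zero, Pi.zero_apply, lagFun_zero_right, pow_zero, mul_one]
    rw [Finset.mul_sum, Real.exp_sum]
    congr 1
    exact Finset.prod_congr rfl fun i _ => by congr 1; ring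
  | succ N ih =>
    have h := Submodule.sum_mem (lagSpan d) (t := Finset.univ)
      (f := fun i => (ξ i : ℂ) • fun x : Fin d → ℝ => (x i : ℂ) *
        ((Real.exp (-(1 / 2) * ∑ i, x i) * (∑ i, ξ i * x i) ^ N : ℝ) : ℂ))
      fun i _ => Submodule.smul_mem _ _ (coord_mul_mem_lagSpan i ih)
    refine (congrArg (· ∈ lagSpan d) (funext fun x => ?_)).mp h
    rw [Finset.sum_apply]
    simp only [Pi.smul_apply, smul_eq_mul, ← mul_assoc]
    rw [← Finset.sum_mul, pow_succ]
    push_cast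
    ring

theorem integral_mul_lagSpan_eq_zero (hd : 1 ≤ d) {f : (Fin d → ℝ) → ℂ}
    (hf : f ∈ schwartzOrthant d) (h0 : laguerreCoeff f = 0) {φ : (Fin d → ℝ) → ℂ}
    (hφ : φ ∈ lagSpan d) :
    IntegrableOn (fun x => f x * φ x) (orthant d) ∧ ∫ x in orthant d, f x * φ x = 0 := by
  induction hφ using Submodule.span_induction with
  | mem φ h =>
    obtain ⟨n, rfl⟩ := h
    have e : EqOn (fun t => f t * laguerreFun n t) (fun x => f x * (multiLag 0 n x : ℂ))
        (orthant d) := fun x hx => by simp only [laguerreFun_eq n hx, multiLag_zero]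
    refine ⟨(integrableOn_mul_laguerreFun hd hf n).congr_fun e (measurableSet_orthant d), ?_⟩
    rw [← setIntegral_congr_fun (measurableSet_orthant d) e]
    exact congrFun h0 n
  | zero => simp
  | add φ ψ _ _ h1 h2 =>
    simp only [Pi.add_apply, mul_add]
    exact ⟨h1.1.add h2.1, by rw [integral_add h1.1 h2.1, h1.2, h2.2, add_zero]⟩
  | smul c φ _ h1 =>
    simp only [Pi.smul_apply, smul_eq_mul, mul_left_comm _ c]
    exact ⟨h1.1.const_mul c, by rw [integral_const_mul, h1.2, mul_zero]⟩

/-- The exponential moments `∫ f(x) e^{-|x|/2} (ξ·x)^N e^{i s ξ·x} dx`. -/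
noncomputable def expMoment (f : (Fin d → ℝ) → ℂ) (ξ : Fin d → ℝ) (N : ℕ) (s : ℝ) : ℂ :=
  ∫ x in orthant d, f x * ((Real.exp (-(1 / 2) * ∑ i, x i) * (∑ i, ξ i * x i) ^ N : ℝ) : ℂ) *
    Complex.exp (Complex.I * (s * ∑ i, ξ i * x i : ℝ))

theorem pow_le_factorial_mul_exp {κ y : ℝ} (hκ : 0 < κ) (hy : 0 ≤ y) (N : ℕ) :
    y ^ N ≤ N.factorial * (κ⁻¹ ^ N) * Real.exp (κ * y) := by
  have h := Real.pow_div_factorial_le_exp (κ * y) (by positivity) N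
  rw [div_le_iff₀ (by positivity), mul_pow] at h
  rw [inv_pow]
  have : 0 < κ ^ N := by positivity
  rw [mul_assoc, mul_left_comm, inv_mul_eq_div, le_div_iff₀ this]
  linarith

/-- Expanding e^{i r ξ·x} in its power series writes a moment at s + r as a series of moments at s.
The factor e^{-|x|/2} dominates e^{κ|ξ·x|}, which legitimizes the interchange for |r| ≤ κ. The step
length κ does not depend on s, so the step can be repeated. -/
theorem expMoment_step {f : (Fin d → ℝ) → ℂ} {K κ : ℝ} (hf : ContDiffOn ℝ ∞ f (orthant d))
    (hK : ∀ x ∈ orthant d, ‖f x‖ ≤ K) {ξ : Fin d → ℝ} (hκ : 0 < κ)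
    (hξ : ∀ x ∈ orthant d, κ * |∑ i, ξ i * x i| ≤ 1 / 8 * ∑ i, x i) {s r : ℝ} (hr : |r| ≤ κ)
    (h : ∀ N, expMoment f ξ N s = 0) (N : ℕ) : expMoment f ξ N (s + r) = 0 := by
  set F : ℕ → (Fin d → ℝ) → ℂ := fun m x =>
    (f x * ((Real.exp (-(1 / 2) * ∑ i, x i) * (∑ i, ξ i * x i) ^ (N + m) : ℝ) : ℂ) *
      Complex.exp (Complex.I * (s * ∑ i, ξ i * x i : ℝ))) * ((Complex.I * r) ^ m / m.factorial) with hF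
  set B : ℕ → (Fin d → ℝ) → ℝ := fun m x => K * Real.exp (-(1 / 2) * ∑ i, x i) *
    |∑ i, ξ i * x i| ^ N * ((κ * |∑ i, ξ i * x i|) ^ m / m.factorial) with hB
  have hBsum : ∀ x, HasSum (fun m => B m x) (K * Real.exp (-(1 / 2) * ∑ i, x i) *
      |∑ i, ξ i * x i| ^ N * Real.exp (κ * |∑ i, ξ i * x i|)) := fun x => by
    have := NormedSpace.expSeries_div_hasSum_exp (𝔸 := ℝ) (κ * |∑ i, ξ i * x i|)
    rw [← Real.exp_eq_exp_ℝ] at this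
    exact this.mul_left _
  have hmeas : ∀ m, AEStronglyMeasurable (F m) (volume.restrict (orthant d)) := fun m => by
    refine AEStronglyMeasurable.mul_const (((hf.continuousOn.aestronglyMeasurable
      (measurableSet_orthant d)).mul ?_).mul ?_) _
    · exact Continuous.aestronglyMeasurable (by fun_prop)
    · exact Continuous.aestronglyMeasurable (by fun_prop)
  have hbound : ∀ m, ∀ᵐ x ∂(volume.restrict (orthant d)), ‖F m x‖ ≤ B m x := fun m => by
    refine (ae_restrict_iff' (measurableSet_orthant d)).2 (.of_forall fun x hx => ?_)
    have h1 := hK x hx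
    have hK0 : 0 ≤ K := (norm_nonneg _).trans h1
    have e1 : ‖Complex.exp (Complex.I * (s * ∑ i, ξ i * x i : ℝ))‖ = 1 := by
      rw [mul_comm]; exact Complex.norm_exp_ofReal_mul_I _
    have e2 : ‖(Complex.I * (r : ℂ)) ^ m / (m.factorial : ℂ)‖ = |r| ^ m / m.factorial := by
      simp
    simp only [hF, hB]
    rw [norm_mul, norm_mul, norm_mul, e1, e2, Complex.norm_real, Real.norm_eq_abs, abs_mul,
      Real.abs_exp, abs_pow, mul_one, mul_pow, pow_add]
    calc _ = ‖f x‖ * (Real.exp (-(1 / 2) * ∑ i, x i) * |∑ i, ξ i * x i| ^ N *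
          (|r| ^ m * |∑ i, ξ i * x i| ^ m / m.factorial)) := by ring
      _ ≤ K * (Real.exp (-(1 / 2) * ∑ i, x i) * |∑ i, ξ i * x i| ^ N *
          (κ ^ m * |∑ i, ξ i * x i| ^ m / m.factorial)) := by gcongr
      _ = _ := by ring
  have hBint : Integrable (fun x => ∑' m, B m x) (volume.restrict (orthant d)) := by
    simp only [fun x => (hBsum x).tsum_eq]
    -- The power |ξ·x|^N costs one factor e^{|x|/8} and the exponential series another, leaving
    -- e^{-|x|/4} from e^{-|x|/2}.
    refine Integrable.mono' ((integrableOn_exp_neg_sum (d := d) (c := 1 / 4) (by norm_num)).const_mul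
      (|K| * (N.factorial * (κ⁻¹ ^ N)))) (Continuous.aestronglyMeasurable (by fun_prop)) ?_
    refine (ae_restrict_iff' (measurableSet_orthant d)).2 (.of_forall fun x hx => ?_)
    have h1 := hξ x hx
    have h2 := pow_le_factorial_mul_exp hκ (abs_nonneg (∑ i, ξ i * x i)) N
    rw [norm_mul, norm_mul, norm_mul, Real.norm_eq_abs, Real.norm_eq_abs, Real.norm_eq_abs,
      Real.norm_eq_abs, Real.abs_exp, Real.abs_exp, abs_pow, abs_abs]
    set S := ∑ i, x i
    set y := |∑ i, ξ i * x i|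
    calc |K| * Real.exp (-(1 / 2) * S) * y ^ N * Real.exp (κ * y)
        ≤ |K| * Real.exp (-(1 / 2) * S) * (N.factorial * (κ⁻¹ ^ N) * Real.exp (1 / 8 * S)) *
          Real.exp (1 / 8 * S) := by
          refine mul_le_mul (mul_le_mul_of_nonneg_left (h2.trans ?_) (by positivity))
            (Real.exp_le_exp.2 h1) (by positivity) (by positivity)
          exact mul_le_mul_of_nonneg_left (Real.exp_le_exp.2 h1) (by positivity)
      _ = |K| * (N.factorial * (κ⁻¹ ^ N)) *
          (Real.exp (-(1 / 2) * S) * Real.exp (1 / 8 * S) * Real.exp (1 / 8 * S)) := by ring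
      _ = _ := by
          rw [← Real.exp_add, ← Real.exp_add]
          congr 2; ring
  have key := hasSum_integral_of_dominated_convergence B hmeas hbound
    (.of_forall fun x => (hBsum x).summable) hBint (f := fun x =>
      f x * ((Real.exp (-(1 / 2) * ∑ i, x i) * (∑ i, ξ i * x i) ^ N : ℝ) : ℂ) *
      Complex.exp (Complex.I * ((s + r) * ∑ i, ξ i * x i : ℝ)))
    (.of_forall fun x => by
      have h1 := NormedSpace.expSeries_div_hasSum_exp (𝔸 := ℂ)
        (Complex.I * r * (∑ i, ξ i * x i : ℝ))
      rw [← Complex.exp_eq_exp_ℂ] at h1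
      have h2 := h1.mul_left (f x * ((Real.exp (-(1 / 2) * ∑ i, x i) *
        (∑ i, ξ i * x i) ^ N : ℝ) : ℂ) * Complex.exp (Complex.I * (s * ∑ i, ξ i * x i : ℝ)))
      have e : Complex.exp (Complex.I * ((s + r) * ∑ i, ξ i * x i : ℝ)) =
          Complex.exp (Complex.I * (s * ∑ i, ξ i * x i : ℝ)) *
          Complex.exp (Complex.I * r * (∑ i, ξ i * x i : ℝ)) := by
        rw [← Complex.exp_add]; congr 1; push_cast; ring
      rw [e, ← mul_assoc]
      refine (congrArg (HasSum · _) (funext fun m => ?_)).mpr h2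
      simp only [hF]; push_cast; ring)
  have hz : ∀ m, ∫ x in orthant d, F m x = 0 := fun m => by
    rw [hF, integral_mul_const]
    have := h (N + m)
    rw [expMoment] at this
    rw [this, zero_mul]
  simp only [hz] at key
  exact key.unique hasSum_zero

theorem expMoment_eq_zero (hd : 1 ≤ d) {f : (Fin d → ℝ) → ℂ} (hf : f ∈ schwartzOrthant d)
    (h0 : laguerreCoeff f = 0) (ξ : Fin d → ℝ) (s : ℝ) (N : ℕ) : expMoment f ξ N s = 0 := by
  obtain ⟨K, hK⟩ := (schwartzOrthant_iterBounded hf ⟨0, hd⟩).2 0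
  set Λ : ℝ := 1 + ∑ i, |ξ i| with hΛ
  have hΛ1 : 1 ≤ Λ := by
    have : 0 ≤ ∑ i, |ξ i| := Finset.sum_nonneg fun i _ => abs_nonneg _
    linarith
  have hξ : ∀ x ∈ orthant d, 1 / (8 * Λ) * |∑ i, ξ i * x i| ≤ 1 / 8 * ∑ i, x i := fun x hx => by
    have h1 : |∑ i, ξ i * x i| ≤ Λ * ∑ i, x i := by
      rw [Finset.mul_sum]
      refine (Finset.abs_sum_le_sum_abs _ _).trans (Finset.sum_le_sum fun i _ => ?_)
      rw [abs_mul, abs_of_pos (hx i)]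
      have : |ξ i| ≤ Λ := by
        have := Finset.single_le_sum (f := fun i => |ξ i|) (fun i _ => abs_nonneg _)
          (Finset.mem_univ i)
        linarith
      exact mul_le_mul_of_nonneg_right this (hx i).le
    rw [one_div_mul_eq_div, div_le_iff₀ (by positivity)]
    linarith
  have hzero : ∀ N, expMoment f ξ N 0 = 0 := fun N => by
    have := (integral_mul_lagSpan_eq_zero hd hf h0 (linear_pow_mem_lagSpan ξ N)).2
    simpa [expMoment] using this
  -- The segment from 0 to s is cut into n pieces, each shorter than the admissible step 1/(8Λ).
  obtain ⟨n, hn⟩ := exists_nat_gt (|s| * (8 * Λ))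
  have hn0 : (0 : ℝ) < n := lt_of_le_of_lt (by positivity) hn
  have hstep : ∀ k : ℕ, ∀ N, expMoment f ξ N (k * (s / n)) = 0 := by
    intro k
    induction k with
    | zero => simpa using hzero
    | succ k ih =>
      intro N
      rw [show ((k + 1 : ℕ) : ℝ) * (s / n) = k * (s / n) + s / n by push_cast; ring]
      refine expMoment_step hf.2.1 hK (κ := 1 / (8 * Λ)) (by positivity) hξ ?_ ih N
      rw [abs_div, abs_of_pos hn0, div_le_div_iff₀ hn0 (by positivity)]
      linarith
  have := hstep n N
  rwa [mul_div_cancel₀ _ hn0.ne'] at this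

/-- A function in `S(ℝ^d_+)` with vanishing Laguerre coefficients vanishes. -/
theorem eq_zero_of_laguerreCoeff_eq_zero (hd : 1 ≤ d) {f : (Fin d → ℝ) → ℂ}
    (hf : f ∈ schwartzOrthant d) (h0 : laguerreCoeff f = 0) : f = 0 := by
  obtain ⟨K, hK⟩ := (schwartzOrthant_iterBounded hf ⟨0, hd⟩).2 0
  set h : (Fin d → ℝ) → ℂ := fun x => f x * (Real.exp (-(1 / 2) * ∑ i, x i) : ℂ) with hh
  have hoff : ∀ x, x ∉ orthant d → h x = 0 := fun x hx => by simp [hh, hf.1 x hx]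
  have hint : Integrable h := by
    rw [← integrableOn_iff_integrable_of_support_subset (s := orthant d)
      (fun x hx => by by_contra hx'; exact hx (hoff x hx'))]
    simpa [hh] using integrableOn_mul_of_bounded hf.2.1 hK
      (integrableOn_exp_neg_sum (d := d) (c := 1 / 2) (by norm_num))
  set g : EuclideanSpace ℝ (Fin d) → ℂ := fun v => h v.ofLp with hg
  have hmp := PiLp.volume_preserving_ofLp (Fin d)
  have hme : MeasurableEmbedding (@WithLp.ofLp 2 (Fin d → ℝ)) :=
    (MeasurableEquiv.toLp 2 (Fin d → ℝ)).symm.measurableEmbedding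
  have hgint : Integrable g := (hmp.integrable_comp_emb hme).2 hint
  -- The Fourier transform of f e^{-|x|/2} at w is the moment with ξ = -2πw, N = 0 and s = 1.
  have hF : FourierTransform.fourier g = 0 := by
    funext w
    rw [Real.fourier_eq']
    have e1 : ∫ v : EuclideanSpace ℝ (Fin d), Complex.exp ((-2 * Real.pi * inner ℝ v w : ℝ) * Complex.I) • g v =
        ∫ x : Fin d → ℝ, Complex.exp (Complex.I * ((1 : ℝ) * ∑ i, (-2 * Real.pi * w i) * x i : ℝ)) *
          h x := by
      rw [← hmp.integral_comp hme]
      refine integral_congr_ae (.of_forall fun v => ?_)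
      simp only [smul_eq_mul, hg]
      congr 2
      rw [PiLp.inner_apply, one_mul, mul_comm Complex.I, Finset.mul_sum]
      congr 2
      refine Finset.sum_congr rfl fun i _ => ?_
      simp; ring
    rw [e1, ← setIntegral_eq_integral_of_forall_compl_eq_zero (s := orthant d)
      (fun x hx => by rw [hoff x hx, mul_zero])]
    have := expMoment_eq_zero hd hf h0 (fun i => -2 * Real.pi * w i) 1 0
    rw [expMoment] at this
    rw [Pi.zero_apply, ← this]
    refine setIntegral_congr_fun (measurableSet_orthant d) fun x _ => ?_
    simp only [hh, pow_zero, mul_one]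
    ring
  funext x
  by_cases hx : x ∈ orthant d
  -- Fourier inversion is applied pointwise, at interior points only, since the extension of f by
  -- zero may be discontinuous on the boundary of the orthant.
  · have hc : ContinuousAt g (WithLp.toLp 2 x) := by
      have h1 : ContinuousAt h x := by
        have : ContinuousAt f x := hf.2.1.continuousOn.continuousAt ((isOpen_orthant d).mem_nhds hx)
        exact this.mul (by fun_prop)
      exact ContinuousAt.comp (f := fun v : EuclideanSpace ℝ (Fin d) => v.ofLp) (g := h) h1
        (PiLp.continuous_ofLp 2 _).continuousAt
    have h1 := hgint.fourierInv_fourier_eq (by rw [hF]; exact integrable_zero _ _ _) hc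
    rw [hF, Real.fourierInv_eq] at h1
    simp only [Pi.zero_apply, smul_zero, integral_zero] at h1
    have h2 : f x * (Real.exp (-(1 / 2) * ∑ i, x i) : ℂ) = 0 := h1.symm
    rcases mul_eq_zero.1 h2 with h3 | h3
    · exact h3
    · exact absurd h3 (by exact_mod_cast (Real.exp_pos _).ne')
  · exact hf.1 x hx

end completeness

/-! ### Locally convex inductive limits -/

section inductiveLimit

variable {ι E : Type*} [AddCommGroup E] [Module ℂ E] {X : ι → Type*} [∀ i, AddCommGroup (X i)]
  [∀ i, Module ℂ (X i)] [∀ i, TopologicalSpace (X i)] (j : ∀ i, X i →ₗ[ℂ] E)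

theorem isTopologicalAddGroup_lcIndTopology : @IsTopologicalAddGroup E (lcIndTopology j) _ :=
  topologicalAddGroup_sInf fun _ ht => ht.1

theorem continuousSMul_lcIndTopology : @ContinuousSMul ℂ E _ _ (lcIndTopology j) :=
  continuousSMul_sInf fun _ ht => ht.2.1

theorem locallyConvexSpace_lcIndTopology : @LocallyConvexSpace ℝ E _ _ _ _ (lcIndTopology j) :=
  .sInf fun _ ht => ht.2.2.1

theorem continuous_lcIndTopology (i : ι) : @Continuous (X i) E _ (lcIndTopology j) (j i) :=
  continuous_sInf_rng.2 fun _ ht => ht.2.2.2 i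

variable {j}

/-- Universal property: the topology induced by `T` is itself a locally convex topology for which
all the maps `j i` are continuous, so the inductive limit topology is finer. -/
theorem continuous_of_lcIndTopology {F : Type*} [AddCommGroup F] [Module ℂ F]
    [TopologicalSpace F] [IsTopologicalAddGroup F] [ContinuousSMul ℂ F] [LocallyConvexSpace ℝ F]
    (T : E →ₗ[ℂ] F) (h : ∀ i, Continuous fun x => T (j i x)) :
    @Continuous E F (lcIndTopology j) _ T := by
  rw [continuous_iff_le_induced]
  exact sInf_le ⟨topologicalAddGroup_induced T, continuousSMul_induced T,
    .induced (T.restrictScalars ℝ), fun i => continuous_induced_rng.2 (h i)⟩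

theorem continuous_seminorm_of_lcIndTopology [∀ i, IsTopologicalAddGroup (X i)] (p : Seminorm ℂ E)
    (h : ∀ i, Continuous fun x => p (j i x)) : @Continuous E ℝ (lcIndTopology j) _ p := by
  let T : E →ₗ[ℂ] SeminormedBy p :=
    { toFun := fun x => x, map_add' := fun _ _ => rfl, map_smul' := fun _ _ => rfl }
  have hT : @Continuous E (SeminormedBy p) (lcIndTopology j) _ T := by
    refine continuous_of_lcIndTopology T fun i => ?_
    refine continuous_of_continuousAt_zero (T ∘ₗ j i) ?_
    rw [ContinuousAt, map_zero, tendsto_zero_iff_norm_tendsto_zero]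
    have := (h i).tendsto 0
    rwa [map_zero, map_zero] at this
  exact @Continuous.comp E (SeminormedBy p) ℝ (lcIndTopology j) _ _ _ _ continuous_norm hT

end inductiveLimit

theorem continuous_seminorm_of_le {E : Type*} [AddCommGroup E] [Module ℂ E] [TopologicalSpace E]
    [IsTopologicalAddGroup E] {p q : Seminorm ℂ E} (hq : Continuous q) (C : ℝ)
    (h : ∀ x, p x ≤ C * q x) : Continuous p := by
  have : ContinuousAt p 0 := by
    rw [ContinuousAt, map_zero]
    refine squeeze_zero (fun x => apply_nonneg p x) h ?_
    have := (hq.tendsto 0).const_mul C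
    rwa [map_zero, mul_zero] at this
  exact Seminorm.continuous_of_continuousAt_zero this

theorem toReal_le_of_le_mul {x y : ℝ≥0∞} {C : ℝ≥0} (hy : y < ⊤) (h : x ≤ C * y) :
    x.toReal ≤ C * y.toReal := by
  have := ENNReal.toReal_mono (ENNReal.mul_ne_top ENNReal.coe_ne_top hy.ne) h
  rwa [ENNReal.toReal_mul, ENNReal.coe_toReal] at this

/-! ### The topologies of the step spaces -/

section steps

variable {d : ℕ} {α : ℝ}

theorem withSeminorms_seqStep (a : Ioi (1 : ℝ)) :
    WithSeminorms (fun _ : Unit => seqStepNorm d α a) := ⟨rfl⟩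

theorem withSeminorms_gsStep (β : ℝ) (A : Ioi (0 : ℝ)) :
    WithSeminorms (fun j : ℕ => gsSeminorm d α β A j) := ⟨rfl⟩

instance (a : Ioi (1 : ℝ)) : IsTopologicalAddGroup (SeqStep d α a) :=
  (withSeminorms_seqStep a).topologicalAddGroup

instance : IsTopologicalAddGroup (SeqSpace d α) := isTopologicalAddGroup_lcIndTopology _

instance : ContinuousSMul ℂ (SeqSpace d α) := continuousSMul_lcIndTopology _

instance : LocallyConvexSpace ℝ (SeqSpace d α) := locallyConvexSpace_lcIndTopology _

instance (β : ℝ) : IsTopologicalAddGroup (GSSpace d α β) := isTopologicalAddGroup_lcIndTopology _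

instance (β : ℝ) : ContinuousSMul ℂ (GSSpace d α β) := continuousSMul_lcIndTopology _

instance (β : ℝ) : LocallyConvexSpace ℝ (GSSpace d α β) := locallyConvexSpace_lcIndTopology _

theorem continuous_seqStepNorm (a : Ioi (1 : ℝ)) : Continuous (seqStepNorm d α a) :=
  (withSeminorms_seqStep a).continuous_seminorm ()

theorem seqStepNorm_apply (a : Ioi (1 : ℝ)) (u : SeqStep d α a) :
    seqStepNorm d α a u = (seqNorm d α a u.1).toReal := rfl

theorem gsSeminorm_apply (β : ℝ) (A : Ioi (0 : ℝ)) (j : ℕ) (f : GSStep d α β A) :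
    gsSeminorm d α β A j f = (gsNorm α β A f.1).toReal + (supNormUpTo j f.1).toReal := rfl

/-! ### The isomorphism of the function space with the sequence space -/

theorem laguerreCoeff_add (hd : 1 ≤ d) {f g : (Fin d → ℝ) → ℂ} (hf : f ∈ schwartzOrthant d)
    (hg : g ∈ schwartzOrthant d) :
    laguerreCoeff (f + g) = laguerreCoeff f + laguerreCoeff g := by
  funext n
  simp only [laguerreCoeff, Pi.add_apply, add_mul]
  exact integral_add (integrableOn_mul_laguerreFun hd hf n) (integrableOn_mul_laguerreFun hd hg n)

theorem laguerreCoeff_smul (c : ℂ) (f : (Fin d → ℝ) → ℂ) :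
    laguerreCoeff (c • f) = c • laguerreCoeff f := by
  funext n
  simp only [laguerreCoeff, Pi.smul_apply, smul_eq_mul, mul_assoc]
  exact integral_const_mul c _

theorem GSSpace.mem_schwartzOrthant {β : ℝ} (f : GSSpace d α β) : f.1 ∈ schwartzOrthant d := by
  obtain ⟨A, -, hf⟩ := f.2
  exact hf.1

theorem laguerreCoeff_mem_seqSubmodule (hd : 1 ≤ d) (hα : 1 ≤ α) (f : GSSpace d α α) :
    laguerreCoeff f.1 ∈ seqSubmodule d α := by
  obtain ⟨A, hA, hf⟩ := f.2
  obtain ⟨a, ha, h⟩ := exists_seqNorm_laguerreCoeff_le (d := d) hd hα hA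
  exact ⟨a, ha, (h _ hf).trans_lt (ENNReal.mul_lt_top (by simp) hf.2)⟩

theorem laguerreSeries_mem_gsSubmodule (hd : 1 ≤ d) (hα : 1 ≤ α) (u : SeqSpace d α) :
    laguerreSeries u.1 ∈ gsSubmodule d α α := by
  obtain ⟨a, ha, hu⟩ := u.2
  obtain ⟨A, hA, C, h⟩ := exists_gsNorm_laguerreSeries_le (d := d) hd hα ha
  exact ⟨A, hA, laguerreSeries_mem_schwartzOrthant hα ha hu,
    (h _ hu).trans_lt (ENNReal.mul_lt_top (by simp) hu)⟩

theorem laguerreCoeff_laguerreSeries_seqSpace (hα : 1 ≤ α) (u : SeqSpace d α) :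
    laguerreCoeff (laguerreSeries u.1) = u.1 := by
  obtain ⟨a, ha, hu⟩ := u.2
  exact laguerreCoeff_laguerreSeries hα ha hu

/-- The difference of the two functions lies in S(ℝ^d_+) and has zero coefficients, so completeness
applies. -/
theorem laguerreSeries_laguerreCoeff (hd : 1 ≤ d) (hα : 1 ≤ α) (f : GSSpace d α α) :
    laguerreSeries (laguerreCoeff f.1) = f.1 := by
  have hs := GSSpace.mem_schwartzOrthant (⟨_, laguerreSeries_mem_gsSubmodule hd hα
    ⟨_, laguerreCoeff_mem_seqSubmodule hd hα f⟩⟩ : GSSpace d α α)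
  have h := laguerreCoeff_laguerreSeries_seqSpace hα
    ⟨_, laguerreCoeff_mem_seqSubmodule hd hα f⟩
  rw [← sub_eq_zero]
  refine eq_zero_of_laguerreCoeff_eq_zero hd (sub_mem hs f.mem_schwartzOrthant) ?_
  rw [sub_eq_add_neg, ← neg_one_smul ℂ f.1, laguerreCoeff_add hd hs
    (Submodule.smul_mem _ _ f.mem_schwartzOrthant), laguerreCoeff_smul, h]
  simp

/-- The Laguerre coefficients as a linear isomorphism of `G^α_α(ℝ^d_+)` onto `s^α`. -/
noncomputable def coeffLinearEquiv (hd : 1 ≤ d) (hα : 1 ≤ α) :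
    GSSpace d α α ≃ₗ[ℂ] SeqSpace d α where
  toFun f := ⟨laguerreCoeff f.1, laguerreCoeff_mem_seqSubmodule hd hα f⟩
  map_add' f g := Subtype.ext (laguerreCoeff_add hd f.mem_schwartzOrthant g.mem_schwartzOrthant)
  map_smul' c f := Subtype.ext (laguerreCoeff_smul c f.1)
  invFun u := ⟨laguerreSeries u.1, laguerreSeries_mem_gsSubmodule hd hα u⟩
  left_inv f := Subtype.ext (laguerreSeries_laguerreCoeff hd hα f)
  right_inv u := Subtype.ext (laguerreCoeff_laguerreSeries_seqSpace hα u)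

/-- By the universal property only the restrictions to steps matter, and the decay estimate sends
the whole step of index A boundedly into one step s^{α,a} with a depending on A alone. -/
theorem continuous_coeffLinearEquiv (hd : 1 ≤ d) (hα : 1 ≤ α) :
    Continuous (coeffLinearEquiv hd hα) := by
  refine continuous_of_lcIndTopology (coeffLinearEquiv hd hα).toLinearMap fun A => ?_
  obtain ⟨a, ha, h⟩ := exists_seqNorm_laguerreCoeff_le (d := d) hd hα A.2
  let T : GSStep d α α A →ₗ[ℂ] SeqStep d α ⟨a, ha⟩ :=
    { toFun := fun f => ⟨laguerreCoeff f.1,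
        (h _ f.2).trans_lt (ENNReal.mul_lt_top (by simp) f.2.2)⟩
      map_add' := fun f g => Subtype.ext (laguerreCoeff_add hd f.2.1 g.2.1)
      map_smul' := fun c f => Subtype.ext (laguerreCoeff_smul c f.1) }
  have hT : Continuous T := by
    refine (withSeminorms_gsStep α A).continuous_of_isBounded (withSeminorms_seqStep _)
      _ (Seminorm.IsBounded.of_real fun _ => ⟨{0}, 2, fun f => ?_⟩)
    rw [Finset.sup_singleton, seqStepNorm_apply, gsSeminorm_apply]
    have h1 := toReal_le_of_le_mul (C := 2) f.2.2 (h _ f.2)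
    have h2 : 0 ≤ (supNormUpTo 0 f.1).toReal := ENNReal.toReal_nonneg
    refine h1.trans ?_
    simp only [NNReal.coe_ofNat]
    linarith
  exact (continuous_lcIndTopology (seqIncl d α) ⟨a, ha⟩).comp hT

theorem exists_supNormUpTo_laguerreSeries_le (hα : 1 ≤ α) {a : ℝ} (ha : 1 < a) (j : ℕ) :
    ∃ C : ℝ≥0, ∀ u ∈ seqStepSubmodule d α a,
      supNormUpTo j (laguerreSeries u) ≤ C * seqNorm d α a u := by
  choose C hC using fun p k : Fin d → ℕ =>
    exists_supNorm_laguerreSeries_le (d := d) (α := α) hα ha p k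
  set J := Finset.Iic (fun _ : Fin d => j)
  have hmem : ∀ p : Fin d → ℕ, ∑ i, p i ≤ j → p ∈ J := fun p hp => Finset.mem_Iic.2 fun i =>
    (Finset.single_le_sum (f := p) (fun _ _ => Nat.zero_le _) (Finset.mem_univ i)).trans hp
  refine ⟨J.sup fun p => J.sup fun k => C p k, fun u hu =>
    iSup₂_le fun p k => iSup₂_le fun hp hk => (hC p k u hu).trans ?_⟩
  gcongr
  exact (Finset.le_sup (f := fun k => C p k) (hmem k hk)).trans
    (Finset.le_sup (f := fun p => J.sup fun k => C p k) (hmem p hp))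

theorem continuous_coeffLinearEquiv_symm (hd : 1 ≤ d) (hα : 1 ≤ α) :
    Continuous (coeffLinearEquiv hd hα).symm := by
  refine continuous_of_lcIndTopology (coeffLinearEquiv hd hα).symm.toLinearMap fun a => ?_
  obtain ⟨A, hA, C, h⟩ := exists_gsNorm_laguerreSeries_le (d := d) hd hα a.2
  have hval : ∀ u : SeqStep d α a, ((coeffLinearEquiv hd hα).symm (seqIncl d α a u)).1 =
    laguerreSeries u.1 := fun _ => rfl
  let T : SeqStep d α a →ₗ[ℂ] GSStep d α α ⟨A, hA⟩ :=
    { toFun := fun u => ⟨laguerreSeries u.1, laguerreSeries_mem_schwartzOrthant hα a.2 u.2,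
        (h _ u.2).trans_lt (ENNReal.mul_lt_top (by simp) u.2)⟩
      map_add' := fun u v => Subtype.ext <| by
        have := congrArg Subtype.val (map_add ((coeffLinearEquiv hd hα).symm.toLinearMap ∘ₗ
          seqIncl d α a) u v)
        exact this
      map_smul' := fun c u => Subtype.ext <| by
        have := congrArg Subtype.val (map_smul ((coeffLinearEquiv hd hα).symm.toLinearMap ∘ₗ
          seqIncl d α a) c u)
        exact this }
  have hT : Continuous T := by
    refine (withSeminorms_seqStep a).continuous_of_isBounded (withSeminorms_gsStep α _)
      _ (Seminorm.IsBounded.of_real fun j => ?_)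
    obtain ⟨C', h'⟩ := exists_supNormUpTo_laguerreSeries_le (d := d) hα a.2 j
    refine ⟨{()}, C + C', fun u => ?_⟩
    rw [Finset.sup_singleton, seqStepNorm_apply, gsSeminorm_apply, add_mul]
    exact add_le_add (toReal_le_of_le_mul u.2 (h _ u.2)) (toReal_le_of_le_mul u.2 (h' _ u.2))
  exact (continuous_lcIndTopology (gsIncl d α α) ⟨A, hA⟩).comp hT

/-- The Laguerre coefficients as a topological isomorphism of `G^α_α(ℝ^d_+)` onto `s^α`. -/
noncomputable def coeffEquiv (hd : 1 ≤ d) (hα : 1 ≤ α) : GSSpace d α α ≃L[ℂ] SeqSpace d α :=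
  { coeffLinearEquiv hd hα with
    continuous_toFun := continuous_coeffLinearEquiv hd hα
    continuous_invFun := continuous_coeffLinearEquiv_symm hd hα }

end steps

/-! ### The unit vectors and the continuous seminorms of the sequence space -/

section sequences

variable {d : ℕ} {α a b : ℝ} {u : (Fin d → ℕ) → ℂ}

theorem norm_mul_rpow_le_seqNorm (ha : 0 < a) (hu : seqNorm d α a u < ⊤) (n : Fin d → ℕ) :
    ‖u n‖ * a ^ rho α n ≤ (seqNorm d α a u).toReal := by
  have h : ‖u n‖ₑ * ENNReal.ofReal (a ^ rho α n) ≤ seqNorm d α a u :=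
    le_iSup (fun n : Fin d → ℕ => ‖u n‖ₑ * ENNReal.ofReal (a ^ rho α n)) n
  have h1 := ENNReal.toReal_mono (LT.lt.ne hu) h
  rwa [ENNReal.toReal_mul, toReal_enorm, ENNReal.toReal_ofReal (by positivity)] at h1

theorem seqNorm_le_ofReal {K : ℝ} (h : ∀ n, ‖u n‖ * a ^ rho α n ≤ K) :
    seqNorm d α a u ≤ ENNReal.ofReal K := by
  refine iSup_le fun n => ?_
  rw [← ofReal_norm, ← ENNReal.ofReal_mul (norm_nonneg _)]
  exact ENNReal.ofReal_le_ofReal (h n)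

theorem seqNorm_lt_top_of_le {K : ℝ} (h : ∀ n, ‖u n‖ * a ^ rho α n ≤ K) :
    seqNorm d α a u < ⊤ := (seqNorm_le_ofReal h).trans_lt ENNReal.ofReal_lt_top

theorem toReal_seqNorm_le {K : ℝ} (hK : 0 ≤ K) (h : ∀ n, ‖u n‖ * a ^ rho α n ≤ K) :
    (seqNorm d α a u).toReal ≤ K :=
  ENNReal.toReal_le_of_le_ofReal hK (seqNorm_le_ofReal h)

theorem toReal_seqNorm_single (ha : 0 < a) (n : Fin d → ℕ) :
    (seqNorm d α a (Pi.single n 1)).toReal ≤ a ^ rho α n := by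
  refine toReal_seqNorm_le (by positivity) fun m => ?_
  by_cases h : m = n
  · subst h; simp
  · simp only [Pi.single_eq_of_ne h, norm_zero, zero_mul]; positivity

variable (α) in
/-- The unit vectors of the sequence space. -/
def unitVec (n : Fin d → ℕ) : SeqSpace d α :=
  ⟨Pi.single n 1, 2, one_lt_two, seqNorm_single_lt_top n 1⟩

/-- In the sup norm of s^{α,a} the partial sums need not converge. In the larger step with b = √a
they do, since |u_n| b^{|n|^{1/α}} is at most a constant times b^{-|n|^{1/α}}, which tends to zero.
-/
theorem hasSum_unitVec (hα : 1 ≤ α) (u : SeqSpace d α) :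
    HasSum (fun n => u.1 n • unitVec α n) u := by
  obtain ⟨a, ha, hu⟩ := u.2
  have ha0 : 0 < a := by linarith
  set b : ℝ := √a
  have hb1 : 1 < b := by rw [Real.lt_sqrt one_pos.le]; simpa using ha
  have hb0 : 0 < b := by linarith
  have hab : a = b * b := (Real.mul_self_sqrt ha0.le).symm
  have hbd : ∀ n, ‖u.1 n‖ * b ^ rho α n ≤ (seqNorm d α a u.1).toReal * b⁻¹ ^ rho α n := fun n => by
    have h := norm_mul_rpow_le_seqNorm ha0 hu n
    rw [hab, Real.mul_rpow hb0.le hb0.le, ← mul_assoc] at h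
    rw [Real.inv_rpow hb0.le, ← div_eq_mul_inv, le_div_iff₀ (by positivity)]
    rwa [hab]
  have hub : seqNorm d α b u.1 < ⊤ := seqNorm_lt_top_of_le
    (K := (seqNorm d α a u.1).toReal * 1) fun n => (hbd n).trans <| mul_le_mul_of_nonneg_left
      (Real.rpow_le_one (by positivity) (inv_le_one_of_one_le₀ hb1.le) (rho_nonneg _ _))
      ENNReal.toReal_nonneg
  let v : SeqStep d α ⟨b, hb1⟩ := ⟨u.1, hub⟩
  let e : (Fin d → ℕ) → SeqStep d α ⟨b, hb1⟩ := fun n => ⟨Pi.single n 1, seqNorm_single_lt_top n 1⟩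
  have hv : HasSum (fun n => u.1 n • e n) v := by
    refine ((withSeminorms_seqStep _).tendsto_nhds _ _).2 fun _ ε hε => ?_
    have hs : Summable fun n : Fin d → ℕ => ‖u.1 n‖ * b ^ rho α n :=
      Summable.of_nonneg_of_le (fun n => by positivity) hbd
        ((summable_rpow_rho hα (by positivity) (inv_lt_one_of_one_lt₀ hb1)).mul_left _)
    have hfin : {n | ¬ ‖u.1 n‖ * b ^ rho α n < ε / 2}.Finite :=
      hs.tendsto_cofinite_zero.eventually (gt_mem_nhds (half_pos hε))
    rw [SummationFilter.unconditional_filter, eventually_atTop]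
    refine ⟨hfin.toFinset, fun s hs => ?_⟩
    rw [seqStepNorm_apply]
    refine (toReal_seqNorm_le (half_pos hε).le fun n => ?_).trans_lt (half_lt_self hε)
    have hval : ((∑ m ∈ s, u.1 m • e m) - v).1 n = (if n ∈ s then u.1 n else 0) - u.1 n := by
      have : ((∑ m ∈ s, u.1 m • e m) - v).1 = (∑ m ∈ s, u.1 m • (Pi.single m 1)) - u.1 := by
        have := map_sum (seqStepSubmodule d α b).subtype (fun m => u.1 m • e m) s
        exact congrArg (· - u.1) this
      rw [this]
      simp [Pi.single_apply]
    rw [hval]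
    split_ifs with hn
    · simpa using (half_pos hε).le
    · have : n ∉ hfin.toFinset := fun h => hn (hs h)
      simp only [Finite.mem_toFinset, mem_ofPred_eq, not_not] at this
      simpa using this.le
  exact (hv.map (seqIncl d α ⟨b, hb1⟩) (continuous_lcIndTopology (seqIncl d α) ⟨b, hb1⟩) :)

/-- Non-negative weights growing more slowly than all `a^{|n|^{1/α}}`, `a > 1`. -/
def IsWeight (α : ℝ) (w : (Fin d → ℕ) → ℝ) : Prop :=
  (∀ n, 0 ≤ w n) ∧ ∀ a : ℝ, 1 < a → ∃ C : ℝ, ∀ n, w n ≤ C * a ^ rho α n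

theorem IsWeight.exists_le {w : (Fin d → ℕ) → ℝ} (hw : IsWeight α w) (ha : 1 < a) :
    ∃ C : ℝ, 0 ≤ C ∧ ∀ n, w n ≤ C * a ^ rho α n := by
  obtain ⟨C, hC⟩ := hw.2 a ha
  exact ⟨max C 0, le_max_right _ _, fun n => (hC n).trans
    (mul_le_mul_of_nonneg_right (le_max_left _ _) (by have : 0 < a := by linarith
                                                      positivity))⟩

theorem IsWeight.mul {v w : (Fin d → ℕ) → ℝ} (hv : IsWeight α v) (hw : IsWeight α w) :
    IsWeight α fun n => v n * w n := by
  refine ⟨fun n => mul_nonneg (hv.1 n) (hw.1 n), fun a ha => ?_⟩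
  have h1 : 1 < √a := by rw [Real.lt_sqrt one_pos.le]; simpa using ha
  obtain ⟨C, hC, h⟩ := hv.exists_le h1
  obtain ⟨C', hC', h'⟩ := hw.exists_le h1
  refine ⟨C * C', fun n => (mul_le_mul (h n) (h' n) (hw.1 n) (by positivity)).trans_eq ?_⟩
  conv_rhs => rw [← Real.mul_self_sqrt (show 0 ≤ a by linarith),
    Real.mul_rpow (by positivity) (by positivity)]
  ring

theorem IsWeight.add_const {w : (Fin d → ℕ) → ℝ} (hw : IsWeight α w) {c : ℝ} (hc : 0 ≤ c) :
    IsWeight α fun n => w n + c := by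
  refine ⟨fun n => add_nonneg (hw.1 n) hc, fun a ha => ?_⟩
  obtain ⟨C, hC, h⟩ := hw.exists_le ha
  refine ⟨C + c, fun n => ?_⟩
  rw [add_mul]
  exact add_le_add (h n) (le_mul_of_one_le_right hc (Real.one_le_rpow ha.le (rho_nonneg _ _)))

theorem isWeight_pow (hα : 1 ≤ α) (R : ℕ) :
    IsWeight (d := d) α fun n => (((∑ i, n i : ℕ) : ℝ) + 1) ^ R := by
  refine ⟨fun n => by positivity, fun a ha => ?_⟩
  have ha0 : 0 < a := by linarith
  obtain ⟨C, hC, h⟩ := exists_pow_mul_rpow_le hα (inv_pos.2 ha0) (inv_lt_one_of_one_lt₀ ha) R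
  refine ⟨C, fun n => ?_⟩
  have := h (∑ i, n i)
  rw [Real.inv_rpow ha0.le, ← div_eq_mul_inv, div_le_iff₀ (by positivity)] at this
  exact this

/-- With a = b², one factor b^{|n|^{1/α}} dominates the weight and the other provides summability.
Weighted ℓ¹ seminorms are therefore continuous on every step. -/
theorem IsWeight.exists_tsum_le (hα : 1 ≤ α) {w : (Fin d → ℕ) → ℝ} (hw : IsWeight α w)
    (ha : 1 < a) : ∃ C : ℝ, ∀ u : (Fin d → ℕ) → ℂ, seqNorm d α a u < ⊤ →
      Summable (fun n => w n * ‖u n‖) ∧ ∑' n, w n * ‖u n‖ ≤ C * (seqNorm d α a u).toReal := by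
  have ha0 : 0 < a := by linarith
  set b : ℝ := √a
  have hb1 : 1 < b := by rw [Real.lt_sqrt one_pos.le]; simpa using ha
  have hb0 : 0 < b := by linarith
  have hab : a = b * b := (Real.mul_self_sqrt ha0.le).symm
  obtain ⟨C, hC, h⟩ := hw.exists_le hb1
  have hs := summable_rpow_rho (d := d) hα (q := b⁻¹) (by positivity) (inv_lt_one_of_one_lt₀ hb1)
  refine ⟨C * ∑' n : Fin d → ℕ, b⁻¹ ^ rho α n, fun u hu => ?_⟩
  have hbd : ∀ n, w n * ‖u n‖ ≤ C * (seqNorm d α a u).toReal * b⁻¹ ^ rho α n := fun n => by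
    have h1 := norm_mul_rpow_le_seqNorm ha0 hu n
    rw [Real.inv_rpow hb0.le, ← div_eq_mul_inv, le_div_iff₀ (by positivity)]
    calc w n * ‖u n‖ * b ^ rho α n ≤ C * b ^ rho α n * ‖u n‖ * b ^ rho α n := by
          gcongr; exact h n
      _ = C * (‖u n‖ * a ^ rho α n) := by
          rw [hab, Real.mul_rpow hb0.le hb0.le]; ring
      _ ≤ _ := by gcongr
  have hsum := Summable.of_nonneg_of_le (fun n => mul_nonneg (hw.1 n) (norm_nonneg _)) hbd
    (hs.mul_left _)
  refine ⟨hsum, (hsum.tsum_le_tsum hbd (hs.mul_left _)).trans_eq ?_⟩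
  rw [tsum_mul_left]; ring

theorem IsWeight.summable (hα : 1 ≤ α) {w : (Fin d → ℕ) → ℝ} (hw : IsWeight α w)
    (u : SeqSpace d α) : Summable fun n => w n * ‖u.1 n‖ := by
  obtain ⟨a, ha, hu⟩ := u.2
  obtain ⟨C, h⟩ := hw.exists_tsum_le hα ha
  exact (h _ hu).1

/-- The seminorm `∑ w_n |u_n|` of the sequence space. -/
noncomputable def weightSeminorm (hα : 1 ≤ α) {w : (Fin d → ℕ) → ℝ} (hw : IsWeight α w) :
    Seminorm ℂ (SeqSpace d α) :=
  Seminorm.ofSMulLE (fun u => ∑' n, w n * ‖u.1 n‖)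
    (by
      have : ∀ n, (0 : SeqSpace d α).1 n = 0 := fun _ => rfl
      simp [this])
    (fun u v => by
      rw [← (hw.summable hα u).tsum_add (hw.summable hα v)]
      refine (hw.summable hα (u + v)).tsum_le_tsum (fun n => ?_)
        ((hw.summable hα u).add (hw.summable hα v))
      rw [← mul_add]
      exact mul_le_mul_of_nonneg_left (norm_add_le (u.1 n) (v.1 n)) (hw.1 n))
    (fun c u => by
      rw [← tsum_mul_left]
      refine (tsum_congr fun n => ?_).le
      have : (c • u).1 n = c * u.1 n := rfl
      rw [this, norm_mul]; ring)

theorem mul_norm_le_weightSeminorm (hα : 1 ≤ α) {w : (Fin d → ℕ) → ℝ} (hw : IsWeight α w)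
    (u : SeqSpace d α) (n : Fin d → ℕ) : w n * ‖u.1 n‖ ≤ weightSeminorm hα hw u :=
  (hw.summable hα u).le_tsum n fun m _ => mul_nonneg (hw.1 m) (norm_nonneg _)

theorem continuous_weightSeminorm (hα : 1 ≤ α) {w : (Fin d → ℕ) → ℝ} (hw : IsWeight α w) :
    Continuous (weightSeminorm hα hw) := by
  refine continuous_seminorm_of_lcIndTopology _ fun a => ?_
  obtain ⟨C, h⟩ := hw.exists_tsum_le hα a.2
  exact continuous_seminorm_of_le (p := (weightSeminorm hα hw).comp (seqIncl d α a))
    (continuous_seqStepNorm a) C fun u => (h u.1 u.2).2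

/-- A continuous seminorm is bounded by a multiple of the norm on every step, and the n-th unit
vector has norm at most a^{|n|^{1/α}} in s^{α,a}. -/
theorem isWeight_seminorm {p : Seminorm ℂ (SeqSpace d α)} (hp : Continuous p) :
    IsWeight α fun n => p (unitVec α n) := by
  refine ⟨fun n => apply_nonneg p _, fun a ha => ?_⟩
  have hc : Continuous (p.comp (seqIncl d α ⟨a, ha⟩)) :=
    hp.comp (continuous_lcIndTopology (seqIncl d α) ⟨a, ha⟩)
  obtain ⟨s, C, -, h⟩ := Seminorm.bound_of_continuous (withSeminorms_seqStep ⟨a, ha⟩) _ hc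
  have h0 : s.sup (fun _ : Unit => seqStepNorm d α ⟨a, ha⟩) ≤ seqStepNorm d α ⟨a, ha⟩ :=
    Finset.sup_le fun _ _ => le_rfl
  refine ⟨C, fun n => (h ⟨Pi.single n 1, seqNorm_single_lt_top n 1⟩).trans ?_⟩
  exact mul_le_mul_of_nonneg_left ((h0 _).trans (toReal_seqNorm_single (by linarith) n)) C.2

/-- Apply p to the unit vector expansion. Hence the seminorms Σ w_n |u_n| form a fundamental system
of continuous seminorms. -/
theorem seminorm_le_weightSeminorm (hα : 1 ≤ α) {p : Seminorm ℂ (SeqSpace d α)}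
    (hp : Continuous p) : p ≤ weightSeminorm hα (isWeight_seminorm hp) := fun u => by
  have h := (hasSum_unitVec hα u)
  have h1 : Tendsto (fun s : Finset (Fin d → ℕ) => p (∑ n ∈ s, u.1 n • unitVec α n)) atTop
      (𝓝 (p u)) := (hp.tendsto u).comp h
  refine le_of_tendsto' h1 fun s => ?_
  refine (Finset.le_sum_of_subadditive p (map_zero p).le (map_add_le_add p) s _).trans ?_
  simp only [map_smul_eq_mul]
  simp only [mul_comm ‖_‖]
  exact ((isWeight_seminorm hp).summable hα u).sum_le_tsum s
    fun n _ => mul_nonneg (apply_nonneg p _) (norm_nonneg _)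

end sequences

/-! ### Nuclearity of spaces with a rapidly converging basis -/

section nuclear

variable {E : Type*} [AddCommGroup E] [Module ℂ E]

/-- The canonical map of `E` into a local Banach space. -/
noncomputable def toLocalBanach (p : Seminorm ℂ E) : E →ₗ[ℂ] LocalBanach p where
  toFun x := ((show SeminormedBy p from x : SeminormedBy p) : UniformSpace.Completion (SeminormedBy p))
  map_add' x y := UniformSpace.Completion.coe_add (α := SeminormedBy p) x y
  map_smul' c x := UniformSpace.Completion.coe_smul (X := SeminormedBy p) c x

theorem norm_toLocalBanach (p : Seminorm ℂ E) (x : E) : ‖toLocalBanach p x‖ = p x :=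
  UniformSpace.Completion.norm_coe (E := SeminormedBy p) x

theorem denseRange_toLocalBanach (p : Seminorm ℂ E) : DenseRange (toLocalBanach p) :=
  UniformSpace.Completion.denseRange_coe (α := SeminormedBy p)

theorem localMap_toLocalBanach {p q : Seminorm ℂ E} (h : p ≤ q) (x : E) :
    localMap h (toLocalBanach q x) = toLocalBanach p x :=
  ContinuousLinearMap.completion_apply_coe (α := SeminormedBy q) (β := SeminormedBy p) _ x

variable [TopologicalSpace E] [IsTopologicalAddGroup E]

theorem continuous_toLocalBanach {p : Seminorm ℂ E} (hp : Continuous p) :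
    Continuous (toLocalBanach p) := by
  refine continuous_of_continuousAt_zero (toLocalBanach p) ?_
  rw [ContinuousAt, map_zero, tendsto_zero_iff_norm_tendsto_zero]
  simp only [norm_toLocalBanach]
  have := hp.tendsto 0
  rwa [map_zero] at this

/-- The expansion in the vectors e_n is itself the nuclear representation: coordinates bounded by q
extend to the local Banach space of q, and Σ ‖c_n‖ ‖e_n‖ converges with the respective norms of q
and p. The two operators agree because they agree on the dense image of E. -/
theorem isNuclearMap_localMap {κ : Type*} [Countable κ] [Infinite κ] {e : κ → E}
    {c : κ → E →ₗ[ℂ] ℂ} (hsum : ∀ u, HasSum (fun n => c n u • e n) u) {p q : Seminorm ℂ E}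
    (hp : Continuous p) (h : p ≤ q) {M : κ → ℝ} (hM : ∀ n, 0 ≤ M n)
    (hc : ∀ n u, ‖c n u‖ ≤ M n * q u) (hs : Summable fun n => M n * p (e n)) :
    IsNuclearMap (localMap h) := by
  have hd := denseRange_toLocalBanach q
  have hc' : ∀ n u, ‖c n u‖ ≤ M n * ‖toLocalBanach q u‖ := fun n u => by
    rw [norm_toLocalBanach]; exact hc n u
  set f : κ → StrongDual ℂ (LocalBanach q) := fun n => (c n).extendOfNorm (toLocalBanach q) with hf
  set y : κ → LocalBanach p := fun n => toLocalBanach p (e n) with hy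
  have hfn : ∀ n, ‖f n‖ * ‖y n‖ ≤ M n * p (e n) := fun n => by
    rw [hy, norm_toLocalBanach]
    exact mul_le_mul_of_nonneg_right (LinearMap.opNorm_extendOfNorm_le hd (hM n) (hc' n))
      (apply_nonneg p _)
  have hfe : ∀ n u, f n (toLocalBanach q u) = c n u := fun n u =>
    LinearMap.extendOfNorm_eq hd ⟨M n, hc' n⟩ u
  have hfs : Summable fun n => ‖f n‖ * ‖y n‖ :=
    Summable.of_nonneg_of_le (fun n => by positivity) hfn hs
  have hT : Summable fun n => (f n).smulRight (y n) :=
    Summable.of_norm (by simpa only [ContinuousLinearMap.norm_smulRight_apply] using hfs)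
  have hTx : ∀ x, HasSum (fun n => f n x • y n) ((∑' n, (f n).smulRight (y n)) x) := fun x => by
    have := hT.hasSum.mapL (ContinuousLinearMap.apply ℂ (LocalBanach p) x)
    simpa using this
  have heq : ∀ x, (∑' n, (f n).smulRight (y n)) x = localMap h x := by
    refine fun x => hd.induction_on x (isClosed_eq (ContinuousLinearMap.continuous _)
      (ContinuousLinearMap.continuous _)) fun u => ?_
    have h1 := hTx (toLocalBanach q u)
    have h2 := (hsum u).map (toLocalBanach p) (continuous_toLocalBanach hp)
    rw [localMap_toLocalBanach]
    refine h1.unique ?_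
    simpa only [hfe, Function.comp_def, map_smul] using h2
  obtain ⟨φ⟩ : Nonempty (ℕ ≃ κ) := inferInstance
  exact ⟨f ∘ φ, y ∘ φ, (φ.summable_iff (f := fun n => ‖f n‖ * ‖y n‖)).2 hfs, fun x =>
    (φ.hasSum_iff (f := fun n => f n x • y n)).2 (heq x ▸ hTx x)⟩

end nuclear

/-! ### Spaces isomorphic to the sequence space -/

section isomorphic

variable {d : ℕ} {α : ℝ} {E : Type*} [AddCommGroup E] [Module ℂ E] [TopologicalSpace E]

theorem hasSum_symm_unitVec (hα : 1 ≤ α) (Φ : E ≃L[ℂ] SeqSpace d α) (u : E) :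
    HasSum (fun n => (Φ u).1 n • Φ.symm (unitVec α n)) u := by
  have := (hasSum_unitVec hα (Φ u)).mapL (Φ.symm : SeqSpace d α →L[ℂ] E)
  simpa using this

/-- The coordinate functionals of the sequence space. -/
noncomputable def coordLinear (n : Fin d → ℕ) : SeqSpace d α →ₗ[ℂ] ℂ :=
  LinearMap.proj n ∘ₗ (seqSubmodule d α).subtype

theorem continuous_coordLinear (hα : 1 ≤ α) (n : Fin d → ℕ) :
    Continuous (coordLinear (α := α) n) := by
  refine continuous_of_continuousAt_zero (coordLinear (α := α) n) ?_
  have hw : IsWeight (d := d) α fun n => (((∑ i, n i : ℕ) : ℝ) + 1) ^ 0 := isWeight_pow hα 0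
  rw [ContinuousAt, map_zero]
  have := (continuous_weightSeminorm hα hw).tendsto 0
  rw [map_zero] at this
  refine squeeze_zero_norm (fun u => ?_) this
  simpa using! mul_norm_le_weightSeminorm hα hw u n

theorem t2Space_of_equiv (hα : 1 ≤ α) (Φ : E ≃L[ℂ] SeqSpace d α) : T2Space E := by
  refine T2Space.of_injective_continuous (f := fun u n => coordLinear n (Φ u)) ?_
    (continuous_pi fun n => (continuous_coordLinear hα n).comp Φ.continuous)
  intro u v h
  exact Φ.injective (Subtype.ext h)

theorem isNuclearSpace_of_equiv (hd : 1 ≤ d) (hα : 1 ≤ α) [IsTopologicalAddGroup E]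
    [ContinuousSMul ℂ E] [LocallyConvexSpace ℝ E] (Φ : E ≃L[ℂ] SeqSpace d α) :
    IsNuclearSpace E := by
  refine ⟨inferInstance, inferInstance, inferInstance, t2Space_of_equiv hα Φ, fun p hp => ?_⟩
  have : Nonempty (Fin d) := ⟨⟨0, hd⟩⟩
  set p' : Seminorm ℂ (SeqSpace d α) := p.comp (Φ.symm : SeqSpace d α →ₗ[ℂ] E)
  have hp' : Continuous p' := hp.comp Φ.symm.continuous
  have hw := isWeight_seminorm hp'
  set w : (Fin d → ℕ) → ℝ := fun n => p' (unitVec α n)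
  set K : (Fin d → ℕ) → ℝ := fun n => (((∑ i, n i : ℕ) : ℝ) + 1) ^ (2 * d)
  have hK : IsWeight α K := isWeight_pow hα _
  have hK1 : ∀ n, 1 ≤ K n := fun n => one_le_pow₀ (by linarith [Nat.cast_nonneg (α := ℝ) (∑ i, n i)])
  -- Adding 1 keeps the weight positive, so that every coordinate is bounded by q; the factor K
  -- leaves w/((w+1)K) ≤ 1/K, which is summable.
  have hv : IsWeight α fun n => (w n + 1) * K n := (hw.add_const zero_le_one).mul hK
  set q : Seminorm ℂ E := (weightSeminorm hα hv).comp (Φ : E →ₗ[ℂ] SeqSpace d α)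
  have hpq : p ≤ q := fun u => by
    have h1 : p u = p' (Φ u) := by simp [p', Seminorm.comp_apply]
    rw [h1]
    refine (seminorm_le_weightSeminorm hα hp' (Φ u)).trans ?_
    refine (hw.summable hα _).tsum_le_tsum (fun n => ?_) (hv.summable hα _)
    refine mul_le_mul_of_nonneg_right ?_ (norm_nonneg _)
    calc w n ≤ w n + 1 := by linarith
      _ ≤ (w n + 1) * K n := le_mul_of_one_le_right (by linarith [hw.1 n]) (hK1 n)
  have hpos : ∀ n, 0 < (w n + 1) * K n := fun n =>
    mul_pos (by linarith [hw.1 n]) (zero_lt_one.trans_le (hK1 n))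
  refine ⟨q, (continuous_weightSeminorm hα hv).comp Φ.continuous, hpq,
    isNuclearMap_localMap (e := fun n => Φ.symm (unitVec α n))
      (c := fun n => coordLinear n ∘ₗ (Φ : E →ₗ[ℂ] SeqSpace d α)) (hasSum_symm_unitVec hα Φ) hp hpq
      (M := fun n => ((w n + 1) * K n)⁻¹) (fun n => (inv_pos.2 (hpos n)).le) (fun n u => ?_) ?_⟩
  · rw [inv_mul_eq_div, le_div_iff₀ (hpos n), mul_comm]
    exact mul_norm_le_weightSeminorm hα hv (Φ u) n
  · refine Summable.of_nonneg_of_le (fun n => mul_nonneg (inv_pos.2 (hpos n)).le (apply_nonneg p _))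
      (fun n => ?_) (summable_inv_sum_pow d)
    have h1 : 0 ≤ w n := hw.1 n
    rw [inv_pow, inv_mul_le_iff₀ (hpos n), mul_assoc, mul_inv_cancel₀ (zero_lt_one.trans_le (hK1 n)).ne']
    change w n ≤ _
    linarith

end isomorphic

/-! ### Compact diagonal operators -/

section diagonal

variable {κ : Type*}

/-- A bounded sequence tending to zero is the norm limit of its finite truncations. -/
theorem hasSum_lp_single [DecidableEq κ] (t : lp (fun _ : κ => ℂ) ∞)
    (ht : Tendsto (fun n => ‖t n‖) cofinite (𝓝 0)) :
    HasSum (fun n => lp.single ∞ n (t n)) t := by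
  rw [HasSum, SummationFilter.unconditional_filter, Metric.tendsto_atTop]
  intro ε hε
  have hfin : {n | ¬ ‖t n‖ < ε / 2}.Finite := ht.eventually (gt_mem_nhds (half_pos hε))
  refine ⟨hfin.toFinset, fun s hs => ?_⟩
  rw [dist_eq_norm]
  refine (lp.norm_le_of_forall_le (half_pos hε).le fun n => ?_).trans_lt (half_lt_self hε)
  have hval : ((∑ m ∈ s, lp.single ∞ m (t m)) - t : lp (fun _ : κ => ℂ) ∞) n =
      (if n ∈ s then t n else 0) - t n := by
    rw [lp.coeFn_sub, Pi.sub_apply, lp.coeFn_sum, Finset.sum_apply]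
    simp [Pi.single_apply]
  rw [hval]
  split_ifs with hn
  · simpa using (half_pos hε).le
  · have : n ∉ hfin.toFinset := fun h => hn (hs h)
    simp only [Finite.mem_toFinset, mem_ofPred_eq, not_not] at this
    simpa using this.le

theorem isCompactOperator_smulRight {X Y : Type*} [NormedAddCommGroup X] [NormedSpace ℂ X]
    [NormedAddCommGroup Y] [NormedSpace ℂ Y] (φ : X →L[ℂ] ℂ) (y : Y) :
    IsCompactOperator (φ.smulRight y) := by
  have h := (isCompactOperator_of_locallyCompactSpace_rng
    (ContinuousLinearMap.toSpanSingleton ℂ y)).comp_clm φ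
  exact h

theorem isCompactOperator_mul_single [DecidableEq κ] (n : κ) (c : ℂ) :
    IsCompactOperator (ContinuousLinearMap.mul ℂ (lp (fun _ : κ => ℂ) ∞) (lp.single ∞ n c)) := by
  have e : ContinuousLinearMap.mul ℂ (lp (fun _ : κ => ℂ) ∞) (lp.single ∞ n c) =
      (lp.evalCLM ℂ (fun _ : κ => ℂ) ∞ n).smulRight
        (lp.single ∞ n c : lp (fun _ : κ => ℂ) ∞) := by
    refine ContinuousLinearMap.ext fun x => lp.ext (funext fun m => ?_)
    by_cases h : m = n
    · subst h
      simp [lp.coeFn_single, lp.infty_coeFn_mul, lp.evalCLM, mul_comm]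
    · simp [lp.coeFn_single, lp.infty_coeFn_mul, Pi.single_eq_of_ne h]
  rw [e]
  exact isCompactOperator_smulRight _ _

/-- Multiplication by t depends continuously on t, so it is an operator norm limit of
multiplications by truncations, which have finite rank. -/
theorem isCompactOperator_mul (t : lp (fun _ : κ => ℂ) ∞)
    (ht : Tendsto (fun n => ‖t n‖) cofinite (𝓝 0)) :
    IsCompactOperator (ContinuousLinearMap.mul ℂ (lp (fun _ : κ => ℂ) ∞) t) := by
  classical
  have h := (hasSum_lp_single t ht).mapL (ContinuousLinearMap.mul ℂ (lp (fun _ : κ => ℂ) ∞))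
  refine isCompactOperator_of_tendsto h (.of_forall fun s => ?_)
  exact Submodule.sum_mem (compactOperator (RingHom.id ℂ) (lp (fun _ : κ => ℂ) ∞)
    (lp (fun _ : κ => ℂ) ∞)) fun n _ => isCompactOperator_mul_single n (t n)

end diagonal

/-! ### The sequence space as an inductive limit of a compact sequence of Banach spaces -/

section inductiveSequence

variable {d : ℕ} {α : ℝ}

/-- A sequence decreasing to `1`. -/
noncomputable def rad (m : ℕ) : ℝ := 1 + 1 / ((m : ℝ) + 1)

theorem one_lt_rad (m : ℕ) : 1 < rad m := by
  unfold rad; linarith [show (0 : ℝ) < 1 / ((m : ℝ) + 1) by positivity]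

/-- The sequence `rad` in the index set of the spaces `s^{α,a}`. -/
noncomputable def radIoi (m : ℕ) : Ioi (1 : ℝ) := ⟨rad m, mem_Ioi.2 (one_lt_rad m)⟩

theorem rad_pos (m : ℕ) : 0 < rad m := zero_lt_one.trans (one_lt_rad m)

theorem rad_succ_lt (m : ℕ) : rad (m + 1) < rad m := by
  unfold rad
  gcongr
  exact_mod_cast Nat.lt_succ_self m

theorem rad_anti : Antitone rad := antitone_nat_of_succ_le fun m => (rad_succ_lt m).le

theorem exists_rad_lt {a : ℝ} (ha : 1 < a) : ∃ m, rad m < a := by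
  obtain ⟨m, hm⟩ := exists_nat_one_div_lt (sub_pos.2 ha)
  exact ⟨m, by unfold rad; linarith⟩

/-- The isomorphism of the Banach space of bounded sequences with `s^{α,b}`. -/
noncomputable def lpToSeqStep (d : ℕ) (α : ℝ) (b : Ioi (1 : ℝ)) :
    lp (fun _ : Fin d → ℕ => ℂ) ∞ →ₗ[ℂ] SeqStep d α b where
  toFun x := ⟨fun n => x n * ((b.1⁻¹ ^ rho α n : ℝ) : ℂ), by
    have hb : 0 < b.1 := zero_lt_one.trans b.2
    refine seqNorm_lt_top_of_le (K := ‖x‖) fun n => ?_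
    rw [norm_mul, Complex.norm_real, Real.norm_of_nonneg (by positivity), mul_assoc,
      ← Real.mul_rpow (by positivity) hb.le, inv_mul_cancel₀ hb.ne', Real.one_rpow, mul_one]
    exact lp.norm_apply_le_norm (by simp) x n⟩
  map_add' x y := Subtype.ext (funext fun n => add_mul _ _ _)
  map_smul' c x := Subtype.ext (funext fun n => mul_assoc _ _ _)

theorem lpToSeqStep_apply (b : Ioi (1 : ℝ)) (x : lp (fun _ : Fin d → ℕ => ℂ) ∞) (n : Fin d → ℕ) :
    (lpToSeqStep d α b x).1 n = x n * ((b.1⁻¹ ^ rho α n : ℝ) : ℂ) := rfl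

theorem norm_lpToSeqStep_mul (b : Ioi (1 : ℝ)) (x : lp (fun _ : Fin d → ℕ => ℂ) ∞)
    (n : Fin d → ℕ) : ‖(lpToSeqStep d α b x).1 n‖ * b.1 ^ rho α n = ‖x n‖ := by
  have hb : 0 < b.1 := zero_lt_one.trans b.2
  rw [lpToSeqStep_apply, norm_mul, Complex.norm_real, Real.norm_of_nonneg (by positivity),
    mul_assoc, ← Real.mul_rpow (by positivity) hb.le, inv_mul_cancel₀ hb.ne', Real.one_rpow, mul_one]

theorem continuous_lpToSeqStep (b : Ioi (1 : ℝ)) : Continuous (lpToSeqStep d α b) := by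
  refine (norm_withSeminorms ℂ _).continuous_of_isBounded (withSeminorms_seqStep b) _
    (Seminorm.IsBounded.of_real fun _ => ⟨{0}, 1, fun x => ?_⟩)
  rw [Finset.sup_singleton, coe_normSeminorm, one_mul, seqStepNorm_apply]
  refine toReal_seqNorm_le (norm_nonneg _) fun n => ?_
  rw [norm_lpToSeqStep_mul]
  exact lp.norm_apply_le_norm (by simp) x n

/-- The embedding of `s^{α,a}` into `s^{α,b}`, `b ≤ a`, regarded as a space of bounded sequences. -/
noncomputable def seqStepToLp (d : ℕ) (α : ℝ) (a : Ioi (1 : ℝ)) {b : ℝ} (hb : 0 < b)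
    (hba : b ≤ a.1) : SeqStep d α a →ₗ[ℂ] lp (fun _ : Fin d → ℕ => ℂ) ∞ where
  toFun u := ⟨fun n => u.1 n * ((b ^ rho α n : ℝ) : ℂ), memℓp_infty
    ⟨(seqNorm d α a u.1).toReal, by
      rintro _ ⟨n, rfl⟩
      simp only
      rw [norm_mul, Complex.norm_real, Real.norm_of_nonneg (by positivity)]
      refine (mul_le_mul_of_nonneg_left ?_ (norm_nonneg _)).trans
        (norm_mul_rpow_le_seqNorm (hb.trans_le hba) u.2 n)
      exact Real.rpow_le_rpow hb.le hba (rho_nonneg _ _)⟩⟩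
  map_add' u v := lp.ext (funext fun n => add_mul _ _ _)
  map_smul' c u := lp.ext (funext fun n => mul_assoc _ _ _)

theorem seqStepToLp_apply (a : Ioi (1 : ℝ)) {b : ℝ} (hb : 0 < b) (hba : b ≤ a.1)
    (u : SeqStep d α a) (n : Fin d → ℕ) :
    seqStepToLp d α a hb hba u n = u.1 n * ((b ^ rho α n : ℝ) : ℂ) := rfl

theorem continuous_seqStepToLp (a : Ioi (1 : ℝ)) {b : ℝ} (hb : 0 < b) (hba : b ≤ a.1) :
    Continuous (seqStepToLp d α a hb hba) := by
  refine (withSeminorms_seqStep a).continuous_of_isBounded (norm_withSeminorms ℂ _) _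
    (Seminorm.IsBounded.of_real fun _ => ⟨{()}, 1, fun u => ?_⟩)
  rw [Finset.sup_singleton, coe_normSeminorm, one_mul, seqStepNorm_apply]
  refine lp.norm_le_of_forall_le ENNReal.toReal_nonneg fun n => ?_
  rw [seqStepToLp_apply, norm_mul, Complex.norm_real, Real.norm_of_nonneg (by positivity)]
  refine (mul_le_mul_of_nonneg_left ?_ (norm_nonneg _)).trans
    (norm_mul_rpow_le_seqNorm (hb.trans_le hba) u.2 n)
  exact Real.rpow_le_rpow hb.le hba (rho_nonneg _ _)

theorem lpToSeqStep_seqStepToLp (a b : Ioi (1 : ℝ)) (hb : 0 < b.1) (hba : b.1 ≤ a.1)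
    (u : SeqStep d α a) : seqIncl d α b (lpToSeqStep d α b (seqStepToLp d α a hb hba u)) =
      seqIncl d α a u := by
  refine Subtype.ext (funext fun n => ?_)
  change u.1 n * ((b.1 ^ rho α n : ℝ) : ℂ) * ((b.1⁻¹ ^ rho α n : ℝ) : ℂ) = u.1 n
  rw [mul_assoc, ← Complex.ofReal_mul, ← Real.mul_rpow hb.le (by positivity),
    mul_inv_cancel₀ hb.ne', Real.one_rpow, Complex.ofReal_one, mul_one]

/-- The multipliers `(a_{m+1} / a_m)^{|n|^{1/α}}` of the linking maps. -/
noncomputable def linkMultiplier (d : ℕ) (α : ℝ) (m : ℕ) : lp (fun _ : Fin d → ℕ => ℂ) ∞ :=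
  ⟨fun n => (((rad (m + 1) / rad m) ^ rho α n : ℝ) : ℂ), memℓp_infty ⟨1, by
    rintro _ ⟨n, rfl⟩
    have h1 := rad_pos m
    have h2 := rad_pos (m + 1)
    simp only
    rw [Complex.norm_real, Real.norm_of_nonneg (by positivity)]
    exact Real.rpow_le_one (by positivity) ((div_le_one h1).2 (rad_succ_lt m).le)
      (rho_nonneg _ _)⟩⟩

theorem linkMultiplier_apply (m : ℕ) (n : Fin d → ℕ) :
    linkMultiplier d α m n = (((rad (m + 1) / rad m) ^ rho α n : ℝ) : ℂ) := rfl

theorem summable_linkMultiplier (hα : 1 ≤ α) (m : ℕ) :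
    Summable fun n : Fin d → ℕ => (rad (m + 1) / rad m) ^ rho α n :=
  summable_rpow_rho hα (div_pos (rad_pos _) (rad_pos _)) ((div_lt_one (rad_pos m)).2 (rad_succ_lt m))

/-- After rescaling by a_m^{|n|^{1/α}}, every step is the same Banach space ℓ^∞, and the inclusions
become multiplication by (a_{m+1}/a_m)^{|n|^{1/α}}, a null sequence. The sequence a_m decreases to
1, hence is cofinal in the scale and yields the same limit. -/
theorem isDFS_of_equiv (hα : 1 ≤ α) {E : Type} [AddCommGroup E] [Module ℂ E] [TopologicalSpace E]
    [IsTopologicalAddGroup E] [ContinuousSMul ℂ E] [LocallyConvexSpace ℝ E]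
    (Φ : E ≃L[ℂ] SeqSpace d α) : IsDFS E := by
  let j : ∀ m : ℕ, lp (fun _ : Fin d → ℕ => ℂ) ∞ →ₗ[ℂ] E := fun m =>
    (Φ.symm : SeqSpace d α →ₗ[ℂ] E) ∘ₗ seqIncl d α (radIoi m) ∘ₗ
      lpToSeqStep d α (radIoi m)
  have hj : ∀ m x, j m x = Φ.symm (seqIncl d α (radIoi m)
    (lpToSeqStep d α (radIoi m) x)) := fun _ _ => rfl
  refine ⟨fun _ => lp (fun _ : Fin d → ℕ => ℂ) ∞, fun _ => inferInstance, fun _ => inferInstance,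
    fun _ => inferInstance, fun m => ContinuousLinearMap.mul ℂ _ (linkMultiplier d α m), j,
    fun m => isCompactOperator_mul _ ?_, fun m => ?_, fun m x => ?_, fun y => ?_,
    le_antisymm ?_ (sInf_le ⟨inferInstance, inferInstance, inferInstance, fun m => ?_⟩)⟩
  · refine ((summable_linkMultiplier (d := d) hα m).tendsto_cofinite_zero).congr fun n => ?_
    have h1 := rad_pos m
    have h2 := rad_pos (m + 1)
    rw [linkMultiplier_apply, Complex.norm_real, Real.norm_of_nonneg (by positivity)]
  · intro x y h
    have h1 := congrArg Subtype.val (Φ.symm.injective h)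
    refine lp.ext (funext fun n => ?_)
    have h2 : x n * ((rad m)⁻¹ ^ rho α n : ℝ) = y n * ((rad m)⁻¹ ^ rho α n : ℝ) := congrFun h1 n
    have h3 : (((rad m)⁻¹ ^ rho α n : ℝ) : ℂ) ≠ 0 := by
      have := rad_pos m
      exact Complex.ofReal_ne_zero.2 (by positivity)
    exact mul_right_cancel₀ h3 h2
  · rw [hj, hj]
    congr 1
    refine Subtype.ext (funext fun n => ?_)
    change (((rad (m + 1) / rad m) ^ rho α n : ℝ) : ℂ) * x n * ((rad (m + 1))⁻¹ ^ rho α n : ℝ) =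
      x n * ((rad m)⁻¹ ^ rho α n : ℝ)
    have h1 := rad_pos m
    have h2 := rad_pos (m + 1)
    rw [mul_right_comm, ← Complex.ofReal_mul, ← Real.mul_rpow (by positivity) (by positivity),
      mul_comm]
    congr 3
    field_simp
  · obtain ⟨a, ha, hu⟩ := (Φ y).2
    obtain ⟨m, hm⟩ := exists_rad_lt ha
    refine ⟨m, seqStepToLp d α ⟨a, mem_Ioi.2 ha⟩ (rad_pos m) hm.le ⟨(Φ y).1, hu⟩, ?_⟩
    exact (congrArg Φ.symm (lpToSeqStep_seqStepToLp ⟨a, mem_Ioi.2 ha⟩ (radIoi m) (rad_pos m) hm.le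
      ⟨(Φ y).1, hu⟩)).trans (Φ.symm_apply_apply y)
  -- Each step s^{α,a} factors continuously through the m-th copy of ℓ^∞ as soon as a_m < a; the
  -- universal property then compares the two limit topologies.
  · rw [← continuous_id_iff_le]
    have h : @Continuous _ E _ (lcIndTopology j) (Φ.symm : SeqSpace d α →ₗ[ℂ] E) := by
      refine @continuous_of_lcIndTopology _ _ _ _ _ _ _ _ _ E _ _ (lcIndTopology j)
        (isTopologicalAddGroup_lcIndTopology j) (continuousSMul_lcIndTopology j)
        (locallyConvexSpace_lcIndTopology j) _ fun a => ?_
      obtain ⟨m, hm⟩ := exists_rad_lt a.2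
      have := @Continuous.comp _ _ E _ _ (lcIndTopology j) _ _ (continuous_lcIndTopology j m)
        (continuous_seqStepToLp (d := d) (α := α) a (rad_pos m) hm.le)
      convert this using 1
      funext u
      exact (congrArg Φ.symm (lpToSeqStep_seqStepToLp a (radIoi m) (rad_pos m) hm.le u)).symm
    have h2 := @Continuous.comp _ _ E _ _ (lcIndTopology j) _ _ h Φ.continuous
    have e : (id : E → E) = (Φ.symm : SeqSpace d α →ₗ[ℂ] E) ∘ Φ :=
      funext fun x => (Φ.symm_apply_apply x).symm
    rwa [e]
  · exact Φ.symm.continuous.comp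
      ((continuous_lcIndTopology (seqIncl d α) (radIoi m)).comp
        (continuous_lpToSeqStep (radIoi m)))

end inductiveSequence

/-! ### Fréchet spaces defined by sequences of seminorms -/

/-- Countably many seminorms give a countably generated uniformity, for which sequential
completeness suffices. -/
theorem isFrechetSpace_of_withSeminorms {F : Type*} [AddCommGroup F] [Module ℂ F]
    [TopologicalSpace F] [T2Space F] {p : ℕ → Seminorm ℂ F} (hp : WithSeminorms p)
    (h : ∀ x : ℕ → F, (∀ m, ∀ ε > 0, ∃ N, ∀ k ≥ N, ∀ l ≥ N, p m (x l - x k) < ε) →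
      ∃ y, ∀ m, ∀ ε > 0, ∃ N, ∀ k ≥ N, p m (x k - y) < ε) : IsFrechetSpace F := by
  have h1 : IsTopologicalAddGroup F := hp.topologicalAddGroup
  let : UniformSpace F := IsTopologicalAddGroup.rightUniformSpace F
  have : IsUniformAddGroup F := isUniformAddGroup_of_addCommGroup
  have : FirstCountableTopology F := hp.firstCountableTopology
  have : (uniformity F).IsCountablyGenerated := IsUniformAddGroup.uniformity_countably_generated
  refine ⟨h1, hp.continuousSMul, hp.toLocallyConvexSpace, UniformSpace.metrizableSpace, ?_⟩
  refine UniformSpace.complete_of_cauchySeq_tendsto fun x hx => ?_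
  obtain ⟨y, hy⟩ := h x fun m ε hε => by
    rw [cauchySeq_iff_tendsto, uniformity_eq_comap_nhds_zero, tendsto_comap_iff] at hx
    have h2 := ((hp.continuous_seminorm m).tendsto 0).comp hx
    rw [map_zero] at h2
    obtain ⟨⟨N, N'⟩, hN⟩ := eventually_atTop.1 (h2.eventually (gt_mem_nhds hε))
    exact ⟨max N N', fun k hk l hl =>
      hN (k, l) ⟨(le_max_left _ _).trans hk, (le_max_right _ _).trans hl⟩⟩
  refine ⟨y, (hp.tendsto_nhds _ _).2 fun m ε hε => ?_⟩
  obtain ⟨N, hN⟩ := hy m ε hε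
  exact eventually_atTop.2 ⟨N, hN⟩

theorem exists_le_of_isVonNBounded {E : Type*} [AddCommGroup E] [Module ℂ E] [TopologicalSpace E]
    {S : Set E} (hS : Bornology.IsVonNBounded ℂ S) {p : Seminorm ℂ E} (hp : Continuous p) :
    ∃ K : ℝ, ∀ x ∈ S, p x ≤ K := by
  have hV : {x : E | p x < 1} ∈ 𝓝 (0 : E) :=
    (isOpen_lt hp continuous_const).mem_nhds (by simp)
  obtain ⟨r, hr, h⟩ := (hS hV).exists_pos
  refine ⟨r, fun x hx => ?_⟩
  obtain ⟨y, hy, rfl⟩ := h (r : ℂ) (by simp [abs_of_pos hr]) hx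
  change p ((r : ℂ) • y) ≤ r
  rw [map_smul_eq_mul, Complex.norm_real, Real.norm_of_nonneg hr.le]
  exact mul_le_of_le_one_right hr.le (le_of_lt hy)

/-! ### The strong dual of the sequence space -/

section dual

variable {d : ℕ} {α : ℝ} {E : Type*} [AddCommGroup E] [Module ℂ E] [TopologicalSpace E]

/-- Bounded sets of the inductive limit are bounded in one of its steps. -/
theorem exists_norm_mul_le_of_isVonNBounded (hα : 1 ≤ α) (Φ : E ≃L[ℂ] SeqSpace d α) {S : Set E}
    (hS : Bornology.IsVonNBounded ℂ S) : ∃ m : ℕ, ∃ K : ℝ, 0 ≤ K ∧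
      ∀ x ∈ S, ∀ n, ‖(Φ x).1 n‖ * rad m ^ rho α n ≤ K := by
  -- If S is bounded in no step, then for every m some x_m in S has, at some index N_m, a coordinate
  -- exceeding m when multiplied by a_m^{|N_m|^{1/α}}.
  by_contra! H
  choose x hxS N hN using fun m : ℕ => H m m (Nat.cast_nonneg m)
  -- The weight keeps just the factors needed at the indices N_m. Given a > 1, all but finitely many
  -- m have a_m < a, and the finitely many others only affect the constant. The continuous seminorm
  -- Σ w_n |u_n| would then be unbounded on S.
  set w : (Fin d → ℕ) → ℝ := fun n => ⨆ m, if N m = n then rad m ^ rho α n else 0 with hw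
  have hterm : ∀ n m, (if N m = n then rad m ^ rho α n else 0) ≤ rad 0 ^ rho α n := fun n m => by
    have h0 := rad_pos 0
    split_ifs
    · exact Real.rpow_le_rpow (rad_pos m).le (rad_anti (Nat.zero_le m)) (rho_nonneg _ _)
    · positivity
  have hbdd : ∀ n, BddAbove (Set.range fun m => if N m = n then rad m ^ rho α n else 0) :=
    fun n => ⟨rad 0 ^ rho α n, by rintro _ ⟨m, rfl⟩; exact hterm n m⟩
  have hterm0 : ∀ n m, 0 ≤ (if N m = n then rad m ^ rho α n else 0) := fun n m => by
    have := rad_pos m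
    split_ifs <;> positivity
  have hweight : IsWeight α w := by
    refine ⟨fun n => Real.iSup_nonneg (hterm0 n), fun a ha => ?_⟩
    obtain ⟨M, hM⟩ := exists_rad_lt ha
    have ha0 : 0 < a := by linarith
    have hs0 : ∀ m ∈ Finset.range M, 0 ≤ rad m ^ rho α (N m) := fun m _ => by
      have := rad_pos m; positivity
    refine ⟨1 + ∑ m ∈ Finset.range M, rad m ^ rho α (N m), fun n => ciSup_le fun m => ?_⟩
    have h1 : 1 ≤ a ^ rho α n := Real.one_le_rpow ha.le (rho_nonneg _ _)
    have hsum := Finset.sum_nonneg hs0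
    split_ifs with h
    · by_cases hm : m < M
      · subst h
        have := Finset.single_le_sum hs0 (Finset.mem_range.2 hm)
        nlinarith
      · have h2 : rad m ^ rho α n ≤ a ^ rho α n := Real.rpow_le_rpow (rad_pos m).le
          ((rad_anti (not_lt.1 hm)).trans hM.le) (rho_nonneg _ _)
        nlinarith
    · positivity
  obtain ⟨K, hK⟩ := exists_le_of_isVonNBounded hS
    (p := (weightSeminorm hα hweight).comp (Φ : E →ₗ[ℂ] SeqSpace d α))
    ((continuous_weightSeminorm hα hweight).comp Φ.continuous)
  obtain ⟨m, hm⟩ := exists_nat_gt K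
  have h1 := (mul_norm_le_weightSeminorm hα hweight (Φ (x m)) (N m)).trans (hK _ (hxS m))
  have h2 : rad m ^ rho α (N m) ≤ w (N m) := by
    have := le_ciSup (hbdd (N m)) m
    simpa using this
  have h3 := mul_le_mul_of_nonneg_right h2 (norm_nonneg ((Φ (x m)).1 (N m)))
  linarith [hN m]

theorem hasSum_apply (hα : 1 ≤ α) (Φ : E ≃L[ℂ] SeqSpace d α) (φ : StrongDual ℂ E) (u : E) :
    HasSum (fun n => (Φ u).1 n * φ (Φ.symm (unitVec α n))) (φ u) := by
  simpa using (hasSum_symm_unitVec hα Φ u).mapL φ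

theorem isWeight_norm_apply (Φ : E ≃L[ℂ] SeqSpace d α) (φ : StrongDual ℂ E) :
    IsWeight α fun n => ‖φ (Φ.symm (unitVec α n))‖ :=
  isWeight_seminorm (p := (normSeminorm ℂ ℂ).comp
    ((φ : E →ₗ[ℂ] ℂ) ∘ₗ (Φ.symm : SeqSpace d α →ₗ[ℂ] E)))
    ((φ.continuous.comp Φ.symm.continuous).norm)

/-- The functional with prescribed values on the unit vectors. -/
theorem exists_functional (hα : 1 ≤ α) (Φ : E ≃L[ℂ] SeqSpace d α)
    {v : (Fin d → ℕ) → ℂ} (hv : IsWeight α fun n => ‖v n‖) :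
    ∃ φ : StrongDual ℂ E, ∀ n, φ (Φ.symm (unitVec α n)) = v n := by
  have hsum : ∀ u : SeqSpace d α, Summable fun n => v n * u.1 n := fun u =>
    Summable.of_norm (by simpa only [norm_mul] using hv.summable hα u)
  let T : SeqSpace d α →ₗ[ℂ] ℂ :=
    { toFun := fun u => ∑' n, v n * u.1 n
      map_add' := fun u w => by
        rw [← (hsum u).tsum_add (hsum w)]
        exact tsum_congr fun n => mul_add _ _ _
      map_smul' := fun c u => by
        rw [RingHom.id_apply, smul_eq_mul, ← tsum_mul_left]
        exact tsum_congr fun n => mul_left_comm _ _ _ }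
  have hT : Continuous T := by
    refine continuous_of_continuousAt_zero T ?_
    rw [ContinuousAt, map_zero]
    have := (continuous_weightSeminorm hα hv).tendsto 0
    rw [map_zero] at this
    refine squeeze_zero_norm (fun u => ?_) this
    refine (norm_tsum_le_tsum_norm (by simpa only [norm_mul] using hv.summable hα u)).trans_eq ?_
    simp only [norm_mul]
    rfl
  refine ⟨(⟨T, hT⟩ : SeqSpace d α →L[ℂ] ℂ).comp (Φ : E →L[ℂ] SeqSpace d α), fun n => ?_⟩
  have h1 : Φ (Φ.symm (unitVec α n)) = unitVec α n := Φ.apply_symm_apply _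
  change T (Φ (Φ.symm (unitVec α n))) = v n
  rw [h1]
  change ∑' m, v m * (Pi.single n (1 : ℂ) : (Fin d → ℕ) → ℂ) m = v n
  rw [tsum_eq_single n fun m hm => by simp [Pi.single_eq_of_ne hm]]
  simp

/-! ### A countable system of seminorms for the strong dual. -/

theorem seqNorm_apply_lt_top (Φ : E ≃L[ℂ] SeqSpace d α) (m : ℕ) (φ : StrongDual ℂ E) :
    seqNorm d α (rad m)⁻¹ (fun n => φ (Φ.symm (unitVec α n))) < ⊤ := by
  obtain ⟨C, hC⟩ := (isWeight_norm_apply Φ φ).2 _ (one_lt_rad m)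
  have hr := rad_pos m
  refine seqNorm_lt_top_of_le (K := C) fun n => ?_
  rw [Real.inv_rpow hr.le, ← div_eq_mul_inv, div_le_iff₀ (by positivity)]
  exact hC n

/-- The seminorms `sup_n |φ(e_n)| a_m^{-|n|^{1/α}}` of the strong dual. -/
noncomputable def dualSeminorm (Φ : E ≃L[ℂ] SeqSpace d α) (m : ℕ) :
    Seminorm ℂ (StrongDual ℂ E) :=
  seminormOfENNReal (fun φ => seqNorm d α (rad m)⁻¹ fun n => φ (Φ.symm (unitVec α n)))
    (seqNorm_apply_lt_top Φ m)
    (fun φ ψ => seqNorm_add d α (rad m)⁻¹ (fun n => φ (Φ.symm (unitVec α n)))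
      fun n => ψ (Φ.symm (unitVec α n)))
    (fun c φ => seqNorm_smul d α (rad m)⁻¹ c fun n => φ (Φ.symm (unitVec α n)))

variable {Φ : E ≃L[ℂ] SeqSpace d α}

theorem norm_apply_le_dualSeminorm (m : ℕ) (φ : StrongDual ℂ E) (n : Fin d → ℕ) :
    ‖φ (Φ.symm (unitVec α n))‖ ≤ dualSeminorm Φ m φ * rad m ^ rho α n := by
  have hr := rad_pos m
  have := norm_mul_rpow_le_seqNorm (inv_pos.2 hr) (seqNorm_apply_lt_top Φ m φ) n
  rwa [Real.inv_rpow hr.le, ← div_eq_mul_inv, div_le_iff₀ (by positivity)] at this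

theorem dualSeminorm_le {m : ℕ} {φ : StrongDual ℂ E} {K : ℝ} (hK : 0 ≤ K)
    (h : ∀ n, ‖φ (Φ.symm (unitVec α n))‖ ≤ K * rad m ^ rho α n) : dualSeminorm Φ m φ ≤ K := by
  have hr := rad_pos m
  refine toReal_seqNorm_le hK fun n => ?_
  rw [Real.inv_rpow hr.le, ← div_eq_mul_inv, div_le_iff₀ (by positivity)]
  exact h n

theorem dualSeminorm_mono : Monotone (dualSeminorm Φ) := fun l m hlm φ => by
  refine dualSeminorm_le (apply_nonneg _ φ) fun n =>
    (norm_apply_le_dualSeminorm m φ n).trans ?_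
  exact mul_le_mul_of_nonneg_left (Real.rpow_le_rpow (rad_pos m).le (rad_anti hlm)
    (rho_nonneg _ _)) (apply_nonneg _ φ)

/-- S is bounded in some step m. Using the dual seminorm of index m + 1 instead of m leaves the
summable factor (a_{m+1}/a_m)^{|n|^{1/α}} in the expansion of φ(x). -/
theorem exists_norm_apply_le (hα : 1 ≤ α) {S : Set E} (hS : Bornology.IsVonNBounded ℂ S) :
    ∃ m : ℕ, ∃ C : ℝ, 0 ≤ C ∧ ∀ φ : StrongDual ℂ E, ∀ x ∈ S, ‖φ x‖ ≤ C * dualSeminorm Φ m φ := by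
  obtain ⟨m, K, hK, h⟩ := exists_norm_mul_le_of_isVonNBounded hα Φ hS
  have hs := summable_linkMultiplier (d := d) hα m
  have hr := rad_pos m
  have hr' := rad_pos (m + 1)
  refine ⟨m + 1, K * ∑' n : Fin d → ℕ, (rad (m + 1) / rad m) ^ rho α n,
    mul_nonneg hK (tsum_nonneg fun n => by positivity), fun φ x hx => ?_⟩
  have h1 := tsum_of_norm_bounded (hs.hasSum.mul_left (K * dualSeminorm Φ (m + 1) φ))
    (f := fun n => (Φ x).1 n * φ (Φ.symm (unitVec α n))) fun n => by
      have h2 : ‖(Φ x).1 n‖ ≤ K / rad m ^ rho α n := by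
        rw [le_div_iff₀ (by positivity)]; exact h x hx n
      rw [norm_mul, Real.div_rpow hr'.le hr.le]
      calc _ ≤ K / rad m ^ rho α n * (dualSeminorm Φ (m + 1) φ * rad (m + 1) ^ rho α n) :=
            mul_le_mul h2 (norm_apply_le_dualSeminorm _ φ n) (norm_nonneg _) (by positivity)
        _ = _ := by ring
  rw [(hasSum_apply hα Φ φ x).tsum_eq] at h1
  exact h1.trans_eq (by ring)

/-- The normalized unit vectors lie in the unit ball of one step. The supremum of |φ| over this
bounded set is `dualSeminorm Φ m φ`. -/
theorem isVonNBounded_range_smul_unitVec (Φ : E ≃L[ℂ] SeqSpace d α) (m : ℕ) :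
    Bornology.IsVonNBounded ℂ (Set.range fun n : Fin d → ℕ =>
      (((rad m)⁻¹ ^ rho α n : ℝ) : ℂ) • Φ.symm (unitVec α n)) := by
  have hr := rad_pos m
  let δ : (Fin d → ℕ) → SeqStep d α (radIoi m) := fun n =>
    ⟨Pi.single n 1, seqNorm_single_lt_top n 1⟩
  let e : (Fin d → ℕ) → SeqStep d α (radIoi m) := fun n =>
    (((rad m)⁻¹ ^ rho α n : ℝ) : ℂ) • δ n
  have he : Bornology.IsVonNBounded ℂ (Set.range e) := by
    rw [(withSeminorms_seqStep (d := d) (α := α) (radIoi m)).isVonNBounded_iff_seminorm_bounded]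
    refine fun _ => ⟨2, two_pos, ?_⟩
    rintro _ ⟨n, rfl⟩
    have h1 := toReal_seqNorm_single (α := α) hr n
    change seqStepNorm d α (radIoi m) ((((rad m)⁻¹ ^ rho α n : ℝ) : ℂ) • δ n) < 2
    rw [map_smul_eq_mul, Complex.norm_real, Real.norm_of_nonneg (by positivity)]
    refine lt_of_le_of_lt ?_ one_lt_two
    calc _ ≤ (rad m)⁻¹ ^ rho α n * rad m ^ rho α n :=
          mul_le_mul_of_nonneg_left h1 (by positivity)
      _ = 1 := by
          rw [← Real.mul_rpow (by positivity) hr.le, inv_mul_cancel₀ hr.ne', Real.one_rpow]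
  have := he.image ((Φ.symm : SeqSpace d α →L[ℂ] E).comp
    ⟨seqIncl d α (radIoi m), continuous_lcIndTopology (seqIncl d α) (radIoi m)⟩)
  rw [← Set.range_comp] at this
  refine (congrArg (Bornology.IsVonNBounded ℂ) (congrArg Set.range (funext fun n => ?_))).mp this
  exact map_smul Φ.symm _ (unitVec α n)

/-- Each `dualSeminorm` is a supremum over a bounded set, hence strongly continuous; conversely the
supremum over any bounded set is controlled by one of them. -/
theorem withSeminorms_dualSeminorm (hα : 1 ≤ α) : WithSeminorms (dualSeminorm Φ) := by
  rw [SeminormFamily.withSeminorms_iff_nhds_eq_iInf]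
  refine le_antisymm (le_iInf fun m => ?_) ?_
  · rw [← tendsto_iff_comap, Metric.tendsto_nhds]
    intro ε hε
    have hmem := (ContinuousLinearMap.hasBasis_nhds_zero_of_basis (𝕜₁ := ℂ) (E := E)
      (σ := RingHom.id ℂ) (Metric.nhds_basis_closedBall (x := (0 : ℂ)))).mem_of_mem
      (i := (_, ε / 2)) ⟨isVonNBounded_range_smul_unitVec Φ m, half_pos hε⟩
    filter_upwards [hmem] with φ hφ
    have hr := rad_pos m
    rw [Real.dist_0_eq_abs, abs_of_nonneg (apply_nonneg _ φ)]
    refine (dualSeminorm_le (half_pos hε).le fun n => ?_).trans_lt (half_lt_self hε)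
    have := hφ _ ⟨n, rfl⟩
    rw [mem_closedBall_zero_iff, map_smul, norm_smul, Complex.norm_real,
      Real.norm_of_nonneg (by positivity), Real.inv_rpow hr.le, inv_mul_le_iff₀ (by positivity)]
      at this
    linarith
  · rw [(ContinuousLinearMap.hasBasis_nhds_zero_of_basis (𝕜₁ := ℂ) (E := E)
      (σ := RingHom.id ℂ) (Metric.nhds_basis_ball (x := (0 : ℂ)))).ge_iff]
    rintro ⟨S, ε⟩ ⟨hS, hε⟩
    obtain ⟨m, C, hC, h⟩ := exists_norm_apply_le (Φ := Φ) hα hS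
    refine mem_iInf_of_mem m ⟨Metric.ball 0 (ε / (C + 1)), Metric.ball_mem_nhds _ (by positivity),
      fun φ hφ x hx => ?_⟩
    have hφ' : dualSeminorm Φ m φ < ε / (C + 1) := by
      simpa [abs_of_nonneg (apply_nonneg (dualSeminorm Φ m) φ)] using hφ
    rw [lt_div_iff₀ (by positivity)] at hφ'
    rw [mem_ball_zero_iff]
    have h1 := h φ x hx
    have h2 := apply_nonneg (dualSeminorm Φ m) φ
    nlinarith

/-! ### Completeness and nuclearity of the strong dual. -/

variable [ContinuousSMul ℂ E]

theorem isFrechetSpace_strongDual (hα : 1 ≤ α) (Φ : E ≃L[ℂ] SeqSpace d α) :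
    IsFrechetSpace (StrongDual ℂ E) := by
  refine isFrechetSpace_of_withSeminorms (withSeminorms_dualSeminorm (Φ := Φ) hα) fun x hx => ?_
  have hcoord : ∀ n, CauchySeq fun k => x k (Φ.symm (unitVec α n)) := fun n => by
    rw [Metric.cauchySeq_iff]
    intro ε hε
    have hr := rad_pos 0
    obtain ⟨N, hN⟩ := hx 0 (ε / rad 0 ^ rho α n) (by positivity)
    refine ⟨N, fun k hk l hl => ?_⟩
    rw [dist_eq_norm]
    have h1 := norm_apply_le_dualSeminorm (Φ := Φ) 0 (x k - x l) n
    have h2 := hN l hl k hk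
    rw [lt_div_iff₀ (by positivity)] at h2
    exact h1.trans_lt h2
  choose v hv using fun n => cauchySeq_tendsto_of_complete (hcoord n)
  have hclose : ∀ m, ∀ ε > 0, ∃ N, ∀ k ≥ N, ∀ n,
      ‖x k (Φ.symm (unitVec α n)) - v n‖ ≤ ε * rad m ^ rho α n := fun m ε hε => by
    obtain ⟨N, hN⟩ := hx m ε hε
    refine ⟨N, fun k hk n => ?_⟩
    refine le_of_tendsto ((hv n).const_sub _).norm (eventually_atTop.2 ⟨N, fun l hl => ?_⟩)
    have hr := rad_pos m
    exact (norm_apply_le_dualSeminorm (Φ := Φ) m (x k - x l) n).trans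
      (mul_le_mul_of_nonneg_right (hN l hl k hk).le (by positivity))
  -- For a > 1, one member of the sequence within distance 1 of the limit in a seminorm with a_m < a
  -- bounds v by a multiple of a^{|n|^{1/α}}; `exists_functional` then realizes v as a continuous
  -- functional.
  have hvw : IsWeight α fun n => ‖v n‖ := by
    refine ⟨fun n => norm_nonneg _, fun a ha => ?_⟩
    obtain ⟨m, hm⟩ := exists_rad_lt ha
    obtain ⟨N, hN⟩ := hclose m 1 one_pos
    obtain ⟨C, hC⟩ := (isWeight_norm_apply Φ (x N)).2 a ha
    refine ⟨C + 1, fun n => ?_⟩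
    have h1 := hN N le_rfl n
    have h2 := norm_sub_norm_le (v n) (x N (Φ.symm (unitVec α n)))
    rw [norm_sub_rev] at h2
    have h3 : rad m ^ rho α n ≤ a ^ rho α n :=
      Real.rpow_le_rpow (rad_pos m).le hm.le (rho_nonneg _ _)
    have h4 := hC n
    linarith
  obtain ⟨φ, hφ⟩ := exists_functional hα Φ hvw
  refine ⟨φ, fun m ε hε => ?_⟩
  obtain ⟨N, hN⟩ := hclose m (ε / 2) (half_pos hε)
  refine ⟨N, fun k hk => (dualSeminorm_le (half_pos hε).le fun n => ?_).trans_lt (half_lt_self hε)⟩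
  rw [sub_apply, hφ]
  exact hN k hk n

/-- The coordinate functionals f_n expand every φ with coefficients φ(e_n). These are bounded by
a_{m+1}^{|n|^{1/α}} times the seminorm of index m + 1, whereas the m-th seminorm of f_n is at most
a_m^{-|n|^{1/α}}; the products are summable. -/
theorem isNuclearSpace_strongDual (hd : 1 ≤ d) (hα : 1 ≤ α) (Φ : E ≃L[ℂ] SeqSpace d α) :
    IsNuclearSpace (StrongDual ℂ E) := by
  have hW := withSeminorms_dualSeminorm (Φ := Φ) hα
  have : Nonempty (Fin d) := ⟨⟨0, hd⟩⟩
  let f : (Fin d → ℕ) → StrongDual ℂ E := fun n =>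
    (⟨coordLinear n, continuous_coordLinear hα n⟩ : SeqSpace d α →L[ℂ] ℂ).comp
      (Φ : E →L[ℂ] SeqSpace d α)
  have hf : ∀ n k, f n (Φ.symm (unitVec α k)) = (Pi.single k (1 : ℂ) : (Fin d → ℕ) → ℂ) n :=
    fun n k => congrArg (fun u : SeqSpace d α => u.1 n) (Φ.apply_symm_apply (unitVec α k))
  let c : (Fin d → ℕ) → StrongDual ℂ E →ₗ[ℂ] ℂ := fun n =>
    { toFun := fun φ => φ (Φ.symm (unitVec α n))
      map_add' := fun _ _ => rfl
      map_smul' := fun _ _ => rfl }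
  have hfn : ∀ m n, dualSeminorm Φ m (f n) ≤ (rad m)⁻¹ ^ rho α n := fun m n => by
    have hr := rad_pos m
    refine dualSeminorm_le (by positivity) fun k => ?_
    rw [hf]
    by_cases h : n = k
    · subst h
      rw [← Real.mul_rpow (by positivity) hr.le, inv_mul_cancel₀ hr.ne', Real.one_rpow]
      simp
    · rw [Pi.single_eq_of_ne h, norm_zero]; positivity
  have hsum : ∀ φ : StrongDual ℂ E, HasSum (fun n => c n φ • f n) φ := fun φ => by
    refine (hW.tendsto_nhds _ _).2 fun m ε hε => ?_
    have hr := rad_pos m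
    have hr' := rad_pos (m + 1)
    have hs := (summable_linkMultiplier (d := d) hα m).mul_left (dualSeminorm Φ (m + 1) φ)
    have hfin : {n | ¬ dualSeminorm Φ (m + 1) φ * (rad (m + 1) / rad m) ^ rho α n < ε / 2}.Finite :=
      hs.tendsto_cofinite_zero.eventually (gt_mem_nhds (half_pos hε))
    rw [SummationFilter.unconditional_filter, eventually_atTop]
    refine ⟨hfin.toFinset, fun s hs => ?_⟩
    refine (dualSeminorm_le (half_pos hε).le fun n => ?_).trans_lt (half_lt_self hε)
    have hval : ((∑ k ∈ s, c k φ • f k) - φ) (Φ.symm (unitVec α n)) =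
        (if n ∈ s then c n φ else 0) - c n φ := by
      rw [sub_apply, sum_apply]
      simp only [smul_apply, hf, Pi.single_apply, smul_eq_mul, mul_ite, mul_one, mul_zero]
      rw [Finset.sum_ite_eq']
      rfl
    rw [hval]
    split_ifs with hn
    · rw [sub_self, norm_zero]; positivity
    · have : n ∉ hfin.toFinset := fun h => hn (hs h)
      simp only [Finite.mem_toFinset, mem_ofPred_eq, not_not] at this
      rw [zero_sub, norm_neg]
      refine (norm_apply_le_dualSeminorm (m + 1) φ n).trans ?_
      rw [Real.div_rpow hr'.le hr.le, ← mul_div_assoc, div_lt_iff₀ (by positivity)] at this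
      exact this.le
  refine ⟨hW.topologicalAddGroup, hW.continuousSMul, hW.toLocallyConvexSpace, inferInstance,
    fun p hp => ?_⟩
  obtain ⟨s, C, -, h⟩ := Seminorm.bound_of_continuous hW p hp
  obtain ⟨m, hm⟩ : ∃ m, s.sup (dualSeminorm Φ) ≤ dualSeminorm Φ m :=
    ⟨s.sup id, Finset.sup_le fun i hi => dualSeminorm_mono (Finset.le_sup (f := id) hi)⟩
  have hpm : ∀ φ, p φ ≤ C * dualSeminorm Φ m φ := fun φ =>
    (h φ).trans (mul_le_mul_of_nonneg_left (hm φ) C.2)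
  -- The factor C + 1 is at least C, so that q dominates p, and at least 1, so that q bounds the
  -- coefficients without a further constant.
  set q : Seminorm ℂ (StrongDual ℂ E) := (C + 1) • dualSeminorm Φ (m + 1) with hq
  have hqa : ∀ φ, q φ = (C + 1) * dualSeminorm Φ (m + 1) φ := fun φ => rfl
  have hqc : Continuous q := continuous_seminorm_of_le (hW.continuous_seminorm (m + 1)) (C + 1)
    fun φ => (hqa φ).le
  have hpq : p ≤ q := fun φ => by
    rw [hqa]
    refine (hpm φ).trans (mul_le_mul (by simp) (dualSeminorm_mono (Nat.le_succ m) φ)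
      (apply_nonneg _ _) (by positivity))
  have hr := rad_pos m
  have hr' := rad_pos (m + 1)
  refine ⟨q, hqc, hpq, isNuclearMap_localMap hsum hp hpq (M := fun n => rad (m + 1) ^ rho α n)
    (fun n => by positivity) (fun n φ => ?_) ?_⟩
  · refine (norm_apply_le_dualSeminorm (m + 1) φ n).trans ?_
    rw [hqa, mul_comm]
    refine mul_le_mul_of_nonneg_left (le_mul_of_one_le_left (apply_nonneg _ _) (by simp))
      (by positivity)
  · have hs := (summable_linkMultiplier (d := d) hα m).mul_left (C : ℝ)
    refine Summable.of_nonneg_of_le (fun n => mul_nonneg (by positivity) (apply_nonneg p _))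
      (fun n => ?_) hs
    calc _ ≤ rad (m + 1) ^ rho α n * (C * (rad m)⁻¹ ^ rho α n) := by
          refine mul_le_mul_of_nonneg_left ((hpm (f n)).trans ?_) (by positivity)
          exact mul_le_mul_of_nonneg_left (hfn m n) C.2
      _ = _ := by
          rw [div_eq_mul_inv, Real.mul_rpow hr'.le (by positivity)]; ring

end dual

end LaguerreExpansion

open LaguerreExpansion in
theorem theorem6p1 (d : ℕ) (hd : 1 ≤ d) (α : ℝ) (hα : 1 ≤ α) :
    (∀ (f : GSSpace d α α) (n : Fin d → ℕ),
      IntegrableOn (fun t => f.1 t * laguerreFun n t) (orthant d)) ∧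
    (∃ Φ : GSSpace d α α ≃L[ℂ] SeqSpace d α, ∀ f n, (Φ f).1 n = laguerreCoeff f.1 n) ∧
    IsDFN (GSSpace d α α) ∧
    IsFN (StrongDual ℂ (GSSpace d α α)) ∧
    (∃ L : (Fin d → ℕ) → GSSpace d α α, (∀ n, (L n).1 = laguerreFun n) ∧
      ∀ f : GSSpace d α α, HasSum (fun n => laguerreCoeff f.1 n • L n) f) := by
  have Φ := coeffEquiv hd hα
  exact ⟨fun f n => integrableOn_mul_laguerreFun hd f.mem_schwartzOrthant n,
    ⟨coeffEquiv hd hα, fun _ _ => rfl⟩,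
    ⟨isNuclearSpace_of_equiv hd hα Φ, isDFS_of_equiv hα Φ⟩,
    ⟨isNuclearSpace_strongDual hd hα Φ, isFrechetSpace_strongDual hα Φ⟩,
    ⟨fun n => (coeffEquiv hd hα).symm (unitVec α n), fun n => laguerreSeries_single n,
      fun f => hasSum_symm_unitVec hα (coeffEquiv hd hα) f⟩⟩
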